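/- Let $d\ge 2$, let $\xi^+\neq\xi^-$ be points of the unit sphere $\mathbb S^{d-1}\subset\mathbb R^d$, and let $V_{\min}>0$. Let $\mathcal S$ be the set of $V\in C^2(\mathbb S^{d-1})$ such that $V(s)\ge V(\xi^\pm)=V_{\min}$ for all $s\in\mathbb S^{d-1}$ and such that, for some $\delta>0$ and $\mu>0$, $|s-\xi^\pm|<\delta$ implies $V(s)-V(\xi^\pm)\ge\mu|s-\xi^\pm|^2$. Let $\mathcal P=\mathcal S\times(0,2)$, with the product of the $C^2$ distance and the usual distance. Identify $(V,\alpha)\in\mathcal P$ with the $-\alpha$-homogeneous potential $V(x)=|x|^{-\alpha}V(x/|x|)$ on $\mathbb R^d\setminus\{0\}$, with $V(0)=+\infty$. For $a<b$ and $x\in H^1((a,b);\mathbb R^d)$ let $$\mathcal A([a,b];x)=\int_a^b\Big(\tfrac12|\dot x(t)|^2+V(x(t))\Big)\,dt\in[0,+\infty].$$ A parabolic Morse minimizer for $(V,\alpha)$, from $\xi^-$ to $\xi^+$, is a path $x\in H^1_{\mathrm{loc}}(\mathbb R;\mathbb R^d)$ such that $\min_{t\in\mathbb R}|x(t)|>0$;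 $|x(t)|\to+\infty$ and $x(t)/|x(t)|\to\xi^\pm$ as $t\to\pm\infty$; and, for all $a<b$, $a'<b'$ and $z\in H^1((a',b');\mathbb R^d)$ with $z(a')=x(a)$ and $z(b')=x(b)$, one has $\mathcal A([a,b];x)\le\mathcal A([a',b'];z)$. For $(V,\alpha)\in\mathcal P$ let $$c(V,\alpha)=\inf\{\mathcal A([a,b];x): a<b,\ x\in H^1((a,b);\mathbb R^d),\ x(a)=\xi^-,\ x(b)=\xi^+\},$$ and let $$\mathrm{In}=\Big\{(V,\alpha)\in\mathcal P: c(V,\alpha)=\frac{4\sqrt{2V_{\min}}}{2-\alpha}\Big\},\qquad \mathrm{Out}=\Big\{(V,\alpha)\in\mathcal P: c(V,\alpha)<\frac{4\sqrt{2V_{\min}}}{2-\alpha}\Big\},$$ $$\Pi=\partial\,\mathrm{In}\cap\partial\,\mathrm{Out},$$ the boundaries being taken in the metric space $\mathcal P$. Then $(V,\alpha)\in\mathcal P$ admits a parabolic Morse minimizer from $\xi^-$ to $\xi^+$ if and only if $(V,\alpha)\in\Pi$. -/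

import Mathlib

open MeasureTheory Set Filter Topology
open scoped ENNReal Manifold ContDiff

noncomputable section

/-- The configuration space `ℝ^d` with `d = n + 1`, with its Euclidean norm. -/
abbrev Conf (n : ℕ) : Type := EuclideanSpace ℝ (Fin (n + 1))

/-- The unit sphere `𝕊^{d-1}` of `ℝ^d`, `d = n + 1`. -/
abbrev USphere (n : ℕ) : Type := Metric.sphere (0 : Conf n) 1

/-- Radial projection `x ↦ x / |x|` of a nonzero vector to the unit sphere. -/
def toUSphere {n : ℕ} (x : Conf n) (hx : x ≠ 0) : USphere n :=
  ⟨‖x‖⁻¹ • x, by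
    rw [mem_sphere_zero_iff_norm, norm_smul, norm_inv, norm_norm,
      inv_mul_cancel₀ (norm_ne_zero_iff.mpr hx)]⟩

open Classical in
/-- The `0`-homogeneous extension `x ↦ U (x / |x|)` of a function `U` on the sphere
(with the irrelevant value `0` at the origin). -/
def radialExt {n : ℕ} (U : USphere n → ℝ) (x : Conf n) : ℝ :=
  if hx : x = 0 then 0 else U (toUSphere x hx)

/-! ### The metric space `C²(𝕊^{d-1})` -/

/-- Real functions of class `C²` on the sphere, as a manifold. -/
def C2Sphere (n : ℕ) : Type := C^2⟮𝓡 n, USphere n; ℝ⟯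

instance (n : ℕ) : CoeFun (C2Sphere n) (fun _ => USphere n → ℝ) := ⟨fun U => U.1⟩

theorem radialExt_contDiffAt {n : ℕ} (U : C2Sphere n) {x : Conf n} (hx : x ≠ 0) :
    ContDiffAt ℝ 2 (radialExt U) x := by
  have := Fact.mk (@finrank_euclideanSpace_fin ℝ _ (n + 1))
  let O : TopologicalSpace.Opens (Conf n) := ⟨{0}ᶜ, isOpen_compl_singleton⟩
  have hf : ContMDiff 𝓘(ℝ, Conf n) 𝓘(ℝ, Conf n) 2
      (fun y : O => ‖(y : Conf n)‖⁻¹ • (y : Conf n)) := by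
    intro y
    have hy : (y : Conf n) ≠ 0 := y.2
    have h : ContDiffAt ℝ 2 (fun z : Conf n => ‖z‖⁻¹ • z) (y : Conf n) :=
      ((contDiffAt_norm ℝ hy).inv (norm_ne_zero_iff.mpr hy)).smul contDiffAt_id
    exact (contMDiffAt_subtype_iff (U := O)
      (f := fun z : Conf n => ‖z‖⁻¹ • z)).mpr h.contMDiffAt
  have hg : ContMDiff 𝓘(ℝ, Conf n) (𝓡 n) 2 (fun y : O => toUSphere (y : Conf n) y.2) :=
    hf.codRestrict_sphere _
  have hU : ContMDiff 𝓘(ℝ, Conf n) 𝓘(ℝ, ℝ) 2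
      (fun y : O => U (toUSphere (y : Conf n) y.2)) := U.2.comp hg
  have hE : (fun y : O => U (toUSphere (y : Conf n) y.2)) = fun y : O => radialExt U y := by
    funext y
    have hy : (y : Conf n) ≠ 0 := y.2
    simp [radialExt, hy]
  rw [hE] at hU
  exact contMDiffAt_iff_contDiffAt.mp
    ((contMDiffAt_subtype_iff (U := O) (f := radialExt U)).mp (hU ⟨x, hx⟩))

theorem radialExt_fderiv_contDiffAt {n : ℕ} (U : C2Sphere n) {x : Conf n} (hx : x ≠ 0) :
    ContDiffAt ℝ 1 (fderiv ℝ (radialExt U)) x :=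
  (radialExt_contDiffAt U hx).fderiv_right (by norm_num)

theorem radialExt_iteratedFDeriv_continuousAt {n : ℕ} (U : C2Sphere n) {x : Conf n}
    (hx : x ≠ 0) : ContinuousAt (iteratedFDeriv ℝ 2 (radialExt U)) x :=
  ((radialExt_contDiffAt U hx).iteratedFDeriv_right (m := 0) (i := 2) (by norm_num)).continuousAt

theorem continuous_on_sphere {n : ℕ} {F : Type*} [TopologicalSpace F] {f : Conf n → F}
    (hf : ∀ x, x ≠ 0 → ContinuousAt f x) : Continuous (fun s : USphere n => f s) :=
  continuous_iff_continuousAt.mpr fun s =>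
    ContinuousAt.comp' (hf s (ne_zero_of_mem_unit_sphere s)) continuousAt_subtype_val

/-- The second order jet of `U ∈ C²(𝕊^{d-1})`: the values on the sphere of the `0`-homogeneous
extension of `U` and of its first and second differentials. -/
def jet2 {n : ℕ} (U : C2Sphere n) :
    C(USphere n, ℝ) × C(USphere n, Conf n →L[ℝ] ℝ) ×
      C(USphere n, Conf n [×2]→L[ℝ] ℝ) :=
  (⟨fun s => radialExt U s,
      continuous_on_sphere fun _ hx => (radialExt_contDiffAt U hx).continuousAt⟩,
   ⟨fun s => fderiv ℝ (radialExt U) s,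
      continuous_on_sphere fun _ hx => (radialExt_fderiv_contDiffAt U hx).continuousAt⟩,
   ⟨fun s => iteratedFDeriv ℝ 2 (radialExt U) s,
      continuous_on_sphere fun _ hx => radialExt_iteratedFDeriv_continuousAt U hx⟩)

theorem radialExt_coe {n : ℕ} (U : USphere n → ℝ) (s : USphere n) : radialExt U s = U s := by
  have hs : (s : Conf n) ≠ 0 := ne_zero_of_mem_unit_sphere s
  have h1 : toUSphere (s : Conf n) hs = s := by
    apply Subtype.ext
    simp [toUSphere]
  simp [radialExt, hs, h1]

theorem jet2_injective (n : ℕ) : Function.Injective (jet2 (n := n)) := by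
  intro U W h
  have h0 : (jet2 U).1 = (jet2 W).1 := congrArg Prod.fst h
  apply Subtype.ext
  funext s
  have hs : radialExt U s = radialExt W s := DFunLike.congr_fun h0 s
  rwa [radialExt_coe, radialExt_coe] at hs

/-- The `C²` distance: the largest of the uniform distances, over the (compact) sphere, of the
functions and of the first and second differentials of their `0`-homogeneous extensions. -/
instance (n : ℕ) : MetricSpace (C2Sphere n) :=
  MetricSpace.induced jet2 (jet2_injective n) inferInstance

/-! ### The classes of potentials -/

/-- The class `𝒮`: functions `U ∈ C²(𝕊^{d-1})` with global minimum `Vmin`, attained at both `ξm` and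
`ξp`, these two minimum points being non-degenerate. -/
def classS {n : ℕ} (ξm ξp : USphere n) (Vmin : ℝ) : Set (C2Sphere n) :=
  {U | U ξm = Vmin ∧ U ξp = Vmin ∧ (∀ s, Vmin ≤ U s) ∧
    ∃ δ > 0, ∃ μ > 0, ∀ ξ ∈ ({ξm, ξp} : Set (USphere n)), ∀ s : USphere n,
      ‖(s : Conf n) - ξ‖ < δ → μ * ‖(s : Conf n) - ξ‖ ^ 2 ≤ U s - U ξ}

/-- The class `𝒫` of pairs `(U, α)` with `U ∈ 𝒮` and `α ∈ (0,2)`. Below it is used as a type, which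
carries the subspace topology of the product `C²(𝕊^{d-1}) × (0,2)`. -/
def classP {n : ℕ} (ξm ξp : USphere n) (Vmin : ℝ) : Set (C2Sphere n × Ioo (0 : ℝ) 2) :=
  {p | p.1 ∈ classS ξm ξp Vmin}

open Classical in
/-- The `-α`-homogeneous potential `V(x) = U (x / |x|) / |x| ^ α`, with `V(0) = +∞`. -/
def potential {n : ℕ} (p : C2Sphere n × Ioo (0 : ℝ) 2) (x : Conf n) : ℝ≥0∞ :=
  if x = 0 then ∞ else ENNReal.ofReal (radialExt p.1 x / ‖x‖ ^ (p.2 : ℝ))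

/-! ### Sobolev paths and the action -/

/-- `x ∈ H¹((a,b); ℝ^d)`, given by its continuous representative on `[a,b]`: `x` is the primitive of
its derivative, which is square integrable. -/
def IsH1 {n : ℕ} (a b : ℝ) (x : ℝ → Conf n) : Prop :=
  MemLp (deriv x) 2 (volume.restrict (Icc a b)) ∧
    ∀ t ∈ Icc a b, x t = x a + ∫ s in a..t, deriv x s

/-- The (possibly infinite) Lagrangian action `∫_a^b (|x'|² / 2 + V(x)) dt`. -/
def action {n : ℕ} (p : C2Sphere n × Ioo (0 : ℝ) 2) (a b : ℝ) (x : ℝ → Conf n) : ℝ≥0∞ :=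
  ∫⁻ t in Icc a b, (ENNReal.ofReal (‖deriv x t‖ ^ 2 / 2) + potential p (x t))

/-- `x` is a free minimizer of the action of parabolic type in the sense of Morse, with ingoing and
outgoing asymptotic directions `ξm` and `ξp`. -/
structure IsParabolicMorseMinimizer {n : ℕ} (ξm ξp : USphere n)
    (p : C2Sphere n × Ioo (0 : ℝ) 2) (x : ℝ → Conf n) : Prop where
  h1_loc : ∀ a b : ℝ, a < b → IsH1 a b x
  min_pos : ∃ t₀ : ℝ, 0 < ‖x t₀‖ ∧ ∀ t, ‖x t₀‖ ≤ ‖x t‖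
  norm_atBot : Tendsto (fun t => ‖x t‖) atBot atTop
  norm_atTop : Tendsto (fun t => ‖x t‖) atTop atTop
  dir_atBot : Tendsto (fun t => ‖x t‖⁻¹ • x t) atBot (𝓝 (ξm : Conf n))
  dir_atTop : Tendsto (fun t => ‖x t‖⁻¹ • x t) atTop (𝓝 (ξp : Conf n))
  minimal : ∀ a b a' b' : ℝ, a < b → a' < b' → ∀ z : ℝ → Conf n, IsH1 a' b' z →
    z a' = x a → z b' = x b → action p a b x ≤ action p a' b' z

/-! ### The Bolza level and the regions `In`, `Out` -/

/-- `c(V)`: the infimum of the action among all `H¹` paths, on arbitrary bounded time intervals, from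
`ξm` to `ξp`. -/
def bolzaLevel {n : ℕ} (ξm ξp : USphere n) (p : C2Sphere n × Ioo (0 : ℝ) 2) : ℝ≥0∞ :=
  sInf {c | ∃ (a b : ℝ) (x : ℝ → Conf n), a < b ∧ IsH1 a b x ∧ x a = ξm ∧ x b = ξp ∧
    c = action p a b x}

/-- Potentials with inner minimizers. -/
def regionIn {n : ℕ} (ξm ξp : USphere n) (Vmin : ℝ) : Set (classP ξm ξp Vmin) :=
  {V | bolzaLevel ξm ξp V.1 = ENNReal.ofReal (4 * √(2 * Vmin) / (2 - (V.1.2 : ℝ)))}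

/-- Potentials with outer minimizers. -/
def regionOut {n : ℕ} (ξm ξp : USphere n) (Vmin : ℝ) : Set (classP ξm ξp Vmin) :=
  {V | bolzaLevel ξm ξp V.1 < ENNReal.ofReal (4 * √(2 * Vmin) / (2 - (V.1.2 : ℝ)))}

/-- The common boundary `Π` of the two regions, boundaries being taken in the metric space `𝒫`. -/
def interfacePi {n : ℕ} (ξm ξp : USphere n) (Vmin : ℝ) : Set (classP ξm ξp Vmin) :=
  frontier (regionIn ξm ξp Vmin) ∩ frontier (regionOut ξm ξp Vmin)

end

/-! Write `β = 1 - α/2` and `L = √(2 Vmin)/β`. Under a dilation by `l`, with time rescaled by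
`l^(1+α/2)`, the action is multiplied by `l^β`. The radial motion along a minimal ray from the
origin to radius `R` costs `L R^β`, so the threshold defining the regions is `2L`, the cost of going
from `ξ⁻` to `ξ⁺` through the origin. Hence `c ≤ 2L` always, and In is the complement of Out. Since
`c` is upper semicontinuous, Out is open, and `Π` is the set of points of the closure of Out that
are not in Out (`mem_interfacePi_iff`).

Lower bounds come from calibrations: a function whose differential is dominated by the Lagrangian
bounds the action below by its increment. The function `|x|^β/β` gives the radial bound `L |R^β -
r^β|`. Adding a small multiple of `|x|^β` times the cosine of the angle to `ξ` gives a bound that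
also sees the direction.

A minimizer forces `V ∈ Π`. If `c < 2L`, a dilated cheap path joins distant points of the minimizer
at cost at most `C R^β` up to a small multiple of `R^β`, with `C < 2L`, against the radial bound `2L
(R^β - r₀^β)` (`notMem_regionOut`). For the closure, replace the angular potential `U` by `(1-ε)U +
ε Vmin`. The action of a long arc then drops by at least a fixed amount `εη`, because `U` is not
identically minimal along the path. Closing the arc up along the minimal rays yields a cost below
`2L R^β`, provided the quantities `r^β θ²` at its ends are small, `θ` being the deviation of the
direction from its limit. Times where this holds exist because `(U - Vmin)/|x|^α` has bounded
integrals along the minimizer, while nondegeneracy of the minima and the growth bound `r^(2-β) =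
O(t)` would otherwise make it at least a multiple of `1/t` (`exists_small_deviation`,
`mem_closure_regionOut`).

Conversely, let `V ∈ Π`. For potentials of Out close to `V`, an almost optimal path from `ξ⁻` to
`ξ⁺` misses the origin. It is dilated so that its least distance to the origin is `1`, and prolonged
along the minimal rays to a large radius. The prolongation costs little because `c` is close to `2L`
near `V` (`exists_far_joined`). Comparison with paths through the origin makes these paths locally
bounded and equi-Hölder. A pointwise limit exists, is a free-time minimizer by lower semicontinuity
(`action_le_of_tendsto`), escapes to infinity, and has the right directions by the angular
calibration. -/

/-! ### Paths with a square integrable velocity -/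

/-- `v` is a square integrable velocity of the path `x` on `[a, b]`. -/
def HasVel {n : ℕ} (a b : ℝ) (x v : ℝ → Conf n) : Prop :=
  MemLp v 2 (volume.restrict (Icc a b)) ∧ ∀ t ∈ Icc a b, x t = x a + ∫ s in a..t, v s

theorem IsH1.hasVel {n : ℕ} {a b : ℝ} {x : ℝ → Conf n} (h : IsH1 a b x) :
    HasVel a b x (deriv x) := h

namespace HasVel

variable {n : ℕ} {a b c : ℝ} {x y v w : ℝ → Conf n}

theorem integrableOn (h : HasVel a b x v) : IntegrableOn v (Icc a b) :=
  h.1.integrable (by norm_num)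

theorem intervalIntegrable (h : HasVel a b x v) {s t : ℝ} (hs : s ∈ Icc a b) (ht : t ∈ Icc a b) :
    IntervalIntegrable v volume s t := by
  exact (h.integrableOn.mono_set (uIcc_subset_Icc hs ht)).intervalIntegrable

theorem sub_eq (h : HasVel a b x v) {s t : ℝ} (hs : s ∈ Icc a b) (ht : t ∈ Icc a b) :
    x t - x s = ∫ u in s..t, v u := by
  have ha : a ∈ Icc a b := ⟨le_rfl, hs.1.trans hs.2⟩
  rw [h.2 t ht, h.2 s hs, ← intervalIntegral.integral_interval_sub_left
    (h.intervalIntegrable ha ht) (h.intervalIntegrable ha hs)]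
  abel

theorem eq_add (h : HasVel a b x v) {s t : ℝ} (hs : s ∈ Icc a b) (ht : t ∈ Icc a b) :
    x t = x s + ∫ u in s..t, v u := by
  rw [← h.sub_eq hs ht]; abel

theorem mono (h : HasVel a b x v) {a' b' : ℝ} (ha : a ≤ a') (hb : b' ≤ b) :
    HasVel a' b' x v := by
  refine ⟨h.1.mono_measure (Measure.restrict_mono (Icc_subset_Icc ha hb) le_rfl), fun t ht => ?_⟩
  exact h.eq_add ⟨ha, (ht.1.trans ht.2).trans hb⟩ ⟨ha.trans ht.1, ht.2.trans hb⟩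

theorem congr (h : HasVel a b x v) (hab : a ≤ b) (hxy : ∀ t ∈ Icc a b, y t = x t) :
    HasVel a b y v := by
  refine ⟨h.1, fun t ht => ?_⟩
  rw [hxy t ht, hxy a ⟨le_rfl, hab⟩, h.2 t ht]

theorem congr_vel (h : HasVel a b x v) (hvw : ∀ᵐ t ∂(volume.restrict (Icc a b)), v t = w t) :
    HasVel a b x w := by
  refine ⟨(memLp_congr_ae hvw).mp h.1, fun t ht => ?_⟩
  rw [h.2 t ht]
  congr 1
  refine intervalIntegral.integral_congr_ae_restrict ?_
  refine ae_mono (Measure.restrict_mono ?_ le_rfl) hvw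
  rw [uIoc_of_le ht.1]
  exact Ioc_subset_Icc_self.trans (Icc_subset_Icc le_rfl ht.2)

theorem ae_hasDerivAt (h : HasVel a b x v) :
    ∀ᵐ t ∂(volume.restrict (Icc a b)), HasDerivAt x (v t) t := by
  rcases lt_or_ge b a with hba | hab
  · simp [Icc_eq_empty_of_lt hba]
  have haa : a ∈ Icc a b := ⟨le_rfl, hab⟩
  have hbb : b ∈ Icc a b := ⟨hab, le_rfl⟩
  -- Nothing is known about `x` outside `[a, b]`, so differentiability is claimed only at interior
  -- points.
  have h₁ : ∀ᵐ t : ℝ, t ≠ a := by simp [ae_iff, measure_singleton]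
  have h₂ : ∀ᵐ t : ℝ, t ≠ b := by simp [ae_iff, measure_singleton]
  rw [ae_restrict_iff' measurableSet_Icc]
  filter_upwards [(h.intervalIntegrable haa hbb).ae_hasDerivAt_integral, h₁, h₂] with t ht h1 h2 htm
  rw [uIcc_of_le hab] at ht
  have hd := (ht htm a haa).const_add (x a)
  refine hd.congr_of_eventuallyEq ?_
  filter_upwards [Icc_mem_nhds (lt_of_le_of_ne htm.1 (Ne.symm h1)) (lt_of_le_of_ne htm.2 h2)]
    with u hu using h.2 u hu

theorem ae_deriv_eq (h : HasVel a b x v) :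
    ∀ᵐ t ∂(volume.restrict (Icc a b)), v t = deriv x t :=
  h.ae_hasDerivAt.mono fun _ ht => ht.deriv.symm

/-- A velocity agrees almost everywhere with `deriv x`. Paths can thus be built with any convenient
`v`, insensitive to null sets and to values outside the interval. -/
theorem isH1 (h : HasVel a b x v) : IsH1 a b x := h.congr_vel h.ae_deriv_eq

theorem action_eq (h : HasVel a b x v) (p : C2Sphere n × Ioo (0 : ℝ) 2) :
    action p a b x =
      ∫⁻ t in Icc a b, (ENNReal.ofReal (‖v t‖ ^ 2 / 2) + potential p (x t)) := by
  refine lintegral_congr_ae (h.ae_deriv_eq.mono fun t ht => ?_)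
  simp only [ht]

theorem continuousOn (h : HasVel a b x v) : ContinuousOn x (Icc a b) := by
  rcases lt_or_ge b a with hba | hab
  · simp [Icc_eq_empty_of_lt hba]
  have := intervalIntegral.continuousOn_primitive_interval' (b₁ := a) (b₂ := b) (a := a) (μ := volume)
    (f := v) (h.intervalIntegrable ⟨le_rfl, hab⟩ ⟨hab, le_rfl⟩) left_mem_uIcc
  rw [uIcc_of_le hab] at this
  exact (this.const_add (x a)).congr fun t ht => h.2 t ht

theorem memLp_glue (h : MemLp v 2 (volume.restrict (Icc a b)))
    (h' : MemLp v 2 (volume.restrict (Icc b c))) :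
    MemLp v 2 (volume.restrict (Icc a c)) := by
  have hsub : Icc a c ⊆ Icc a b ∪ Icc b c := by
    intro t ht
    rcases le_total t b with h1 | h1
    · exact Or.inl ⟨ht.1, h1⟩
    · exact Or.inr ⟨h1, ht.2⟩
  have hm : AEStronglyMeasurable v (volume.restrict (Icc a b ∪ Icc b c)) :=
    (aestronglyMeasurable_union_iff).mpr ⟨h.1, h'.1⟩
  have : MemLp v 2 (volume.restrict (Icc a b ∪ Icc b c)) := by
    rw [memLp_two_iff_integrable_sq_norm hm]
    exact IntegrableOn.union ((memLp_two_iff_integrable_sq_norm h.1).mp h)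
      ((memLp_two_iff_integrable_sq_norm h'.1).mp h')
  exact this.mono_measure (Measure.restrict_mono hsub le_rfl)

theorem glue (h : HasVel a b x v) (h' : HasVel b c x v) (hab : a ≤ b) (hbc : b ≤ c) :
    HasVel a c x v := by
  refine ⟨memLp_glue h.1 h'.1, fun t ht => ?_⟩
  have haa : a ∈ Icc a b := ⟨le_rfl, hab⟩
  have hb : b ∈ Icc a b := ⟨hab, le_rfl⟩
  have hb' : b ∈ Icc b c := ⟨le_rfl, hbc⟩
  rcases le_total t b with h1 | h1
  · exact h.2 t ⟨ht.1, h1⟩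
  · have htc : t ∈ Icc b c := ⟨h1, ht.2⟩
    rw [h'.2 t htc, h.2 b hb, add_assoc,
      intervalIntegral.integral_add_adjacent_intervals (h.intervalIntegrable haa hb)
        (h'.intervalIntegrable hb' htc)]

theorem piecewise (h : HasVel a b x v) (h' : HasVel b c y w) (hab : a ≤ b) (hbc : b ≤ c)
    (hxy : x b = y b) :
    HasVel a c (fun t => if t ≤ b then x t else y t) (fun t => if t ≤ b then v t else w t) := by
  refine glue (b := b) ?_ ?_ hab hbc
  · refine (h.congr hab fun t ht => if_pos ht.2).congr_vel ?_
    filter_upwards [ae_restrict_mem measurableSet_Icc] with t ht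
    exact (if_pos ht.2).symm
  · refine (h'.congr hbc fun t ht => ?_).congr_vel ?_
    · rcases ht.1.eq_or_lt with h1 | h1
      · simp [← h1, hxy]
      · exact if_neg (not_le.mpr h1)
    · have h₁ : ∀ᵐ t : ℝ, t ≠ b := by simp [ae_iff, measure_singleton]
      filter_upwards [ae_restrict_mem measurableSet_Icc, ae_restrict_of_ae h₁] with t ht h1
      exact (if_neg (not_le.mpr (lt_of_le_of_ne ht.1 (Ne.symm h1)))).symm

/-- Negative `κ` is allowed, so one statement covers dilation, translation and time reversal. -/
theorem affine (h : HasVel a b x v) (l : ℝ) {κ : ℝ} (hκ : κ ≠ 0) (d : ℝ) {a' b' : ℝ}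
    (hab : a' ≤ b') (himg : ∀ t ∈ Icc a' b', κ * t + d ∈ Icc a b) :
    HasVel a' b' (fun t => l • x (κ * t + d)) (fun t => (l * κ) • v (κ * t + d)) := by
  have ha := himg a' ⟨le_rfl, hab⟩
  have hb := himg b' ⟨hab, le_rfl⟩
  have hab'' : a ≤ b := ha.1.trans ha.2
  have hsub : uIcc (κ * a' + d) (κ * b' + d) ⊆ Icc a b := uIcc_subset_Icc ha hb
  have hi : IntervalIntegrable (fun t => v (κ * t + d)) volume a' b' := by
    have h1 := (h.intervalIntegrable ha hb).comp_add_right d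
    have h2 := h1.comp_mul_left (c := κ)
    simpa [hκ] using h2
  have hi2 : IntervalIntegrable (fun t => ‖v (κ * t + d)‖ ^ 2) volume a' b' := by
    have h0 : IntervalIntegrable (fun t => ‖v t‖ ^ 2) volume (κ * a' + d) (κ * b' + d) := by
      refine IntegrableOn.intervalIntegrable ?_
      exact IntegrableOn.mono_set ((memLp_two_iff_integrable_sq_norm h.1.1).mp h.1) hsub
    have h1 := h0.comp_add_right d
    have h2 := h1.comp_mul_left (c := κ)
    simpa [hκ] using h2
  rw [intervalIntegrable_iff_integrableOn_Icc_of_le hab] at hi hi2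
  refine ⟨MemLp.const_smul ((memLp_two_iff_integrable_sq_norm hi.1).mpr hi2) (l * κ),
    fun t ht => ?_⟩
  rw [intervalIntegral.integral_smul, intervalIntegral.integral_comp_mul_add _ hκ,
    ← h.sub_eq ha (himg t ht), smul_smul, mul_assoc, mul_inv_cancel₀ hκ, mul_one, smul_sub]
  abel

end HasVel

/-! ### Additivity and homogeneity of the action -/

section Action

variable {n : ℕ} {a b c : ℝ} {x y : ℝ → Conf n} (p : C2Sphere n × Ioo (0 : ℝ) 2)

theorem action_add (x : ℝ → Conf n) (hab : a ≤ b) (hbc : b ≤ c) :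
    action p a c x = action p a b x + action p b c x := by
  unfold action
  have h : Icc a c = Icc a b ∪ Ioc b c := (Icc_union_Ioc_eq_Icc hab hbc).symm
  rw [h, lintegral_union measurableSet_Ioc, restrict_Ioc_eq_restrict_Icc]
  exact Set.disjoint_left.mpr fun t ht ht' => absurd ht.2 (not_le.mpr ht'.1)

theorem action_congr (hxy : ∀ t ∈ Icc a b, x t = y t) : action p a b x = action p a b y := by
  unfold action
  -- At the end points `deriv` depends on values outside the interval; they form a null set.
  rw [← restrict_Ioo_eq_restrict_Icc]
  refine setLIntegral_congr_fun measurableSet_Ioo fun t ht => ?_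
  have h : x =ᶠ[𝓝 t] y := by
    filter_upwards [Icc_mem_nhds ht.1 ht.2] with u hu using hxy u hu
  simp only [h.deriv_eq, h.eq_of_nhds]

theorem action_mono {a' b' : ℝ} (x : ℝ → Conf n) (ha : a ≤ a') (hb : b' ≤ b) :
    action p a' b' x ≤ action p a b x :=
  lintegral_mono_set (Icc_subset_Icc ha hb)

theorem radialExt_smul (U : USphere n → ℝ) {l : ℝ} (hl : 0 < l) (z : Conf n) :
    radialExt U (l • z) = radialExt U z := by
  by_cases hz : z = 0
  · simp [hz]
  · have hz' : l • z ≠ 0 := smul_ne_zero hl.ne' hz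
    have h : toUSphere (l • z) hz' = toUSphere z hz := by
      apply Subtype.ext
      simp only [toUSphere, norm_smul, Real.norm_eq_abs, abs_of_pos hl, mul_inv, smul_smul]
      congr 1
      field_simp
    simp [radialExt, hz, hz', h]

theorem potential_of_ne {z : Conf n} (hz : z ≠ 0) :
    potential p z = ENNReal.ofReal (radialExt p.1 z / ‖z‖ ^ (p.2 : ℝ)) := by
  simp [potential, hz]

theorem potential_smul {l : ℝ} (hl : 0 < l) (z : Conf n) :
    potential p (l • z) = ENNReal.ofReal (l ^ (-(p.2 : ℝ))) * potential p z := by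
  have hpos : 0 < l ^ (-(p.2 : ℝ)) := Real.rpow_pos_of_pos hl _
  by_cases hz : z = 0
  · simp only [potential, hz, smul_zero, if_true]
    rw [ENNReal.mul_top]
    simpa using hpos
  · rw [potential_of_ne p hz, potential_of_ne p (smul_ne_zero hl.ne' hz), radialExt_smul _ hl,
      ← ENNReal.ofReal_mul hpos.le, norm_smul, Real.norm_eq_abs, abs_of_pos hl,
      Real.mul_rpow hl.le (norm_nonneg _), Real.rpow_neg hl.le]
    congr 1
    field_simp

/-- The action of a path rescaled in space by `l` and in time by the factor `l ^ (1 + α / 2)`,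
possibly reversed. -/
theorem action_affine {l κ d a' b' : ℝ} (hl : 0 < l) (hκ : |κ| = l ^ (-(1 + (p.2 : ℝ) / 2)))
    (hx : IsH1 a b x) (hab : a' ≤ b') (himg : (fun t => κ * t + d) '' Icc a' b' = Icc a b) :
    action p a' b' (fun t => l • x (κ * t + d)) =
      ENNReal.ofReal (l ^ (1 - (p.2 : ℝ) / 2)) * action p a b x := by
  have hκ0 : κ ≠ 0 := by
    rw [← abs_pos, hκ]; exact Real.rpow_pos_of_pos hl _
  have hv := hx.hasVel.affine l hκ0 d hab fun t ht => by
    rw [← himg]; exact ⟨t, ht, rfl⟩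
  have hinj : InjOn (fun t => κ * t + d) (Icc a' b') := by
    intro s _ t _ hst
    simpa [hκ0] using hst
  have hda : ∀ t ∈ Icc a' b', HasDerivWithinAt (fun t => κ * t + d) κ (Icc a' b') t := by
    intro t _
    simpa using (((hasDerivAt_id t).const_mul κ).add_const d).hasDerivWithinAt
  have hpos : 0 < l ^ (1 - (p.2 : ℝ) / 2) := Real.rpow_pos_of_pos hl _
  rw [hv.action_eq, action, ← himg,
    lintegral_image_eq_lintegral_abs_deriv_mul measurableSet_Icc hda hinj,
    ← lintegral_const_mul' _ _ ENNReal.ofReal_ne_top]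
  refine lintegral_congr fun t => ?_
  -- Kinetic and potential energy both acquire the factor `l^(-α) = (lκ)²`, which is what dictates
  -- `|κ|`; the change of variables accounts for the remaining `|κ|`.
  have h1 : l ^ (1 - (p.2 : ℝ) / 2) * |κ| = l ^ (-(p.2 : ℝ)) := by
    rw [hκ, ← Real.rpow_add hl]; congr 1; ring
  have h2 : l ^ (-(p.2 : ℝ)) = (l * κ) ^ 2 := by
    rw [mul_pow, ← sq_abs κ, hκ, ← Real.rpow_natCast (l ^ (-(1 + (p.2 : ℝ) / 2))),
      ← Real.rpow_mul hl.le, ← Real.rpow_natCast l, ← Real.rpow_add hl]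
    congr 1; push_cast; ring
  rw [← mul_assoc, ← ENNReal.ofReal_mul hpos.le, h1, mul_add, potential_smul p hl,
    ← ENNReal.ofReal_mul (Real.rpow_nonneg hl.le _), norm_smul, mul_pow, Real.norm_eq_abs, sq_abs, h2]
  congr 2
  ring

end Action

/-! ### The cost of joining two points in free time -/

/-- The exponent `1 - α / 2` by which the action scales under dilations. -/
noncomputable def homExp {n : ℕ} (p : C2Sphere n × Ioo (0 : ℝ) 2) : ℝ := 1 - (p.2 : ℝ) / 2

theorem homExp_pos {n : ℕ} (p : C2Sphere n × Ioo (0 : ℝ) 2) : 0 < homExp p := by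
  have := p.2.2.2
  unfold homExp; linarith

theorem homExp_lt_one {n : ℕ} (p : C2Sphere n × Ioo (0 : ℝ) 2) : homExp p < 1 := by
  have := p.2.2.1
  unfold homExp; linarith

/-- `y` and `z` are joined by an `H¹` path with values in `K` and action at most `C`. -/
def JoinedAtCost {n : ℕ} (p : C2Sphere n × Ioo (0 : ℝ) 2) (K : Set (Conf n)) (y z : Conf n)
    (C : ℝ) : Prop :=
  0 ≤ C ∧ ∃ (b : ℝ) (x : ℝ → Conf n), 0 ≤ b ∧ IsH1 0 b x ∧ x 0 = y ∧ x b = z ∧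
    (∀ t ∈ Icc 0 b, x t ∈ K) ∧ action p 0 b x ≤ ENNReal.ofReal C

namespace JoinedAtCost

variable {n : ℕ} {p : C2Sphere n × Ioo (0 : ℝ) 2} {K K' : Set (Conf n)} {y z w : Conf n}
  {C D : ℝ}

theorem mono (h : JoinedAtCost p K y z C) (hK : K ⊆ K') (hC : C ≤ D) :
    JoinedAtCost p K' y z D := by
  obtain ⟨h0, b, x, hb, hx, h1, h2, h3, h4⟩ := h
  exact ⟨h0.trans hC, b, x, hb, hx, h1, h2, fun t ht => hK (h3 t ht),
    h4.trans (ENNReal.ofReal_le_ofReal hC)⟩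

theorem of_path {a b : ℝ} {x : ℝ → Conf n} (hab : a ≤ b) (hx : IsH1 a b x)
    (hK : ∀ t ∈ Icc a b, x t ∈ K) (hC : 0 ≤ C) (hact : action p a b x ≤ ENNReal.ofReal C) :
    JoinedAtCost p K (x a) (x b) C := by
  have himg : (fun t => (1 : ℝ) * t + a) '' Icc 0 (b - a) = Icc a b := by
    simp
  have h := action_affine p (l := 1) (κ := 1) (d := a) one_pos (by simp) hx (sub_nonneg.mpr hab) himg
  simp only [Real.one_rpow, ENNReal.ofReal_one, one_mul, one_smul] at h
  have hv := hx.hasVel.affine 1 one_ne_zero a (a' := 0) (b' := b - a) (sub_nonneg.mpr hab)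
    (fun t ht => by rw [← himg]; exact ⟨t, ht, rfl⟩)
  refine ⟨hC, b - a, fun t => x (t + a), sub_nonneg.mpr hab, ?_, by simp, by simp, ?_, ?_⟩
  · simpa using hv.isH1
  · exact fun t ht => hK _ ⟨by linarith [ht.1], by linarith [ht.2]⟩
  · rw [h]; exact hact

theorem refl (hy : y ∈ K) : JoinedAtCost p K y y 0 := by
  refine ⟨le_rfl, 0, fun _ => y, le_rfl, ?_, rfl, rfl, fun _ _ => hy, ?_⟩
  · refine ⟨by simp, fun t ht => by simp⟩
  · simp [action]

theorem trans (h : JoinedAtCost p K y z C) (h' : JoinedAtCost p K z w D) :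
    JoinedAtCost p K y w (C + D) := by
  obtain ⟨h0, b, x, hb, hx, h1, h2, h3, h4⟩ := h
  obtain ⟨h0', b', x', hb', hx', h1', h2', h3', h4'⟩ := h'
  have himg : (fun t => (1 : ℝ) * t + (-b)) '' Icc b (b + b') = Icc 0 b' := by
    simp
  have hact := action_affine p (l := 1) (κ := 1) (d := -b) one_pos (by simp) hx'
    (by linarith : b ≤ b + b') himg
  have hv := hx'.hasVel.affine 1 one_ne_zero (-b) (a' := b) (b' := b + b') (by linarith)
    (fun t ht => by rw [← himg]; exact ⟨t, ht, rfl⟩)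
  simp only [Real.one_rpow, ENNReal.ofReal_one, one_mul, one_smul] at hact hv
  have hg := hx.hasVel.piecewise hv hb (by linarith) (by simp [h1', h2])
  have e1 : action p 0 b (fun t => if t ≤ b then x t else x' (t + -b)) = action p 0 b x :=
    action_congr p fun t ht => if_pos ht.2
  have e2 : action p b (b + b') (fun t => if t ≤ b then x t else x' (t + -b)) =
      action p b (b + b') (fun t => x' (t + -b)) := by
    refine action_congr p fun t ht => ?_
    rcases ht.1.eq_or_lt with h | h
    · simp [← h, h1', h2]
    · exact if_neg (not_le.mpr h)
  refine ⟨add_nonneg h0 h0', b + b', _, add_nonneg hb hb', hg.isH1, by simp [hb, h1], ?_, ?_, ?_⟩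
  · rcases hb'.eq_or_lt with h | h
    · simp [← h, h2, ← h2', ← h1']
    · simp [h, h2']
  · intro t ht
    rcases le_or_gt t b with h | h
    · simpa [h] using h3 t ⟨ht.1, h⟩
    · simpa [not_le.mpr h] using h3' (t + -b) ⟨by linarith, by linarith [ht.2]⟩
  · rw [action_add p _ hb (by linarith), e1, e2, hact, ENNReal.ofReal_add h0 h0']
    exact add_le_add h4 h4'

theorem symm (h : JoinedAtCost p K y z C) : JoinedAtCost p K z y C := by
  obtain ⟨h0, b, x, hb, hx, h1, h2, h3, h4⟩ := h
  have himg : (fun t => (-1 : ℝ) * t + b) '' Icc 0 b = Icc 0 b := by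
    have : (fun t => (-1 : ℝ) * t + b) = fun t => b - t := by ext; ring
    rw [this]; simp
  have hact := action_affine p (l := 1) (κ := -1) (d := b) one_pos (by simp) hx hb himg
  have hv := hx.hasVel.affine 1 (neg_ne_zero.mpr one_ne_zero) b (a' := 0) (b' := b) hb
    (fun t ht => by rw [← himg]; exact ⟨t, ht, rfl⟩)
  simp only [Real.one_rpow, ENNReal.ofReal_one, one_mul, one_smul] at hact hv
  refine ⟨h0, b, _, hb, hv.isH1, by simp [h2], by simp [h1], ?_, ?_⟩
  · exact fun t ht => h3 _ ⟨by linarith [ht.2], by linarith [ht.1]⟩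
  · rw [hact]; exact h4

theorem smul (h : JoinedAtCost p K y z C) {l : ℝ} (hl : 0 < l) (hK : ∀ u ∈ K, l • u ∈ K') :
    JoinedAtCost p K' (l • y) (l • z) (l ^ homExp p * C) := by
  obtain ⟨h0, b, x, hb, hx, h1, h2, h3, h4⟩ := h
  set κ : ℝ := l ^ (-(1 + (p.2 : ℝ) / 2)) with hκd
  have hκ : 0 < κ := Real.rpow_pos_of_pos hl _
  have himg : (fun t => κ * t + 0) '' Icc 0 (b / κ) = Icc 0 b := by
    simp only [add_zero]
    rw [image_mul_left_Icc hκ.le (by positivity)]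
    simp [mul_div_cancel₀ b hκ.ne']
  have hb' : 0 ≤ b / κ := by positivity
  have hact := action_affine p (l := l) (κ := κ) (d := 0) hl (by rw [abs_of_pos hκ]) hx hb' himg
  have hv := hx.hasVel.affine l hκ.ne' 0 (a' := 0) (b' := b / κ) hb'
    (fun t ht => by rw [← himg]; exact ⟨t, ht, rfl⟩)
  have hpos : 0 ≤ l ^ homExp p := Real.rpow_nonneg hl.le _
  refine ⟨mul_nonneg hpos h0, b / κ, _, hb', hv.isH1, by simp [h1], ?_, ?_, ?_⟩
  · simp [mul_div_cancel₀ b hκ.ne', h2]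
  · intro t ht
    refine hK _ (h3 _ ?_)
    rw [← himg]; exact ⟨t, ht, rfl⟩
  · rw [hact, ENNReal.ofReal_mul hpos]
    exact mul_le_mul_right h4 _

theorem of_bolzaLevel_lt {ξm ξp : USphere n} (h : bolzaLevel ξm ξp p < ENNReal.ofReal C) :
    JoinedAtCost p univ ξm ξp C := by
  obtain ⟨c, ⟨a, b, x, hab, hx, ha, hb, rfl⟩, hlt⟩ := sInf_lt_iff.mp h
  have hC : 0 ≤ C := by
    by_contra hC
    rw [ENNReal.ofReal_of_nonpos (not_le.mp hC).le] at hlt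
    exact absurd hlt not_lt_zero
  rw [← ha, ← hb]
  exact of_path hab.le hx (fun _ _ => mem_univ _) hC hlt.le

theorem bolzaLevel_le {ξm ξp : USphere n} (hne : ξp ≠ ξm) (h : JoinedAtCost p K ξm ξp C) :
    bolzaLevel ξm ξp p ≤ ENNReal.ofReal C := by
  obtain ⟨h0, b, x, hb, hx, h1, h2, h3, h4⟩ := h
  -- Joining paths may have duration `0`, competitors for `bolzaLevel` may not; distinct ends
  -- exclude that case.
  have hb0 : 0 ≠ b := by
    rintro rfl
    exact hne (Subtype.ext (h2.symm.trans h1))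
  have hmem : action p 0 b x ∈ {c | ∃ (a b : ℝ) (x : ℝ → Conf n), a < b ∧ IsH1 a b x ∧
      x a = ξm ∧ x b = ξp ∧ c = action p a b x} :=
    ⟨0, b, x, lt_of_le_of_ne hb hb0, hx, h1, h2, rfl⟩
  exact (sInf_le hmem).trans h4

/-- A straight path covered with the speed `κ ρ ^ (-α / 2)` of a Kepler-like radial motion. -/
theorem of_radial_profile {κ B ρ₁ ρ₂ : ℝ} (hκ : 0 < κ) (hB : 0 ≤ B) (hρ₁ : 0 ≤ ρ₁)
    (hρ : ρ₁ ≤ ρ₂) (y e : Conf n) (hK : ∀ ρ ∈ Icc ρ₁ ρ₂, y + ρ • e ∈ K)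
    (hpot : ∀ ρ ∈ Ioc ρ₁ ρ₂, potential p (y + ρ • e) ≤ ENNReal.ofReal (B * ρ ^ (-(p.2 : ℝ)))) :
    JoinedAtCost p K (y + ρ₁ • e) (y + ρ₂ • e)
      ((‖e‖ ^ 2 * κ ^ 2 / 2 + B) / κ * ((ρ₂ ^ homExp p - ρ₁ ^ homExp p) / homExp p)) := by
  set α : ℝ := (p.2 : ℝ) with hα
  have hα0 : 0 < α := p.2.2.1
  have hα2 : α < 2 := p.2.2.2
  have hβ := homExp_pos p
  -- The profile `ρ(t) = (k t)^γ` solves `ρ' = κ ρ^(-α/2)`: this needs `γ - 1 = -αγ/2` and `γ k =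
  -- κ`.
  set γ : ℝ := 2 / (2 + α) with hγd
  have hγ : 0 < γ := by positivity
  have hγα : γ * (2 + α) = 2 := by rw [hγd]; field_simp
  set k : ℝ := κ / γ with hkd
  have hk : 0 < k := by positivity
  have hγk : γ * k = κ := by rw [hkd]; field_simp
  -- Kinetic energy and potential bound are both multiples of `(k t)^r`. Since `α < 2`, `r > -1` and
  -- a start at the origin has finite action.
  set r : ℝ := 2 * γ - 2 with hrd
  have hr1 : r + 1 = homExp p * γ := by unfold homExp; rw [← hα, hrd]; linarith
  have hr : -1 < r := by have : 0 < homExp p * γ := by positivity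
                         linarith
  have hαr : γ * (-α) = r := by rw [hrd]; linarith
  have hρ₂ : 0 ≤ ρ₂ := hρ₁.trans hρ
  set t₁ : ℝ := ρ₁ ^ γ⁻¹ / k with ht₁
  set t₂ : ℝ := ρ₂ ^ γ⁻¹ / k with ht₂
  have ht₁0 : 0 ≤ t₁ := by positivity
  have ht₁₂ : t₁ ≤ t₂ := by
    rw [ht₁, ht₂]; gcongr
  have hkt₁ : k * t₁ = ρ₁ ^ γ⁻¹ := by rw [ht₁]; field_simp
  have hkt₂ : k * t₂ = ρ₂ ^ γ⁻¹ := by rw [ht₂]; field_simp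
  have hρt₁ : (k * t₁) ^ γ = ρ₁ := by rw [hkt₁, Real.rpow_inv_rpow hρ₁ hγ.ne']
  have hρt₂ : (k * t₂) ^ γ = ρ₂ := by rw [hkt₂, Real.rpow_inv_rpow hρ₂ hγ.ne']
  let x : ℝ → Conf n := fun t => y + ((k * t) ^ γ) • e
  let v : ℝ → Conf n := fun t => (κ * (k * t) ^ (γ - 1)) • e
  have hcont : ContinuousOn x (Icc t₁ t₂) := by
    refine Continuous.continuousOn ?_
    have : Continuous fun t : ℝ => (k * t) ^ γ :=
      (continuous_const.mul continuous_id).rpow_const fun _ => Or.inr hγ.le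
    exact continuous_const.add (this.smul continuous_const)
  have hder : ∀ t ∈ Ioo t₁ t₂, HasDerivAt x (v t) t := by
    intro t ht
    have htp : 0 < k * t := mul_pos hk (ht₁0.trans_lt ht.1)
    have h1 : HasDerivAt (fun t : ℝ => k * t) k t := by
      simpa using (hasDerivAt_id t).const_mul k
    have h2 := (h1.rpow_const (p := γ) (Or.inl htp.ne')).smul_const e
    refine (h2.const_add y).congr_deriv ?_
    simp only [v]
    congr 1
    rw [← hγk]; ring
  have hInt : ∀ q : ℝ, -1 < q → IntervalIntegrable (fun t => (k * t) ^ q) volume t₁ t₂ := by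
    intro q hq
    have h1 := (intervalIntegral.intervalIntegrable_rpow' (a := k * t₁) (b := k * t₂) hq).comp_mul_left (c := k)
    simpa [hk.ne'] using h1
  have hvint : IntervalIntegrable v volume t₁ t₂ := by
    have h1 := (hInt (γ - 1) (by linarith)).const_mul κ
    exact h1.smul_continuousOn continuousOn_const
  have hv2 : ∀ t ∈ Icc t₁ t₂, ‖v t‖ ^ 2 = ‖e‖ ^ 2 * κ ^ 2 * (k * t) ^ r := by
    intro t ht
    have htp : 0 ≤ k * t := mul_nonneg hk.le (ht₁0.trans ht.1)
    simp only [v]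
    rw [norm_smul, mul_pow, Real.norm_eq_abs, sq_abs, mul_pow, ← Real.rpow_natCast ((k * t) ^ (γ - 1)),
      ← Real.rpow_mul htp]
    have : (γ - 1) * ((2 : ℕ) : ℝ) = r := by rw [hrd]; push_cast; ring
    rw [this]; ring
  have hvI : IntegrableOn v (Icc t₁ t₂) :=
    (intervalIntegrable_iff_integrableOn_Icc_of_le ht₁₂).mp hvint
  have hvel : HasVel t₁ t₂ x v := by
    refine ⟨?_, fun t ht => ?_⟩
    · rw [memLp_two_iff_integrable_sq_norm hvI.1]
      have h1 : IntegrableOn (fun t => ‖e‖ ^ 2 * κ ^ 2 * (k * t) ^ r) (Icc t₁ t₂) :=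
        (intervalIntegrable_iff_integrableOn_Icc_of_le ht₁₂).mp ((hInt r hr).const_mul _)
      exact h1.congr_fun (fun t ht => (hv2 t ht).symm) measurableSet_Icc
    · rw [intervalIntegral.integral_eq_sub_of_hasDerivAt_of_le ht.1
        (hcont.mono (Icc_subset_Icc le_rfl ht.2))
        (fun u hu => hder u ⟨hu.1, hu.2.trans_le ht.2⟩)
        (hvint.mono_set (by rw [uIcc_of_le ht.1, uIcc_of_le ht₁₂]; exact Icc_subset_Icc le_rfl ht.2))]
      abel
  set D : ℝ := ‖e‖ ^ 2 * κ ^ 2 / 2 + B with hD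
  have hD0 : 0 ≤ D := by positivity
  have hrange : ∀ t ∈ Icc t₁ t₂, (k * t) ^ γ ∈ Icc ρ₁ ρ₂ := by
    intro t ht
    have h0 : 0 ≤ t := ht₁0.trans ht.1
    constructor
    · rw [← hρt₁]; have := ht.1; gcongr
    · rw [← hρt₂]; have := ht.2; gcongr
  have hval : (∫ t in t₁..t₂, D * (k * t) ^ r) =
      D / κ * ((ρ₂ ^ homExp p - ρ₁ ^ homExp p) / homExp p) := by
    rw [intervalIntegral.integral_const_mul,
      intervalIntegral.integral_comp_mul_left (fun u => u ^ r) hk.ne',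
      integral_rpow (Or.inl hr), hkt₁, hkt₂, hr1, ← Real.rpow_mul hρ₁, ← Real.rpow_mul hρ₂]
    have : γ⁻¹ * (homExp p * γ) = homExp p := by field_simp
    rw [this, ← hγk, smul_eq_mul]
    field_simp
  have hact : action p t₁ t₂ x ≤
      ENNReal.ofReal (D / κ * ((ρ₂ ^ homExp p - ρ₁ ^ homExp p) / homExp p)) := by
    rw [hvel.action_eq, ← hval, intervalIntegral.integral_of_le ht₁₂, ← integral_Icc_eq_integral_Ioc,
      ofReal_integral_eq_lintegral_ofReal]
    -- The potential bound is assumed only for `ρ > ρ₁`, since the potential may be infinite at the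
    -- initial point.
    · have h₁ : ∀ᵐ t : ℝ, t ≠ t₁ := by simp [ae_iff, measure_singleton]
      refine lintegral_mono_ae ?_
      filter_upwards [ae_restrict_mem measurableSet_Icc, ae_restrict_of_ae h₁] with t ht hne
      have htp : 0 ≤ k * t := mul_nonneg hk.le (ht₁0.trans ht.1)
      have hlt : ρ₁ < (k * t) ^ γ := by
        have h3 : t₁ < t := lt_of_le_of_ne ht.1 (Ne.symm hne)
        rw [← hρt₁]; gcongr
      have h4 := hpot _ ⟨hlt, (hrange t ht).2⟩
      rw [← Real.rpow_mul htp, hαr] at h4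
      have e1 : D * (k * t) ^ r = ‖v t‖ ^ 2 / 2 + B * (k * t) ^ r := by
        rw [hv2 t ht, hD]; ring
      rw [e1, ENNReal.ofReal_add (by positivity) (by positivity)]
      exact add_le_add le_rfl h4
    · exact (intervalIntegrable_iff_integrableOn_Icc_of_le ht₁₂).mp ((hInt r hr).const_mul _)
    · filter_upwards [ae_restrict_mem measurableSet_Icc] with t ht
      have htp : 0 ≤ k * t := mul_nonneg hk.le (ht₁0.trans ht.1)
      positivity
  have hnn : 0 ≤ D / κ * ((ρ₂ ^ homExp p - ρ₁ ^ homExp p) / homExp p) := by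
    have : ρ₁ ^ homExp p ≤ ρ₂ ^ homExp p := by gcongr
    have : 0 ≤ ρ₂ ^ homExp p - ρ₁ ^ homExp p := by linarith
    positivity
  have hfin := of_path (p := p) (K := K) ht₁₂ hvel.isH1 (fun t ht => hK _ (hrange t ht)) hnn hact
  simpa only [x, hρt₁, hρt₂] using hfin

end JoinedAtCost

/-! ### Explicit competitors and their costs -/

section MorseMinimizers

variable {n : ℕ}

theorem toUSphere_smul_norm (z : Conf n) (hz : z ≠ 0) : ‖z‖ • (toUSphere z hz : Conf n) = z := by
  simp [toUSphere, smul_smul, norm_ne_zero_iff.mpr hz]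

theorem radialExt_of_ne (U : USphere n → ℝ) {z : Conf n} (hz : z ≠ 0) :
    radialExt U z = U (toUSphere z hz) := by
  simp [radialExt, hz]

theorem C2Sphere.le_norm_jet2 (U : C2Sphere n) (s : USphere n) : U s ≤ ‖(jet2 U).1‖ := by
  have h := (jet2 U).1.norm_coe_le_norm s
  have e : (jet2 U).1 s = U s := radialExt_coe U s
  rw [e] at h
  exact (le_abs_self _).trans h

theorem potential_smul_coe (p : C2Sphere n × Ioo (0 : ℝ) 2) {ρ : ℝ} (hρ : 0 < ρ)
    (s : USphere n) : potential p (ρ • (s : Conf n)) = ENNReal.ofReal (p.1 s * ρ ^ (-(p.2 : ℝ))) := by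
  have hs : (s : Conf n) ≠ 0 := ne_zero_of_mem_unit_sphere s
  rw [potential_of_ne p (smul_ne_zero hρ.ne' hs), radialExt_smul _ hρ, radialExt_coe, norm_smul,
    norm_eq_of_mem_sphere s, mul_one, Real.norm_of_nonneg hρ.le, Real.rpow_neg hρ.le]
  rfl

theorem norm_normalize_sub_le {z ξ : Conf n} {ρ : ℝ} (hρ : 0 < ρ) (hz : z ≠ 0) (hξ : ‖ξ‖ = 1) :
    ‖‖z‖⁻¹ • z - ξ‖ ≤ 2 * ‖z - ρ • ξ‖ / ρ := by
  have hz0 : 0 < ‖z‖ := norm_pos_iff.mpr hz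
  have e : ‖z‖⁻¹ • z - ξ = (‖z‖⁻¹ - ρ⁻¹) • z + ρ⁻¹ • (z - ρ • ξ) := by
    rw [smul_sub, smul_smul, inv_mul_cancel₀ hρ.ne', sub_smul]; simp
  have h1 : |ρ - ‖z‖| ≤ ‖z - ρ • ξ‖ := by
    have := abs_norm_sub_norm_le z (ρ • ξ)
    rwa [norm_smul, hξ, mul_one, Real.norm_of_nonneg hρ.le, abs_sub_comm] at this
  have h2 : ‖(‖z‖⁻¹ - ρ⁻¹) • z‖ = |ρ - ‖z‖| / ρ := by
    rw [norm_smul, Real.norm_eq_abs]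
    have : ‖z‖⁻¹ - ρ⁻¹ = (ρ - ‖z‖) / (‖z‖ * ρ) := by field_simp
    rw [this, abs_div, abs_of_pos (mul_pos hz0 hρ)]
    field_simp
  calc ‖‖z‖⁻¹ • z - ξ‖ ≤ ‖(‖z‖⁻¹ - ρ⁻¹) • z‖ + ‖ρ⁻¹ • (z - ρ • ξ)‖ := by
        rw [e]; exact norm_add_le _ _
    _ = |ρ - ‖z‖| / ρ + ‖z - ρ • ξ‖ / ρ := by
        rw [h2, norm_smul, Real.norm_of_nonneg (inv_nonneg.mpr hρ.le)]
        ring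
    _ ≤ ‖z - ρ • ξ‖ / ρ + ‖z - ρ • ξ‖ / ρ := by gcongr
    _ = _ := by ring

namespace JoinedAtCost

variable {p : C2Sphere n × Ioo (0 : ℝ) 2}

/-- The zero-energy speed `κ = √(2 U(s))` balances kinetic and potential energy, so the cost of
`of_radial_profile` is the Jacobi length of the segment. -/
theorem radial (s : USphere n) (hs : 0 < p.1 s) {ρ₁ ρ₂ : ℝ} (hρ₁ : 0 ≤ ρ₁) (hρ : ρ₁ ≤ ρ₂) :
    JoinedAtCost p {z | ρ₁ ≤ ‖z‖} (ρ₁ • (s : Conf n)) (ρ₂ • (s : Conf n))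
      (√(2 * p.1 s) / homExp p * (ρ₂ ^ homExp p - ρ₁ ^ homExp p)) := by
  have hκ : 0 < √(2 * p.1 s) := Real.sqrt_pos.mpr (by linarith)
  have h := of_radial_profile (p := p) (K := {z | ρ₁ ≤ ‖z‖}) hκ hs.le hρ₁ hρ 0 (s : Conf n)
    (fun ρ hρ' => by
      simp [norm_smul, abs_of_nonneg (hρ₁.trans hρ'.1), hρ'.1])
    (fun ρ hρ' => by
      rw [zero_add, potential_smul_coe p (hρ₁.trans_lt hρ'.1)])
  simp only [zero_add] at h
  refine h.mono subset_rfl (le_of_eq ?_)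
  rw [norm_eq_of_mem_sphere s, Real.sq_sqrt (by linarith)]
  have : (1 ^ 2 * (2 * p.1 s) / 2 + p.1 s) / √(2 * p.1 s) = √(2 * p.1 s) := by
    rw [div_eq_iff hκ.ne', Real.mul_self_sqrt (by linarith)]; ring
  rw [this]; ring

theorem zero_left {y : Conf n} (hy : y ≠ 0) (hpos : ∀ s, 0 < p.1 s) :
    JoinedAtCost p univ 0 y (√(2 * radialExt p.1 y) / homExp p * ‖y‖ ^ homExp p) := by
  have h := radial (p := p) (toUSphere y hy) (hpos _) le_rfl (norm_nonneg y)
  rw [toUSphere_smul_norm, zero_smul, Real.zero_rpow (homExp_pos p).ne', sub_zero] at h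
  rw [radialExt_of_ne _ hy]
  exact h.mono (subset_univ _) le_rfl

/-- Joining two points through the origin. -/
theorem through_zero {y z : Conf n} (hy : y ≠ 0) (hz : z ≠ 0) (hpos : ∀ s, 0 < p.1 s) :
    JoinedAtCost p univ y z (√(2 * radialExt p.1 y) / homExp p * ‖y‖ ^ homExp p +
      √(2 * radialExt p.1 z) / homExp p * ‖z‖ ^ homExp p) :=
  (zero_left hy hpos).symm.trans (zero_left hz hpos)

theorem through_zero_of_le {y z : Conf n} (hy : y ≠ 0) (hz : z ≠ 0) (hpos : ∀ s, 0 < p.1 s)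
    {M : ℝ} (hM : ∀ s, p.1 s ≤ M) :
    JoinedAtCost p univ y z (√(2 * M) / homExp p * (‖y‖ ^ homExp p + ‖z‖ ^ homExp p)) := by
  have hβ := homExp_pos p
  refine (through_zero hy hz hpos).mono subset_rfl ?_
  rw [mul_add, radialExt_of_ne _ hy, radialExt_of_ne _ hz]
  have h1 := hM (toUSphere y hy)
  have h2 := hM (toUSphere z hz)
  gcongr

/-- Nearby points away from the origin are joined at a cost controlled by their distance. -/
theorem of_near {M : ℝ} (hM0 : 0 ≤ M) (hM : ∀ s, p.1 s ≤ M) {y z : Conf n} (hy : 1 ≤ ‖y‖)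
    (hyz : ‖z - y‖ ≤ 1 / 2) :
    JoinedAtCost p univ y z ((1 / 2 + 16 * M) * ‖z - y‖) := by
  have hα0 : 0 < (p.2 : ℝ) := p.2.2.1
  have hα2 : (p.2 : ℝ) < 2 := p.2.2.2
  have hβ := homExp_pos p
  rcases eq_or_ne z y with rfl | hne
  · simpa using refl (p := p) (mem_univ z)
  set e := z - y with he
  have he0 : 0 < ‖e‖ := norm_pos_iff.mpr (sub_ne_zero.mpr hne)
  -- The segment is run over `ρ ∈ [1, 2]`, away from the singularity of the profile. Speed parameter
  -- `‖e‖⁻¹` makes the cost linear in `‖e‖`. The factor `16` is `4 · 4`: `‖u‖^(-α) ≤ 4` as `‖u‖ ≥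
  -- 1/2`, and `ρ^(-α) ≥ 1/4` as `ρ ≤ 2`.
  have h := of_radial_profile (p := p) (K := univ) (κ := ‖e‖⁻¹) (B := 16 * M) (ρ₁ := 1) (ρ₂ := 2)
    (by positivity) (by positivity) zero_le_one one_le_two (y - e) e (fun _ _ => mem_univ _) ?_
  · have e1 : y - e + (1 : ℝ) • e = y := by simp
    have e2 : y - e + (2 : ℝ) • e = z := by rw [two_smul, he]; abel
    rw [e1, e2] at h
    refine h.mono subset_rfl ?_
    have h3 : ((2 : ℝ) ^ homExp p - 1 ^ homExp p) / homExp p ≤ 1 := by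
      rw [div_le_one hβ, Real.one_rpow]
      have := rpow_one_add_le_one_add_mul_self (s := (1 : ℝ)) (by norm_num) hβ.le (homExp_lt_one p).le
      norm_num at this
      linarith
    have h4 : (‖e‖ ^ 2 * ‖e‖⁻¹ ^ 2 / 2 + 16 * M) / ‖e‖⁻¹ = (1 / 2 + 16 * M) * ‖e‖ := by
      field_simp
    rw [h4]
    exact mul_le_of_le_one_right (by positivity) h3
  · intro ρ hρ
    set u := y - e + ρ • e with hu
    have hun : 1 / 2 ≤ ‖u‖ := by
      have e3 : y = u + (1 - ρ) • e := by rw [hu, sub_smul, one_smul]; abel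
      have h5 : ‖(1 - ρ) • e‖ ≤ 1 / 2 := by
        rw [norm_smul, Real.norm_eq_abs]
        have : |1 - ρ| ≤ 1 := by rw [abs_le]; constructor <;> linarith [hρ.1, hρ.2]
        calc |1 - ρ| * ‖e‖ ≤ 1 * (1 / 2) := by gcongr
          _ = 1 / 2 := by norm_num
      have h6 : ‖y‖ ≤ ‖u‖ + ‖(1 - ρ) • e‖ := by
        conv_lhs => rw [e3]
        exact norm_add_le _ _
      linarith
    have hu0 : u ≠ 0 := norm_pos_iff.mp (by linarith)
    rw [potential_of_ne p hu0, radialExt_of_ne _ hu0]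
    refine ENNReal.ofReal_le_ofReal ?_
    have h7 : (1 / 4 : ℝ) ≤ ‖u‖ ^ (p.2 : ℝ) := by
      calc (1 / 4 : ℝ) = (1 / 2 : ℝ) ^ (2 : ℝ) := by norm_num
        _ ≤ (1 / 2 : ℝ) ^ (p.2 : ℝ) :=
          Real.rpow_le_rpow_of_exponent_ge (by norm_num) (by norm_num) hα2.le
        _ ≤ ‖u‖ ^ (p.2 : ℝ) := by gcongr
    have hρ0 : 0 < ρ := by linarith [hρ.1]
    have h8 : (1 / 4 : ℝ) ≤ ρ ^ (-(p.2 : ℝ)) := by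
      calc (1 / 4 : ℝ) = (2 : ℝ) ^ (-2 : ℝ) := by
            rw [Real.rpow_neg (by norm_num)]; norm_num
        _ ≤ (2 : ℝ) ^ (-(p.2 : ℝ)) :=
          Real.rpow_le_rpow_of_exponent_le (by norm_num) (by linarith)
        _ ≤ ρ ^ (-(p.2 : ℝ)) :=
          Real.rpow_le_rpow_of_nonpos hρ0 hρ.2 (by linarith)
    calc p.1 (toUSphere u hu0) / ‖u‖ ^ (p.2 : ℝ) ≤ M / ‖u‖ ^ (p.2 : ℝ) := by
          gcongr; exact hM _
      _ ≤ M / (1 / 4) := by gcongr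
      _ = 16 * M * (1 / 4) := by ring
      _ ≤ 16 * M * ρ ^ (-(p.2 : ℝ)) := by gcongr

/-- A point whose direction is close to a minimum `ξ` of the angular potential is joined to the ray
of direction `ξ` at a cost exceeding the radial one only quadratically. -/
theorem to_minimal_ray {ξ : USphere n} {m M : ℝ} (hm : 0 < m) (hM0 : 0 ≤ M)
    (hM : ∀ s, p.1 s ≤ m + M * ‖(s : Conf n) - ξ‖ ^ 2) :
    ∃ C, 0 ≤ C ∧ ∀ s : USphere n, ‖(s : Conf n) - ξ‖ ≤ 1 → ∀ r : ℝ, 0 < r →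
      JoinedAtCost p univ (r • (s : Conf n)) ((2 * r) • (ξ : Conf n))
        (√(2 * m) / homExp p * ((2 * r) ^ homExp p - r ^ homExp p) +
          C * (r ^ homExp p * ‖(s : Conf n) - ξ‖ ^ 2)) := by
  have hα0 : 0 < (p.2 : ℝ) := p.2.2.1
  have hα2 : (p.2 : ℝ) < 2 := p.2.2.2
  have hβ := homExp_pos p
  have hκ : 0 < √(2 * m) := Real.sqrt_pos.mpr (by linarith)
  have hκ2 : √(2 * m) ^ 2 = 2 * m := Real.sq_sqrt (by linarith)
  have h2β : 0 ≤ (2 : ℝ) ^ homExp p - 1 := by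
    have := Real.one_le_rpow (x := 2) (by norm_num) hβ.le
    linarith
  refine ⟨(5 * m + 16 * M) / √(2 * m) * ((2 ^ homExp p - 1) / homExp p), by positivity, ?_⟩
  intro s hs r hr
  set θ := ‖(s : Conf n) - ξ‖ with hθ
  have hθ0 : 0 ≤ θ := norm_nonneg _
  have hθ2 : θ ^ 2 ≤ 1 := pow_le_one₀ hθ0 hs
  have hsn : ‖(s : Conf n)‖ = 1 := norm_eq_of_mem_sphere s
  have hξn : ‖(ξ : Conf n)‖ = 1 := norm_eq_of_mem_sphere ξ
  have hin : inner ℝ (s : Conf n) (ξ : Conf n) = 1 - θ ^ 2 / 2 := by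
    have := norm_sub_sq_real (s : Conf n) (ξ : Conf n)
    rw [hsn, hξn, ← hθ] at this
    linarith
  -- The segment from `s` to `2ξ` is `ρ ξ + (2 - ρ)(s - ξ)` for `ρ ∈ [1, 2]`, a perturbation of the
  -- radial motion along `ξ` with parameter `ρ`.
  set e : Conf n := (2 : ℝ) • (ξ : Conf n) - s with he
  have hen : ‖e‖ ^ 2 = 1 + 2 * θ ^ 2 := by
    rw [he, norm_sub_sq_real, inner_smul_left, real_inner_comm, hin, norm_smul, hξn, hsn]
    norm_num
    ring
  -- The direction stays within `2θ` of `ξ`, whence the first factor. The second compensates `‖z‖ ≥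
  -- ρ(1 - θ²/2)`, using `α < 2`.
  set B : ℝ := (m + 4 * M * θ ^ 2) * (1 + 3 * θ ^ 2) with hB
  have h := of_radial_profile (p := p) (K := univ) (κ := √(2 * m)) (B := B) (ρ₁ := 1) (ρ₂ := 2)
    hκ (by positivity) zero_le_one one_le_two ((s : Conf n) - e) e (fun _ _ => mem_univ _) ?_
  · have e1 : (s : Conf n) - e + (1 : ℝ) • e = s := by simp
    have e2 : (s : Conf n) - e + (2 : ℝ) • e = (2 : ℝ) • (ξ : Conf n) := by
      rw [two_smul, he]; abel
    rw [e1, e2] at h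
    have h' := h.smul hr (K' := univ) fun _ _ => mem_univ _
    rw [smul_smul, mul_comm r 2] at h'
    refine h'.mono subset_rfl ?_
    rw [hen, hκ2, Real.one_rpow, Real.mul_rpow (by norm_num) hr.le]
    have hBle : B ≤ m + (3 * m + 16 * M) * θ ^ 2 := by
      rw [hB]
      nlinarith [mul_nonneg (mul_nonneg hM0 (sq_nonneg θ)) (sub_nonneg.mpr hθ2)]
    have hs2 : 2 * m / √(2 * m) = √(2 * m) := by
      rw [div_eq_iff hκ.ne', Real.mul_self_sqrt (by linarith)]
    have key : ((1 + 2 * θ ^ 2) * (2 * m) / 2 + B) / √(2 * m) ≤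
        √(2 * m) + (5 * m + 16 * M) / √(2 * m) * θ ^ 2 := by
      calc ((1 + 2 * θ ^ 2) * (2 * m) / 2 + B) / √(2 * m)
          ≤ (2 * m + (5 * m + 16 * M) * θ ^ 2) / √(2 * m) := by
            refine div_le_div_of_nonneg_right ?_ hκ.le
            linarith
        _ = 2 * m / √(2 * m) + (5 * m + 16 * M) / √(2 * m) * θ ^ 2 := by ring
        _ = _ := by rw [hs2]
    have hrp : 0 ≤ r ^ homExp p := Real.rpow_nonneg hr.le _
    have := mul_le_mul_of_nonneg_left (mul_le_mul_of_nonneg_right key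
      (div_nonneg h2β hβ.le)) hrp
    refine this.trans (le_of_eq ?_)
    ring
  · intro ρ hρ
    have hρ0 : 0 < ρ := by linarith [hρ.1]
    set z := (s : Conf n) - e + ρ • e with hz
    have hzρ : z - ρ • (ξ : Conf n) = (2 - ρ) • ((s : Conf n) - ξ) := by
      rw [hz, he]; module
    have h2ρ : |2 - ρ| ≤ 1 := by rw [abs_le]; constructor <;> linarith [hρ.1, hρ.2]
    have hd : ‖z - ρ • (ξ : Conf n)‖ ≤ θ := by
      rw [hzρ, norm_smul, Real.norm_eq_abs]
      exact mul_le_of_le_one_left hθ0 h2ρ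
    have hzn : ρ * (1 - θ ^ 2 / 2) ≤ ‖z‖ := by
      have h1 : inner ℝ z (ξ : Conf n) ≤ ‖z‖ := by
        have := real_inner_le_norm z (ξ : Conf n)
        rwa [hξn, mul_one] at this
      have h2 : inner ℝ z (ξ : Conf n) = ρ - (2 - ρ) * (θ ^ 2 / 2) := by
        have : z = ρ • (ξ : Conf n) + (2 - ρ) • ((s : Conf n) - ξ) := by rw [← hzρ]; abel
        rw [this, inner_add_left, inner_smul_left, inner_smul_left, inner_sub_left, hin,
          real_inner_self_eq_norm_sq, hξn]
        simp
        ring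
      have : (2 - ρ) * (θ ^ 2 / 2) ≤ ρ * (θ ^ 2 / 2) := by
        gcongr
        linarith [hρ.1]
      linarith
    have hw : 1 / 2 ≤ 1 - θ ^ 2 / 2 := by linarith
    have hz0 : 0 < ‖z‖ := lt_of_lt_of_le (by positivity) hzn
    have hzne : z ≠ 0 := norm_pos_iff.mp hz0
    rw [potential_of_ne p hzne, radialExt_of_ne _ hzne]
    refine ENNReal.ofReal_le_ofReal ?_
    have hdir : ‖(toUSphere z hzne : Conf n) - ξ‖ ≤ 2 * θ := by
      refine (norm_normalize_sub_le hρ0 hzne hξn).trans ?_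
      rw [div_le_iff₀ hρ0]
      have : 2 * θ * 1 ≤ 2 * θ * ρ := by gcongr; exact hρ.1.le
      linarith
    have hU : p.1 (toUSphere z hzne) ≤ m + 4 * M * θ ^ 2 := by
      refine (hM _).trans ?_
      have : ‖(toUSphere z hzne : Conf n) - ξ‖ ^ 2 ≤ (2 * θ) ^ 2 := by gcongr
      have := mul_le_mul_of_nonneg_left this hM0
      linarith
    have hpow : (1 - θ ^ 2 / 2) ^ 2 ≤ (1 - θ ^ 2 / 2) ^ (p.2 : ℝ) := by
      rw [← Real.rpow_natCast]
      exact Real.rpow_le_rpow_of_exponent_ge (by linarith) (by nlinarith) (by push_cast; linarith)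
    have hden : ρ ^ (p.2 : ℝ) * (1 - θ ^ 2 / 2) ^ 2 ≤ ‖z‖ ^ (p.2 : ℝ) := by
      calc ρ ^ (p.2 : ℝ) * (1 - θ ^ 2 / 2) ^ 2 ≤ ρ ^ (p.2 : ℝ) * (1 - θ ^ 2 / 2) ^ (p.2 : ℝ) := by
            gcongr
        _ = (ρ * (1 - θ ^ 2 / 2)) ^ (p.2 : ℝ) :=
            (Real.mul_rpow hρ0.le (by linarith)).symm
        _ ≤ _ := by gcongr
    have hinv : 1 ≤ (1 + 3 * θ ^ 2) * (1 - θ ^ 2 / 2) ^ 2 := by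
      nlinarith [mul_nonneg (sq_nonneg θ) (sub_nonneg.mpr hθ2), mul_nonneg (mul_nonneg (sq_nonneg θ) (sq_nonneg θ)) (sq_nonneg θ), sq_nonneg θ]
    have hρα : 0 < ρ ^ (p.2 : ℝ) := Real.rpow_pos_of_pos hρ0 _
    calc p.1 (toUSphere z hzne) / ‖z‖ ^ (p.2 : ℝ)
        ≤ (m + 4 * M * θ ^ 2) / ‖z‖ ^ (p.2 : ℝ) := by gcongr
      _ ≤ (m + 4 * M * θ ^ 2) / (ρ ^ (p.2 : ℝ) * (1 - θ ^ 2 / 2) ^ 2) := by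
          gcongr
      _ ≤ B * ρ ^ (-(p.2 : ℝ)) := by
          have h0 : 0 < 1 - θ ^ 2 / 2 := by linarith
          rw [Real.rpow_neg hρ0.le, div_le_iff₀ (by positivity), hB]
          have e4 : (m + 4 * M * θ ^ 2) * (1 + 3 * θ ^ 2) * (ρ ^ (p.2 : ℝ))⁻¹ *
              (ρ ^ (p.2 : ℝ) * (1 - θ ^ 2 / 2) ^ 2) =
              (m + 4 * M * θ ^ 2) * ((1 + 3 * θ ^ 2) * (1 - θ ^ 2 / 2) ^ 2) := by
            field_simp
          rw [e4]
          exact le_mul_of_one_le_right (by positivity) hinv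

end JoinedAtCost

/-- Near `ξ` the differential of the extension is Lipschitz and vanishes at the minimum, so the mean
value inequality gives a quadratic bound. At distance at least `δ` boundedness of `U` suffices. -/
theorem C2Sphere.le_add_sq_of_min (U : C2Sphere n) (ξ : USphere n) (hmin : ∀ s, U ξ ≤ U s) :
    ∃ M, 0 ≤ M ∧ ∀ s, U s ≤ U ξ + M * ‖(s : Conf n) - ξ‖ ^ 2 := by
  have hξ0 : (ξ : Conf n) ≠ 0 := ne_zero_of_mem_unit_sphere ξ
  have hC2 := radialExt_contDiffAt U hξ0
  have hlocmin : IsLocalMin (radialExt U) (ξ : Conf n) := by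
    filter_upwards [isOpen_compl_singleton.mem_nhds (show (ξ : Conf n) ∈ ({0}ᶜ : Set (Conf n)) from hξ0)]
      with z hz
    rw [radialExt_coe, radialExt_of_ne _ (show z ≠ 0 from hz)]
    exact hmin _
  have hcrit : fderiv ℝ (radialExt U) (ξ : Conf n) = 0 := hlocmin.fderiv_eq_zero
  obtain ⟨K, t, ht, hK⟩ := (radialExt_fderiv_contDiffAt U hξ0).exists_lipschitzOnWith
  obtain ⟨δ, hδ, hball⟩ := Metric.mem_nhds_iff.mp (inter_mem ht
    (isOpen_compl_singleton.mem_nhds (show (ξ : Conf n) ∈ ({0}ᶜ : Set (Conf n)) from hξ0)))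
  have hξt : (ξ : Conf n) ∈ t := mem_of_mem_nhds ht
  refine ⟨K + (‖(jet2 U).1‖ + |U ξ|) / δ ^ 2, by positivity, fun s => ?_⟩
  rcases lt_or_ge ‖(s : Conf n) - ξ‖ δ with hs | hs
  · have hconv := Convex.norm_image_sub_le_of_norm_fderiv_le (𝕜 := ℝ) (f := radialExt U)
      (C := K * ‖(s : Conf n) - ξ‖) (s := Metric.closedBall (ξ : Conf n) ‖(s : Conf n) - ξ‖)
      (x := (ξ : Conf n)) (y := (s : Conf n)) ?_ ?_ (convex_closedBall _ _)
      (by simp) (by simp [dist_eq_norm])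
    · rw [radialExt_coe, radialExt_coe, Real.norm_eq_abs] at hconv
      have h1 := (le_abs_self _).trans hconv
      have h2 : 0 ≤ (‖(jet2 U).1‖ + |U ξ|) / δ ^ 2 * ‖(s : Conf n) - ξ‖ ^ 2 := by positivity
      rw [add_mul]
      nlinarith
    · intro z hz
      have hz' : z ∈ Metric.ball (ξ : Conf n) δ :=
        lt_of_le_of_lt (Metric.mem_closedBall.mp hz) hs
      exact ((radialExt_contDiffAt U (hball hz').2).differentiableAt (by norm_num))
    · intro z hz
      have hz1 : dist z (ξ : Conf n) ≤ ‖(s : Conf n) - ξ‖ := Metric.mem_closedBall.mp hz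
      have hz' : z ∈ Metric.ball (ξ : Conf n) δ := lt_of_le_of_lt hz1 hs
      have h1 := hK.dist_le_mul z (hball hz').1 (ξ : Conf n) hξt
      rw [hcrit, dist_zero_right] at h1
      exact h1.trans (by gcongr)
  · have h1 := C2Sphere.le_norm_jet2 U s
    have h2 : -U ξ ≤ |U ξ| := neg_le_abs _
    have h3 : ‖(jet2 U).1‖ + |U ξ| ≤ (‖(jet2 U).1‖ + |U ξ|) / δ ^ 2 * ‖(s : Conf n) - ξ‖ ^ 2 := by
      rw [div_mul_eq_mul_div, le_div_iff₀ (by positivity)]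
      gcongr
    have h4 : 0 ≤ (K : ℝ) * ‖(s : Conf n) - ξ‖ ^ 2 := by positivity
    rw [add_mul]
    linarith

/-! ### Calibrations and lower bounds for the action -/

theorem AbsolutelyContinuousOnInterval.of_dist_le {X Y : Type*} [PseudoMetricSpace X]
    [PseudoMetricSpace Y] {f : ℝ → X} {g : ℝ → Y} {a b K : ℝ}
    (hf : AbsolutelyContinuousOnInterval f a b)
    (h : ∀ s ∈ uIcc a b, ∀ t ∈ uIcc a b, dist (g s) (g t) ≤ K * dist (f s) (f t)) :
    AbsolutelyContinuousOnInterval g a b := by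
  rw [absolutelyContinuousOnInterval_iff] at hf ⊢
  intro ε hε
  obtain ⟨δ, hδ, H⟩ := hf (ε / (|K| + 1)) (by positivity)
  refine ⟨δ, hδ, fun E hE hlen => ?_⟩
  have h1 := H E hE hlen
  calc ∑ i ∈ Finset.range E.1, dist (g (E.2 i).1) (g (E.2 i).2)
      ≤ ∑ i ∈ Finset.range E.1, (|K| + 1) * dist (f (E.2 i).1) (f (E.2 i).2) := by
        refine Finset.sum_le_sum fun i hi => ?_
        have hm := hE.1 i hi
        refine (h _ hm.1 _ hm.2).trans ?_
        gcongr
        linarith [le_abs_self K]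
    _ = (|K| + 1) * ∑ i ∈ Finset.range E.1, dist (f (E.2 i).1) (f (E.2 i).2) := by
        rw [Finset.mul_sum]
    _ < (|K| + 1) * (ε / (|K| + 1)) := by gcongr
    _ = ε := by field_simp

namespace HasVel

variable {a b : ℝ} {x v : ℝ → Conf n}

theorem norm_sub_le (h : HasVel a b x v) {s t : ℝ} (hs : s ∈ Icc a b) (ht : t ∈ Icc a b) :
    ‖x t - x s‖ ≤ |∫ u in s..t, ‖v u‖| := by
  rw [h.sub_eq hs ht]
  exact intervalIntegral.norm_integral_le_abs_integral_norm

theorem absolutelyContinuous (h : HasVel a b x v) (hab : a ≤ b) :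
    AbsolutelyContinuousOnInterval x a b := by
  have haa : a ∈ Icc a b := ⟨le_rfl, hab⟩
  have hbb : b ∈ Icc a b := ⟨hab, le_rfl⟩
  have hInt := (h.intervalIntegrable haa hbb).norm
  refine (hInt.absolutelyContinuousOnInterval_intervalIntegral left_mem_uIcc).of_dist_le
    (K := 1) fun s hs t ht => ?_
  rw [uIcc_of_le hab] at hs ht
  rw [one_mul, dist_comm, dist_comm (∫ _ in a..s, _), dist_eq_norm, Real.dist_eq,
    intervalIntegral.integral_interval_sub_left (h.intervalIntegrable haa ht).norm
      (h.intervalIntegrable haa hs).norm]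
  exact h.norm_sub_le hs ht

theorem absolutelyContinuous_comp (h : HasVel a b x v) (hab : a ≤ b) {G : Conf n → ℝ}
    (hG : ContDiff ℝ 1 G) : AbsolutelyContinuousOnInterval (fun t => G (x t)) a b := by
  have hac := h.absolutelyContinuous hab
  obtain ⟨R, hR⟩ := hac.exists_bound
  obtain ⟨K, hK⟩ := (hG.contDiffOn (s := Metric.closedBall 0 R)).exists_lipschitzOnWith
    (by norm_num) (convex_closedBall _ _) (isCompact_closedBall _ _)
  refine hac.of_dist_le (K := K) fun s hs t ht => ?_
  exact hK.dist_le_mul _ (by simpa using hR s hs) _ (by simpa using hR t ht)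

end HasVel

theorem ofReal_integral_le_lintegral {a b : ℝ} (hab : a ≤ b) {f : ℝ → ℝ} {g : ℝ → ℝ≥0∞}
    (hf : IntervalIntegrable f volume a b)
    (hfg : ∀ᵐ t ∂(volume.restrict (Icc a b)), ENNReal.ofReal (f t) ≤ g t) :
    ENNReal.ofReal (∫ t in a..b, f t) ≤ ∫⁻ t in Icc a b, g t := by
  have hi : IntegrableOn f (Icc a b) := (intervalIntegrable_iff_integrableOn_Icc_of_le hab).mp hf
  rw [intervalIntegral.integral_of_le hab, ← integral_Icc_eq_integral_Ioc]
  calc ENNReal.ofReal (∫ t in Icc a b, f t)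
      ≤ ENNReal.ofReal (∫ t in Icc a b, max (f t) 0) :=
        ENNReal.ofReal_le_ofReal (integral_mono hi hi.pos_part fun t => le_max_left _ _)
    _ = ∫⁻ t in Icc a b, ENNReal.ofReal (max (f t) 0) :=
        ofReal_integral_eq_lintegral_ofReal hi.pos_part (ae_of_all _ fun t => le_max_right _ _)
    _ ≤ ∫⁻ t in Icc a b, g t := by
        refine lintegral_mono_ae (hfg.mono fun t ht => ?_)
        rcases le_total (f t) 0 with h | h
        · simp [max_eq_right h]
        · rwa [max_eq_left h]

/-- The calibration principle: integrate the derivative of `G` along the path. No condition is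
needed where the path meets the origin, the potential being infinite there. -/
theorem IsH1.ofReal_sub_le_action {a b : ℝ} {x : ℝ → Conf n} (hx : IsH1 a b x) (hab : a ≤ b)
    (p : C2Sphere n × Ioo (0 : ℝ) 2) {G : Conf n → ℝ} (hG : ContDiff ℝ 1 G)
    (hcal : ∀ z w : Conf n, z ≠ 0 →
      fderiv ℝ G z w ≤ ‖w‖ ^ 2 / 2 + radialExt p.1 z / ‖z‖ ^ (p.2 : ℝ)) :
    ENNReal.ofReal (G (x b) - G (x a)) ≤ action p a b x := by
  have hac := hx.hasVel.absolutelyContinuous_comp hab hG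
  rw [← hac.integral_deriv_eq_sub]
  refine ofReal_integral_le_lintegral hab hac.intervalIntegrable_deriv ?_
  filter_upwards [hx.hasVel.ae_hasDerivAt] with t ht
  by_cases hz : x t = 0
  · simp [potential, hz]
  have hd : HasDerivAt (fun t => G (x t)) (fderiv ℝ G (x t) (deriv x t)) t :=
    ((hG.differentiable (by norm_num)) (x t)).hasFDerivAt.comp_hasDerivAt t ht
  rw [hd.deriv, potential_of_ne p hz]
  exact (ENNReal.ofReal_le_ofReal (hcal _ _ hz)).trans ENNReal.ofReal_add_le

/-- A function whose differential is bounded by the density of the Jacobi metric of the isotropic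
potential `1 / |x| ^ (2 - 2β)`, with a regularization `ε` at the origin. -/
noncomputable def calib (β c ε : ℝ) (ξ z : Conf n) : ℝ :=
  ((1 - c) * (‖z‖ ^ 2 + ε ^ 2) ^ (β / 2) +
    c * ((‖z‖ ^ 2 + ε ^ 2) ^ ((β - 1) / 2) * inner ℝ z ξ)) / β

theorem contDiff_calib {β c ε : ℝ} (hε : 0 < ε) (ξ : Conf n) :
    ContDiff ℝ 1 (calib β c ε ξ) := by
  have hQ : ContDiff ℝ 1 fun z : Conf n => ‖z‖ ^ 2 + ε ^ 2 :=
    (contDiff_norm_sq ℝ).add contDiff_const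
  have hpos : ∀ z : Conf n, ‖z‖ ^ 2 + ε ^ 2 ≠ 0 := fun z => by positivity
  have h1 := hQ.rpow_const_of_ne (p := β / 2) hpos
  have h2 := hQ.rpow_const_of_ne (p := (β - 1) / 2) hpos
  have h3 : ContDiff ℝ 1 fun z : Conf n => inner ℝ z ξ := contDiff_id.inner ℝ contDiff_const
  exact ((contDiff_const.mul h1).add (contDiff_const.mul (h2.mul h3))).div_const β

/-- For `ε = 0` the calibration is `r^β (1 - c w)/β`, with `w` equal to one minus the cosine of the
angle to `ξ`. In units of `r^(β-1)`, the left side is the squared radial plus the squared tangential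
derivative, as `w(2 - w)` is the squared sine. -/
theorem calib_coeff_le {β c w : ℝ} (hβ : 0 < β) (hc : 0 ≤ c) (hc' : c * (1 + β ^ 2) ≤ β ^ 2)
    (hw : 0 ≤ w) (hw' : w ≤ 2) :
    (1 - c * w) ^ 2 + (c / β) ^ 2 * (w * (2 - w)) ≤ 1 := by
  have h1 : (c / β) ^ 2 * (w * (2 - w)) = c * w * (c / β ^ 2 * (2 - w)) := by
    field_simp
  have h2 : c / β ^ 2 * (2 - w) ≤ c / β ^ 2 * 2 := by gcongr; linarith
  have h3 : c / β ^ 2 + c ≤ 1 := by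
    rw [← mul_le_mul_iff_left₀ (show 0 < β ^ 2 by positivity)]
    have : (c / β ^ 2 + c) * β ^ 2 = c * (1 + β ^ 2) := by field_simp
    linarith
  have h4 : c * w ≤ c * 2 := by gcongr
  have h5 : c * w * (c / β ^ 2 * (2 - w) + c * w - 2) ≤ 0 :=
    mul_nonpos_of_nonneg_of_nonpos (by positivity) (by linarith)
  rw [h1]
  nlinarith

/-- The regularized gradient is `q^(β-1) (A u + B ξ)` with `q = √(‖z‖² + ε²)` and `u = z/q`. As `‖u‖
≤ 1`, the vector has norm at most `1` by `calib_coeff_le`; as `q ≥ ‖z‖` and `β < 1`, `q^(β-1) ≤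
‖z‖^(β-1)`. -/
theorem abs_fderiv_calib_le {β c ε : ℝ} (hβ : 0 < β) (hβ1 : β < 1) (hε : 0 < ε) (hc : 0 ≤ c)
    (hc' : c * (1 + β ^ 2) ≤ β ^ 2) {ξ : Conf n} (hξ : ‖ξ‖ = 1) {z : Conf n} (hz : z ≠ 0)
    (w : Conf n) : |fderiv ℝ (calib β c ε ξ) z w| ≤ ‖z‖ ^ (β - 1) * ‖w‖ := by
  set Q : ℝ := ‖z‖ ^ 2 + ε ^ 2 with hQ
  have hz0 : 0 < ‖z‖ := norm_pos_iff.mpr hz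
  have hQ0 : 0 < Q := by positivity
  set q := √Q with hq
  have hq0 : 0 < q := Real.sqrt_pos.mpr hQ0
  have hq2 : q ^ 2 = Q := Real.sq_sqrt hQ0.le
  have hzq : ‖z‖ ≤ q := by
    rw [hq]; apply Real.le_sqrt_of_sq_le; rw [hQ]; nlinarith
  have hpow : ∀ e : ℝ, Q ^ (e / 2) = q ^ e := by
    intro e
    rw [← hq2, ← Real.rpow_natCast, ← Real.rpow_mul hq0.le]
    congr 1; push_cast; ring
  have hline : HasDerivAt (fun t : ℝ => z + t • w) w 0 := by
    simpa using ((hasDerivAt_id (0 : ℝ)).smul_const w).const_add z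
  have hN : HasDerivAt (fun t : ℝ => ‖z + t • w‖ ^ 2 + ε ^ 2) (2 * inner ℝ z w) 0 := by
    simpa using (hline.norm_sq).add_const (ε ^ 2)
  have hI : HasDerivAt (fun t : ℝ => inner ℝ (z + t • w) ξ) (inner ℝ w ξ) 0 := by
    simpa using hline.inner ℝ (hasDerivAt_const (0 : ℝ) ξ)
  have h1 := hN.rpow_const (p := β / 2) (Or.inl (by simp; positivity))
  have h2 := (hN.rpow_const (p := (β - 1) / 2) (Or.inl (by simp; positivity))).mul hI
  have h3 := ((h1.const_mul (1 - c)).add (h2.const_mul c)).div_const β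
  have h4 : HasDerivAt (fun t : ℝ => calib β c ε ξ (z + t • w))
      (fderiv ℝ (calib β c ε ξ) z w) 0 := by
    have hd := ((contDiff_calib (β := β) (c := c) hε ξ).differentiable (by norm_num) (z + (0 : ℝ) • w)).hasFDerivAt
    have := hd.comp_hasDerivAt 0 hline
    simp only [zero_smul, add_zero] at this
    exact this
  have h5 := h4.unique h3
  simp only [zero_smul, add_zero, ← hQ] at h5
  set u : Conf n := q⁻¹ • z with hu
  set k : ℝ := inner ℝ u ξ with hk
  set A : ℝ := (1 - c) + c * (β - 1) / β * k with hA
  set B : ℝ := c / β with hB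
  have hzu : z = q • u := by rw [hu, smul_smul, mul_inv_cancel₀ hq0.ne', one_smul]
  have hun : ‖u‖ ≤ 1 := by
    rw [hu, norm_smul, norm_inv, Real.norm_of_nonneg hq0.le, inv_mul_le_iff₀ hq0]; linarith
  clear_value u
  have hk1 : |k| ≤ 1 := by
    have := abs_real_inner_le_norm u ξ
    rw [hξ, mul_one] at this
    exact this.trans hun
  have e1 : Q ^ (β / 2 - 1) = q ^ (β - 1) / q := by
    rw [show β / 2 - 1 = (β - 2) / 2 by ring, hpow, show β - 2 = (β - 1) - 1 by ring,
      Real.rpow_sub_one hq0.ne']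
  have e2 : Q ^ ((β - 1) / 2 - 1) = q ^ (β - 1) / q ^ 2 := by
    rw [show (β - 1) / 2 - 1 = (β - 1 - 1 - 1) / 2 by ring, hpow, Real.rpow_sub_one hq0.ne',
      Real.rpow_sub_one hq0.ne']
    field_simp
  have e3 : Q ^ ((β - 1) / 2) = q ^ (β - 1) := hpow _
  have hform : fderiv ℝ (calib β c ε ξ) z w = q ^ (β - 1) * inner ℝ (A • u + B • ξ) w := by
    rw [h5, e1, e2, e3, inner_add_left, inner_smul_left, inner_smul_left]
    have i1 : inner ℝ z w = q * inner ℝ u w := by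
      rw [hzu, inner_smul_left]; rfl
    have i2 : inner ℝ z ξ = q * k := by
      rw [hzu, inner_smul_left]; rfl
    rw [i1, i2, real_inner_comm ξ w, hA, hB]
    simp only [conj_trivial]
    field_simp
    ring
  have hnorm : ‖A • u + B • ξ‖ ≤ 1 := by
    have hsq : ‖A • u + B • ξ‖ ^ 2 ≤ 1 := by
      rw [norm_add_sq_real, norm_smul, norm_smul, inner_smul_left, inner_smul_right, hξ, ← hk]
      simp only [Real.norm_eq_abs, mul_pow, sq_abs, conj_trivial, mul_one]
      have hu2 : A ^ 2 * ‖u‖ ^ 2 ≤ A ^ 2 * 1 := by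
        gcongr
        exact pow_le_one₀ (norm_nonneg _) hun
      have key := calib_coeff_le hβ hc hc' (w := 1 - k) (by linarith [(abs_le.mp hk1).2])
        (by linarith [(abs_le.mp hk1).1])
      have hAB : A + B * k = 1 - c * (1 - k) := by
        rw [hA, hB]; field_simp; ring
      have hAB' : A = 1 - c * (1 - k) - B * k := by linarith
      have : A ^ 2 * 1 + 2 * (A * (B * k)) + B ^ 2 * 1 =
          (1 - c * (1 - k)) ^ 2 + B ^ 2 * ((1 - k) * (2 - (1 - k))) := by
        rw [hAB']; ring
      norm_num at this ⊢
      linarith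
    nlinarith [norm_nonneg (A • u + B • ξ)]
  rw [hform, abs_mul, abs_of_pos (Real.rpow_pos_of_pos hq0 _)]
  calc q ^ (β - 1) * |inner ℝ (A • u + B • ξ) w| ≤ q ^ (β - 1) * (‖A • u + B • ξ‖ * ‖w‖) := by
        gcongr; exact abs_real_inner_le_norm _ _
    _ ≤ q ^ (β - 1) * (1 * ‖w‖) := by gcongr
    _ ≤ ‖z‖ ^ (β - 1) * ‖w‖ := by
        rw [one_mul]
        gcongr ?_ * _
        exact Real.rpow_le_rpow_of_nonpos hz0 hzq (by linarith)

section LowerBounds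

variable {p : C2Sphere n × Ioo (0 : ℝ) 2} {m : ℝ} {a b : ℝ} {x : ℝ → Conf n}

/-- Young's inequality turns the gradient bound into the calibration condition. It applies to both
signs, hence the absolute value. -/
theorem IsH1.ofReal_calib_le_action (hm : 0 < m) (hp : ∀ s, m ≤ p.1 s) (hx : IsH1 a b x)
    (hab : a ≤ b) {c ε : ℝ} (hε : 0 < ε) (hc : 0 ≤ c)
    (hc' : c * (1 + homExp p ^ 2) ≤ homExp p ^ 2) {ξ : Conf n} (hξ : ‖ξ‖ = 1) :
    ENNReal.ofReal (√(2 * m) * |calib (homExp p) c ε ξ (x b) - calib (homExp p) c ε ξ (x a)|) ≤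
      action p a b x := by
  have hβ := homExp_pos p
  have hβ1 := homExp_lt_one p
  have hsq : √(2 * m) ^ 2 = 2 * m := Real.sq_sqrt (by linarith)
  have key : ∀ σ : ℝ, |σ| = √(2 * m) →
      ENNReal.ofReal (σ * calib (homExp p) c ε ξ (x b) - σ * calib (homExp p) c ε ξ (x a)) ≤
      action p a b x := by
    intro σ hσ
    have hG := contDiff_calib (β := homExp p) (c := c) hε ξ
    refine hx.ofReal_sub_le_action hab p (G := fun z => σ * calib (homExp p) c ε ξ z)
      (contDiff_const.mul hG) fun z w hz => ?_
    have hz0 : 0 < ‖z‖ := norm_pos_iff.mpr hz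
    have hfd : fderiv ℝ (fun z => σ * calib (homExp p) c ε ξ z) z w =
        σ * fderiv ℝ (calib (homExp p) c ε ξ) z w := by
      rw [fderiv_const_mul (hG.differentiable (by norm_num) z)]
      simp
    rw [hfd]
    have h1 := abs_fderiv_calib_le hβ hβ1 hε hc hc' hξ hz w
    set N := ‖z‖ ^ (homExp p - 1) with hN
    have hN0 : 0 < N := Real.rpow_pos_of_pos hz0 _
    have hN2 : N ^ 2 = (‖z‖ ^ (p.2 : ℝ))⁻¹ := by
      rw [hN, ← Real.rpow_natCast, ← Real.rpow_mul hz0.le, ← Real.rpow_neg hz0.le]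
      congr 1
      unfold homExp; push_cast; ring
    have h2 : m * N ^ 2 ≤ radialExt p.1 z / ‖z‖ ^ (p.2 : ℝ) := by
      rw [hN2, div_eq_mul_inv, radialExt_of_ne _ hz]
      have := hp (toUSphere z hz)
      gcongr
    calc σ * fderiv ℝ (calib (homExp p) c ε ξ) z w
        ≤ |σ * fderiv ℝ (calib (homExp p) c ε ξ) z w| := le_abs_self _
      _ = √(2 * m) * |fderiv ℝ (calib (homExp p) c ε ξ) z w| := by rw [abs_mul, hσ]
      _ ≤ √(2 * m) * (N * ‖w‖) := by gcongr
      _ ≤ ‖w‖ ^ 2 / 2 + m * N ^ 2 := by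
          nlinarith [sq_nonneg (‖w‖ - √(2 * m) * N)]
      _ ≤ _ := by linarith
  rcases le_total (calib (homExp p) c ε ξ (x a)) (calib (homExp p) c ε ξ (x b)) with h | h
  · rw [abs_of_nonneg (sub_nonneg.mpr h), mul_sub]
    exact key _ (abs_of_nonneg (Real.sqrt_nonneg _))
  · have := key (-√(2 * m)) (by rw [abs_neg, abs_of_nonneg (Real.sqrt_nonneg _)])
    rw [abs_of_nonpos (sub_nonpos.mpr h)]
    convert this using 2
    ring

/-- The case `c = 0` keeps only the radial term and lets a path end at the origin, as needed for the
radial bound. -/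
theorem tendsto_calib_zero {β c : ℝ} (hβ : 0 < β) (ξ z : Conf n) (hz : z ≠ 0 ∨ c = 0) :
    Tendsto (fun ε => calib β c ε ξ z) (𝓝[>] 0)
      (𝓝 (((1 - c) * ‖z‖ ^ β + c * (‖z‖ ^ (β - 1) * inner ℝ z ξ)) / β)) := by
  have hQ : Tendsto (fun ε : ℝ => ‖z‖ ^ 2 + ε ^ 2) (𝓝[>] 0) (𝓝 (‖z‖ ^ 2)) := by
    have : Tendsto (fun ε : ℝ => ‖z‖ ^ 2 + ε ^ 2) (𝓝 0) (𝓝 (‖z‖ ^ 2 + 0 ^ 2)) :=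
      (continuous_const.add (continuous_id.pow 2)).tendsto 0
    simpa using this.mono_left nhdsWithin_le_nhds
  have e : ∀ q : ℝ, (‖z‖ ^ 2) ^ (q / 2) = ‖z‖ ^ q := by
    intro q
    rw [← Real.rpow_natCast, ← Real.rpow_mul (norm_nonneg z)]
    congr 1; push_cast; ring
  have h1 := (hQ.rpow_const (p := β / 2) (Or.inr (by positivity))).const_mul (1 - c)
  rw [e] at h1
  rcases hz with hz | rfl
  · have h2 := ((hQ.rpow_const (p := (β - 1) / 2)
      (Or.inl (by simpa using hz))).mul_const (inner ℝ z ξ)).const_mul c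
    rw [e] at h2
    exact (h1.add h2).div_const β
  · simpa [calib] using h1.div_const β

theorem IsH1.ofReal_calib_zero_le_action (hm : 0 < m) (hp : ∀ s, m ≤ p.1 s) (hx : IsH1 a b x)
    (hab : a ≤ b) {c : ℝ} (hc : 0 ≤ c) (hc' : c * (1 + homExp p ^ 2) ≤ homExp p ^ 2)
    {ξ : Conf n} (hξ : ‖ξ‖ = 1) (ha : x a ≠ 0 ∨ c = 0) (hb : x b ≠ 0 ∨ c = 0) :
    ENNReal.ofReal (√(2 * m) *
      |((1 - c) * ‖x b‖ ^ homExp p + c * (‖x b‖ ^ (homExp p - 1) * inner ℝ (x b) ξ)) / homExp p -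
      ((1 - c) * ‖x a‖ ^ homExp p + c * (‖x a‖ ^ (homExp p - 1) * inner ℝ (x a) ξ)) / homExp p|) ≤
      action p a b x := by
  have hβ := homExp_pos p
  have h := ((tendsto_calib_zero hβ ξ (x b) hb).sub (tendsto_calib_zero hβ ξ (x a) ha)).abs.const_mul
    (√(2 * m))
  refine le_of_tendsto (ENNReal.tendsto_ofReal h) ?_
  filter_upwards [self_mem_nhdsWithin] with ε hε
  exact hx.ofReal_calib_le_action hm hp hab hε hc hc' hξ

/-- The action controls the variation of `|x| ^ (1 - α / 2)`. -/
theorem IsH1.ofReal_radial_le_action (hm : 0 < m) (hp : ∀ s, m ≤ p.1 s) (hx : IsH1 a b x)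
    (hab : a ≤ b) :
    ENNReal.ofReal (√(2 * m) / homExp p * |‖x b‖ ^ homExp p - ‖x a‖ ^ homExp p|) ≤
      action p a b x := by
  have hβ := homExp_pos p
  obtain ⟨ξ, hξ⟩ : ∃ ξ : Conf n, ‖ξ‖ = 1 := ⟨EuclideanSpace.single 0 1, by simp⟩
  have h := hx.ofReal_calib_zero_le_action hm hp hab (c := 0) le_rfl (by rw [zero_mul]; positivity)
    hξ (Or.inr rfl) (Or.inr rfl)
  convert h using 2
  rw [zero_mul, zero_mul, add_zero, add_zero, sub_zero, one_mul, one_mul, ← sub_div, abs_div,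
    abs_of_pos hβ]
  ring

/-- Reaching the ray of direction `ξ` costs more than the radial motion if the initial direction
is different from `ξ`. -/
theorem IsH1.ofReal_angular_le_action (hm : 0 < m) (hp : ∀ s, m ≤ p.1 s) (hx : IsH1 a b x)
    (hab : a ≤ b) {c : ℝ} (hc : 0 ≤ c) (hc' : c * (1 + homExp p ^ 2) ≤ homExp p ^ 2)
    {ξ : Conf n} (hξ : ‖ξ‖ = 1) {t₁ t₂ R : ℝ} (ht : t₁ = a ∧ t₂ = b ∨ t₁ = b ∧ t₂ = a) (hR : 0 < R)
    (h1 : x t₁ ≠ 0) (h2 : x t₂ = R • ξ) :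
    ENNReal.ofReal (√(2 * m) / homExp p * (R ^ homExp p - ‖x t₁‖ ^ homExp p *
      (1 - c * (1 - inner ℝ (x t₁) ξ / ‖x t₁‖)))) ≤ action p a b x := by
  have hβ := homExp_pos p
  have hx0 : 0 < ‖x t₁‖ := norm_pos_iff.mpr h1
  have h2' : x t₂ ≠ 0 := by
    rw [h2]; exact smul_ne_zero hR.ne' (norm_pos_iff.mp (by rw [hξ]; exact one_pos))
  have hnR : ‖x t₂‖ = R := by rw [h2, norm_smul, hξ, mul_one, Real.norm_of_nonneg hR.le]
  have hiR : inner ℝ (x t₂) ξ = R := by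
    rw [h2, inner_smul_left, real_inner_self_eq_norm_sq, hξ]; simp
  have key : ENNReal.ofReal (√(2 * m) *
      |((1 - c) * ‖x t₂‖ ^ homExp p + c * (‖x t₂‖ ^ (homExp p - 1) * inner ℝ (x t₂) ξ)) / homExp p -
      ((1 - c) * ‖x t₁‖ ^ homExp p + c * (‖x t₁‖ ^ (homExp p - 1) * inner ℝ (x t₁) ξ)) / homExp p|) ≤
      action p a b x := by
    rcases ht with ⟨rfl, rfl⟩ | ⟨rfl, rfl⟩
    · exact hx.ofReal_calib_zero_le_action hm hp hab hc hc' hξ (Or.inl h1) (Or.inl h2')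
    · rw [abs_sub_comm]
      exact hx.ofReal_calib_zero_le_action hm hp hab hc hc' hξ (Or.inl h2') (Or.inl h1)
  refine le_trans (ENNReal.ofReal_le_ofReal ?_) key
  have e1 : ‖x t₁‖ ^ (homExp p - 1) = ‖x t₁‖ ^ homExp p / ‖x t₁‖ := Real.rpow_sub_one hx0.ne' _
  have e2 : R ^ (homExp p - 1) = R ^ homExp p / R := Real.rpow_sub_one hR.ne' _
  rw [hnR, hiR, e1, e2]
  have e3 : √(2 * m) / homExp p * (R ^ homExp p - ‖x t₁‖ ^ homExp p *
      (1 - c * (1 - inner ℝ (x t₁) ξ / ‖x t₁‖))) = √(2 * m) *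
      (((1 - c) * R ^ homExp p + c * (R ^ homExp p / R * R)) / homExp p -
      ((1 - c) * ‖x t₁‖ ^ homExp p + c * (‖x t₁‖ ^ homExp p / ‖x t₁‖ * inner ℝ (x t₁) ξ)) / homExp p) := by
    field_simp
    ring
  rw [e3]
  gcongr
  exact le_abs_self _

theorem IsH1.norm_sub_sq_le (hx : IsH1 a b x) (hab : a ≤ b) {Q : ℝ} (hQ : 0 ≤ Q)
    (hact : action p a b x ≤ ENNReal.ofReal Q) : ‖x b - x a‖ ^ 2 ≤ 2 * (b - a) * Q := by
  rcases hab.eq_or_lt with rfl | hlt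
  · simp
  have haa : a ∈ Icc a b := ⟨le_rfl, hab⟩
  have hbb : b ∈ Icc a b := ⟨hab, le_rfl⟩
  have hv := hx.hasVel
  have hsq : IntegrableOn (fun t => ‖deriv x t‖ ^ 2) (Icc a b) :=
    (memLp_two_iff_integrable_sq_norm hv.1.1).mp hv.1
  have hkin : ∫ t in Icc a b, ‖deriv x t‖ ^ 2 / 2 ≤ Q := by
    have h1 : ENNReal.ofReal (∫ t in Icc a b, ‖deriv x t‖ ^ 2 / 2) ≤ ENNReal.ofReal Q := by
      rw [ofReal_integral_eq_lintegral_ofReal (hsq.div_const 2)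
        (ae_of_all _ fun t => by positivity)]
      exact le_trans (lintegral_mono fun t => le_self_add) hact
    exact (ENNReal.ofReal_le_ofReal_iff hQ).mp h1
  set D := ‖x b - x a‖ with hD
  have hD0 : 0 ≤ D := norm_nonneg _
  have hba : 0 < b - a := sub_pos.mpr hlt
  -- The mean speed is the best weight in `k‖v‖ ≤ ‖v‖²/2 + k²/2`; the outcome is Cauchy–Schwarz for
  -- the kinetic energy.
  set k := D / (b - a) with hk
  have hk0 : 0 ≤ k := by positivity
  have hn : D ≤ ∫ t in Icc a b, ‖deriv x t‖ := by
    have := hv.norm_sub_le haa hbb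
    rw [intervalIntegral.integral_of_le hab, ← integral_Icc_eq_integral_Ioc,
      abs_of_nonneg (integral_nonneg fun t => norm_nonneg _)] at this
    exact this
  have hle : ∫ t in Icc a b, k * ‖deriv x t‖ ≤ ∫ t in Icc a b, (‖deriv x t‖ ^ 2 / 2 + k ^ 2 / 2) := by
    refine integral_mono (hv.integrableOn.norm.const_mul k)
      ((hsq.div_const 2).add (integrable_const _)) fun t => ?_
    dsimp only
    nlinarith [sq_nonneg (‖deriv x t‖ - k)]
  rw [integral_const_mul, integral_add (hsq.div_const 2) (integrable_const _), integral_const,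
    measureReal_restrict_apply_univ, Real.volume_real_Icc_of_le hab, smul_eq_mul] at hle
  have h3 : k * D ≤ Q + (b - a) * (k ^ 2 / 2) := by
    have := mul_le_mul_of_nonneg_left hn hk0
    linarith
  have h4 : k * (b - a) = D := by rw [hk]; field_simp
  have h5 : k * D * (b - a) ≤ (Q + (b - a) * (k ^ 2 / 2)) * (b - a) := by gcongr
  have h6 : k * D * (b - a) = D ^ 2 := by rw [mul_right_comm, h4]; ring
  have h7 : (b - a) * (k ^ 2 / 2) * (b - a) = D ^ 2 / 2 := by rw [← h4]; ring
  rw [add_mul, h6, h7] at h5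
  linarith

/-- Potential energy alone: a path confined to a ball pays in proportion to its duration. -/
theorem ofReal_mul_le_action {M : ℝ} (hm : 0 < m) (hp : ∀ s, m ≤ p.1 s) (hM : 0 < M)
    (hxM : ∀ t ∈ Icc a b, ‖x t‖ ≤ M) :
    ENNReal.ofReal ((b - a) * (m * M ^ (-(p.2 : ℝ)))) ≤ action p a b x := by
  have hα0 : 0 < (p.2 : ℝ) := p.2.2.1
  have h1 : ∫⁻ _ in Icc a b, ENNReal.ofReal (m * M ^ (-(p.2 : ℝ))) ≤ action p a b x := by
    refine setLIntegral_mono' measurableSet_Icc fun t ht => ?_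
    refine le_trans ?_ le_add_self
    by_cases hz : x t = 0
    · simp [potential, hz]
    · rw [potential_of_ne p hz, radialExt_of_ne _ hz, Real.rpow_neg hM.le, ← div_eq_mul_inv]
      have hz0 : 0 < ‖x t‖ := norm_pos_iff.mpr hz
      have := hp (toUSphere (x t) hz)
      have := hxM t ht
      gcongr
      linarith
  refine le_trans (le_of_eq ?_) h1
  rw [lintegral_const, Measure.restrict_apply_univ, Real.volume_Icc, mul_comm,
    ENNReal.ofReal_mul (by positivity)]

end LowerBounds

/-! ### Dependence of the costs on the potential -/

theorem C2Sphere.abs_sub_le_dist (U W : C2Sphere n) (s : USphere n) : |U s - W s| ≤ dist U W := by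
  have h1 : dist ((jet2 U).1 s) ((jet2 W).1 s) ≤ dist (jet2 U).1 (jet2 W).1 :=
    ContinuousMap.dist_apply_le_dist s
  have h2 : dist (jet2 U).1 (jet2 W).1 ≤ dist (jet2 U) (jet2 W) := le_max_left _ _
  have e1 : (jet2 U).1 s = U s := radialExt_coe U s
  have e2 : (jet2 W).1 s = W s := radialExt_coe W s
  rw [e1, e2, Real.dist_eq] at h1
  exact h1.trans h2

theorem continuous_homExp : Continuous (homExp (n := n)) := by
  unfold homExp
  exact continuous_const.sub ((continuous_subtype_val.comp continuous_snd).div_const 2)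

/-- The cost of the radial motion from the origin to the unit sphere, for an angular potential
equal to `m`. -/
noncomputable def rayCost (m : ℝ) (p : C2Sphere n × Ioo (0 : ℝ) 2) : ℝ := √(2 * m) / homExp p

theorem continuous_rayCost (m : ℝ) : Continuous (rayCost (n := n) m) :=
  continuous_const.div continuous_homExp fun p => (homExp_pos p).ne'

theorem rayCost_pos {m : ℝ} (hm : 0 < m) (p : C2Sphere n × Ioo (0 : ℝ) 2) : 0 < rayCost m p :=
  div_pos (Real.sqrt_pos.mpr (by linarith)) (homExp_pos p)

theorem two_rayCost (m : ℝ) (p : C2Sphere n × Ioo (0 : ℝ) 2) :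
    4 * √(2 * m) / (2 - (p.2 : ℝ)) = 2 * rayCost m p := by
  have h : (2 - (p.2 : ℝ)) ≠ 0 := by have := p.2.2.2; linarith
  have h' : (2 - (p.2 : ℝ)) = 2 * homExp p := by unfold homExp; ring
  have := (homExp_pos p).ne'
  rw [h', rayCost]
  field_simp
  ring

section Compare

variable {p : C2Sphere n × Ioo (0 : ℝ) 2} {m : ℝ}

theorem eventually_abs_angular_sub_lt (p : C2Sphere n × Ioo (0 : ℝ) 2) {η : ℝ} (hη : 0 < η) :
    ∀ᶠ p' in 𝓝 p, ∀ s, |p'.1 s - p.1 s| < η := by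
  have h : ∀ᶠ p' in 𝓝 p, dist p'.1 p.1 < η :=
    (continuous_fst.tendsto p).eventually (Metric.ball_mem_nhds _ hη)
  filter_upwards [h] with p' hp' s
  exact (C2Sphere.abs_sub_le_dist _ _ s).trans_lt hp'

theorem eventually_bounds (hm : 0 < m) (hp : ∀ s, m ≤ p.1 s) :
    ∀ᶠ p' in 𝓝 p, ∀ s, 0 < p'.1 s ∧ p'.1 s ≤ ‖(jet2 p.1).1‖ + m := by
  filter_upwards [eventually_abs_angular_sub_lt p hm] with p' h s
  have h1 := abs_lt.mp (h s)
  have h2 := C2Sphere.le_norm_jet2 p.1 s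
  have h3 := hp s
  constructor <;> linarith [h1.1, h1.2]

theorem eventually_homExp_gt (p : C2Sphere n × Ioo (0 : ℝ) 2) :
    ∀ᶠ p' in 𝓝 p, homExp p / 2 < homExp p' :=
  (continuous_homExp.tendsto p).eventually (lt_mem_nhds (by linarith [homExp_pos p]))

/-- One factor `1 + τ` compares the angular parts, bounded below by `m`; the other compares the
powers of `‖z‖`, whose logarithm is bounded on the annulus. Near the origin a change of exponent
makes the ratio degenerate. -/
theorem eventually_potential_le (hm : 0 < m) (hp : ∀ s, m ≤ p.1 s) {ρ M δ : ℝ} (hρ : 0 < ρ)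
    (hδ : 0 < δ) :
    ∀ᶠ p' in 𝓝 p, ∀ z : Conf n, ρ ≤ ‖z‖ → ‖z‖ ≤ M →
      potential p' z ≤ ENNReal.ofReal (1 + δ) * potential p z ∧
      potential p z ≤ ENNReal.ofReal (1 + δ) * potential p' z := by
  obtain ⟨τ, hτ, hτδ⟩ : ∃ τ > 0, (1 + τ) * (1 + τ) ≤ 1 + δ := by
    refine ⟨min 1 (δ / 3), by positivity, ?_⟩
    have h1 := min_le_left 1 (δ / 3)
    have h2 := min_le_right 1 (δ / 3)
    have h3 : 0 < min 1 (δ / 3) := by positivity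
    nlinarith
  set Λ := |Real.log ρ| + |Real.log M| with hΛ
  have hΛ0 : 0 ≤ Λ := by positivity
  have hexp : ∀ᶠ p' in 𝓝 p, Real.exp (|(p'.2 : ℝ) - (p.2 : ℝ)| * Λ) < 1 + τ := by
    have hc : Continuous fun p' : C2Sphere n × Ioo (0 : ℝ) 2 =>
        Real.exp (|(p'.2 : ℝ) - (p.2 : ℝ)| * Λ) := by
      have : Continuous fun p' : C2Sphere n × Ioo (0 : ℝ) 2 => (p'.2 : ℝ) :=
        continuous_subtype_val.comp continuous_snd
      fun_prop
    refine (hc.tendsto p).eventually (gt_mem_nhds ?_)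
    simp [hτ]
  set η := min (m / 2) (m / 2 * τ) with hη
  have hη0 : 0 < η := by positivity
  filter_upwards [hexp, eventually_abs_angular_sub_lt p hη0] with p' h1 h2 z hz1 hz2
  have hz0 : 0 < ‖z‖ := hρ.trans_le hz1
  have hz : z ≠ 0 := norm_pos_iff.mp hz0
  have hM : 0 < M := hz0.trans_le hz2
  have hlog : |Real.log ‖z‖| ≤ Λ := by
    have l1 := Real.log_le_log hρ hz1
    have l2 := Real.log_le_log hz0 hz2
    rw [abs_le]
    constructor
    · linarith [neg_abs_le (Real.log ρ), abs_nonneg (Real.log M)]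
    · linarith [le_abs_self (Real.log M), abs_nonneg (Real.log ρ)]
  have hpow : ∀ α₁ α₂ : ℝ, |α₁ - α₂| = |(p'.2 : ℝ) - (p.2 : ℝ)| →
      (‖z‖ ^ α₁)⁻¹ ≤ (1 + τ) * (‖z‖ ^ α₂)⁻¹ := by
    intro α₁ α₂ hα
    rw [← Real.rpow_neg hz0.le, ← Real.rpow_neg hz0.le]
    have e : ‖z‖ ^ (-α₁) = ‖z‖ ^ (α₂ - α₁) * ‖z‖ ^ (-α₂) := by
      rw [← Real.rpow_add hz0]; congr 1; ring
    rw [e]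
    gcongr
    rw [Real.rpow_def_of_pos hz0]
    refine le_trans (Real.exp_le_exp.mpr ?_) h1.le
    calc Real.log ‖z‖ * (α₂ - α₁) ≤ |Real.log ‖z‖ * (α₂ - α₁)| := le_abs_self _
      _ = |(p'.2 : ℝ) - (p.2 : ℝ)| * |Real.log ‖z‖| := by
          rw [abs_mul, abs_sub_comm α₂, hα, mul_comm]
      _ ≤ _ := by gcongr
  set s := toUSphere z hz with hs
  have hs1 := abs_lt.mp (h2 s)
  have hs2 := hp s
  have hηm : η ≤ m / 2 := min_le_left _ _
  have hητ : η ≤ m / 2 * τ := min_le_right _ _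
  have hmul : ∀ u w : ℝ, m / 2 ≤ w → u ≤ w + η → u ≤ (1 + τ) * w := by
    intro u w hw hu
    have : m / 2 * τ ≤ w * τ := by gcongr
    linarith
  have hfin : ∀ q q' : C2Sphere n × Ioo (0 : ℝ) 2, 0 ≤ q'.1 s →
      q.1 s ≤ (1 + τ) * q'.1 s → |(q.2 : ℝ) - (q'.2 : ℝ)| = |(p'.2 : ℝ) - (p.2 : ℝ)| →
      potential q z ≤ ENNReal.ofReal (1 + δ) * potential q' z := by
    intro q q' h0 hU hα
    rw [potential_of_ne q hz, potential_of_ne q' hz, ← ENNReal.ofReal_mul (by positivity),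
      radialExt_of_ne _ hz, radialExt_of_ne _ hz, ← hs]
    refine ENNReal.ofReal_le_ofReal ?_
    have hP : 0 < ‖z‖ ^ (q.2 : ℝ) := Real.rpow_pos_of_pos hz0 _
    have hP' : 0 < ‖z‖ ^ (q'.2 : ℝ) := Real.rpow_pos_of_pos hz0 _
    calc q.1 s / ‖z‖ ^ (q.2 : ℝ) ≤ (1 + τ) * q'.1 s * (‖z‖ ^ (q.2 : ℝ))⁻¹ := by
          rw [div_eq_mul_inv]; gcongr
      _ ≤ (1 + τ) * q'.1 s * ((1 + τ) * (‖z‖ ^ (q'.2 : ℝ))⁻¹) := by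
          gcongr; exact hpow _ _ hα
      _ = (1 + τ) * (1 + τ) * (q'.1 s / ‖z‖ ^ (q'.2 : ℝ)) := by ring
      _ ≤ _ := by gcongr
  constructor
  · exact hfin p' p (by linarith) (hmul _ _ (by linarith) (by linarith [hs1.2])) rfl
  · exact hfin p p' (by linarith [hs1.1]) (hmul _ _ (by linarith [hs1.1]) (by linarith [hs1.1]))
      (abs_sub_comm _ _)

theorem action_le_mul {p' : C2Sphere n × Ioo (0 : ℝ) 2} {a b δ : ℝ} {x : ℝ → Conf n} (hδ : 0 ≤ δ)
    (h : ∀ t ∈ Icc a b, potential p' (x t) ≤ ENNReal.ofReal (1 + δ) * potential p (x t)) :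
    action p' a b x ≤ ENNReal.ofReal (1 + δ) * action p a b x := by
  unfold action
  rw [← lintegral_const_mul' _ _ ENNReal.ofReal_ne_top]
  refine setLIntegral_mono' measurableSet_Icc fun t ht => ?_
  rw [mul_add]
  refine add_le_add ?_ (h t ht)
  have h1 : (1 : ℝ≥0∞) ≤ ENNReal.ofReal (1 + δ) := by
    rw [← ENNReal.ofReal_one]; exact ENNReal.ofReal_le_ofReal (by linarith)
  exact le_mul_of_one_le_left zero_le h1

/-- The times are the first and last visits to the closed ball of radius `ρ`; the excursion between
them is meant to be replaced by a path through the origin. -/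
theorem exists_crossing {b ρ : ℝ} {x : ℝ → Conf n} (hb : 0 ≤ b) (hx : ContinuousOn x (Icc 0 b))
    (h0 : ρ < ‖x 0‖) (h1 : ρ < ‖x b‖) (hlow : ∃ t ∈ Icc 0 b, ‖x t‖ < ρ) :
    ∃ t₁ t₂, 0 ≤ t₁ ∧ t₁ ≤ t₂ ∧ t₂ ≤ b ∧ ‖x t₁‖ = ρ ∧ ‖x t₂‖ = ρ ∧
      (∀ t ∈ Icc 0 t₁, ρ ≤ ‖x t‖) ∧ ∀ t ∈ Icc t₂ b, ρ ≤ ‖x t‖ := by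
  set S := Icc 0 b ∩ {t | ‖x t‖ ≤ ρ} with hS
  have hScl : IsClosed S := by
    have := hx.norm.preimage_isClosed_of_isClosed isClosed_Icc (isClosed_Iic (a := ρ))
    exact this
  have hSc : IsCompact S := isCompact_Icc.of_isClosed_subset hScl inter_subset_left
  obtain ⟨t₀, ht₀, ht₀ρ⟩ := hlow
  have hne : S.Nonempty := ⟨t₀, ht₀, ht₀ρ.le⟩
  obtain ⟨t₁, ht₁S, ht₁⟩ := hSc.exists_isLeast hne
  obtain ⟨t₂, ht₂S, ht₂⟩ := hSc.exists_isGreatest hne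
  have h01 : 0 < t₁ := by
    refine lt_of_le_of_ne ht₁S.1.1 ?_
    rintro rfl
    exact absurd ht₁S.2 (not_le.mpr h0)
  have h2b : t₂ < b := by
    refine lt_of_le_of_ne ht₂S.1.2 ?_
    rintro rfl
    exact absurd ht₂S.2 (not_le.mpr h1)
  have L1 : ∀ t ∈ Icc 0 t₁, ρ ≤ ‖x t‖ := by
    intro t ht
    have hcl : closure (Ico 0 t₁) = Icc 0 t₁ := closure_Ico h01.ne
    refine le_on_closure (s := Ico 0 t₁) (f := fun _ => ρ) (g := fun t => ‖x t‖) ?_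
      continuousOn_const ?_ (by rw [hcl]; exact ht)
    · intro u hu
      by_contra hlt
      exact absurd (ht₁ ⟨⟨hu.1, hu.2.le.trans ht₁S.1.2⟩, (not_le.mp hlt).le⟩) (not_le.mpr hu.2)
    · rw [hcl]; exact hx.norm.mono (Icc_subset_Icc le_rfl ht₁S.1.2)
  have L2 : ∀ t ∈ Icc t₂ b, ρ ≤ ‖x t‖ := by
    intro t ht
    have hcl : closure (Ioc t₂ b) = Icc t₂ b := closure_Ioc h2b.ne
    refine le_on_closure (s := Ioc t₂ b) (f := fun _ => ρ) (g := fun t => ‖x t‖) ?_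
      continuousOn_const ?_ (by rw [hcl]; exact ht)
    · intro u hu
      by_contra hlt
      exact absurd (ht₂ ⟨⟨ht₂S.1.1.trans hu.1.le, hu.2⟩, (not_le.mp hlt).le⟩) (not_le.mpr hu.1)
    · rw [hcl]; exact hx.norm.mono (Icc_subset_Icc ht₂S.1.1 le_rfl)
  exact ⟨t₁, t₂, h01.le, ht₁ ht₂S, h2b.le, le_antisymm ht₁S.2 (L1 _ ⟨h01.le, le_rfl⟩),
    le_antisymm ht₂S.2 (L2 _ ⟨le_rfl, h2b.le⟩), L1, L2⟩

/-- Upper semicontinuity of the least cost of joining two points with respect to the potential. -/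
theorem JoinedAtCost.eventually (hm : 0 < m) (hp : ∀ s, m ≤ p.1 s) {y z : Conf n} (hy : y ≠ 0)
    (hz : z ≠ 0) {C η : ℝ} (h : JoinedAtCost p univ y z C) (hη : 0 < η) :
    ∀ᶠ p' in 𝓝 p, JoinedAtCost p' univ y z (C + η) := by
  obtain ⟨hC, b, x, hb, hx, h1, h2, -, hact⟩ := h
  have hβ := homExp_pos p
  have hcont := hx.hasVel.continuousOn
  obtain ⟨M, hM⟩ := isCompact_Icc.exists_bound_of_continuousOn hcont
  set N := ‖(jet2 p.1).1‖ + m with hN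
  have hN0 : 0 < N := by positivity
  -- Crossing the ball of radius `ρ` through the origin costs less than `η/2`, uniformly for nearby
  -- potentials, whose exponents exceed `homExp p / 2`.
  obtain ⟨ρ, hρ0, hρ1, hρy, hρz, hρη⟩ : ∃ ρ : ℝ, 0 < ρ ∧ ρ < 1 ∧ ρ < ‖y‖ ∧ ρ < ‖z‖ ∧
      √(2 * N) / (homExp p / 2) * (ρ ^ (homExp p / 2) + ρ ^ (homExp p / 2)) < η / 2 := by
    have ht : Tendsto (fun ρ : ℝ => √(2 * N) / (homExp p / 2) *
        (ρ ^ (homExp p / 2) + ρ ^ (homExp p / 2))) (𝓝[>] 0) (𝓝 0) := by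
      have h0 : Tendsto (fun ρ : ℝ => ρ ^ (homExp p / 2)) (𝓝[>] 0) (𝓝 0) := by
        have := (Real.continuousAt_rpow_const 0 (homExp p / 2) (Or.inr (by positivity))).tendsto
        rw [Real.zero_rpow (by positivity)] at this
        exact this.mono_left nhdsWithin_le_nhds
      simpa using (h0.add h0).const_mul (√(2 * N) / (homExp p / 2))
    have hlt : ∀ c : ℝ, 0 < c → ∀ᶠ ρ : ℝ in 𝓝[>] 0, ρ < c := fun c hc =>
      nhdsWithin_le_nhds (gt_mem_nhds hc)
    obtain ⟨ρ, hρ⟩ := ((ht.eventually (gt_mem_nhds (half_pos hη))).and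
      ((hlt 1 one_pos).and ((hlt _ (norm_pos_iff.mpr hy)).and
      ((hlt _ (norm_pos_iff.mpr hz)).and self_mem_nhdsWithin)))).exists
    exact ⟨ρ, hρ.2.2.2.2, hρ.2.1, hρ.2.2.1, hρ.2.2.2.1, hρ.1⟩
  obtain ⟨δ, hδ, hδC⟩ : ∃ δ > 0, δ * C ≤ η / 2 := by
    refine ⟨η / 2 / (C + 1), by positivity, ?_⟩
    rw [div_mul_eq_mul_div, div_le_iff₀ (by positivity)]
    gcongr
    linarith
  filter_upwards [eventually_potential_le hm hp hρ0 hδ (M := M), eventually_bounds hm hp,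
    eventually_homExp_gt p] with p' hpot hbd hexp
  have hβ' := homExp_pos p'
  have hseg : ∀ s t, 0 ≤ s → s ≤ t → t ≤ b → (∀ u ∈ Icc s t, ρ ≤ ‖x u‖) →
      action p' s t x ≤ ENNReal.ofReal (1 + δ) * action p s t x := by
    intro s t hs hst htb hlow
    exact action_le_mul hδ.le fun u hu =>
      (hpot _ (hlow u hu) (hM u ⟨hs.trans hu.1, hu.2.trans htb⟩)).1
  have hmulC : ENNReal.ofReal (1 + δ) * action p 0 b x ≤ ENNReal.ofReal ((1 + δ) * C) := by
    rw [ENNReal.ofReal_mul (by positivity)]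
    exact mul_le_mul_right hact _
  rcases em (∃ t ∈ Icc 0 b, ‖x t‖ < ρ) with hlow | hlow
  · obtain ⟨t₁, t₂, h01, h12, h2b, hn1, hn2, L1, L2⟩ :=
      exists_crossing hb hcont (h1 ▸ hρy) (h2 ▸ hρz) hlow
    have hfin : action p 0 b x ≠ ⊤ := ne_top_of_le_ne_top ENNReal.ofReal_ne_top hact
    have hsum : action p 0 t₁ x + action p t₂ b x ≤ action p 0 b x := by
      rw [action_add p x h01 (h12.trans h2b), action_add p x h12 h2b]
      exact add_le_add le_rfl le_add_self
    have f1 : action p 0 t₁ x ≠ ⊤ :=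
      ne_top_of_le_ne_top hfin (le_self_add.trans hsum)
    have f2 : action p t₂ b x ≠ ⊤ := ne_top_of_le_ne_top hfin (le_add_self.trans hsum)
    set A₁ := (action p 0 t₁ x).toReal with hA₁
    set A₂ := (action p t₂ b x).toReal with hA₂
    have hA : A₁ + A₂ ≤ C := by
      rw [hA₁, hA₂, ← ENNReal.toReal_add f1 f2]
      exact ENNReal.toReal_le_of_le_ofReal hC (hsum.trans hact)
    have hA₁0 : 0 ≤ A₁ := ENNReal.toReal_nonneg
    have hA₂0 : 0 ≤ A₂ := ENNReal.toReal_nonneg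
    have J1 : JoinedAtCost p' univ y (x t₁) ((1 + δ) * A₁) := by
      rw [← h1]
      refine JoinedAtCost.of_path h01 (hx.hasVel.mono le_rfl (h12.trans h2b)).isH1
        (fun _ _ => mem_univ _) (by positivity) ?_
      rw [ENNReal.ofReal_mul (by positivity), hA₁, ENNReal.ofReal_toReal f1]
      exact hseg _ _ le_rfl h01 (h12.trans h2b) L1
    have J3 : JoinedAtCost p' univ (x t₂) z ((1 + δ) * A₂) := by
      rw [← h2]
      refine JoinedAtCost.of_path h2b (hx.hasVel.mono (h01.trans h12) le_rfl).isH1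
        (fun _ _ => mem_univ _) (by positivity) ?_
      rw [ENNReal.ofReal_mul (by positivity), hA₂, ENNReal.ofReal_toReal f2]
      exact hseg _ _ (h01.trans h12) h2b le_rfl L2
    have J2 := JoinedAtCost.through_zero_of_le (p := p') (y := x t₁) (z := x t₂)
      (norm_pos_iff.mp (hn1 ▸ hρ0)) (norm_pos_iff.mp (hn2 ▸ hρ0)) (fun s => (hbd s).1)
      (fun s => (hbd s).2)
    rw [hn1, hn2] at J2
    refine ((J1.trans J2).trans J3).mono subset_rfl ?_
    have hmid : √(2 * N) / homExp p' * (ρ ^ homExp p' + ρ ^ homExp p') ≤ η / 2 := by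
      refine le_trans ?_ hρη.le
      have : ρ ^ homExp p' ≤ ρ ^ (homExp p / 2) :=
        Real.rpow_le_rpow_of_exponent_ge hρ0 hρ1.le hexp.le
      gcongr
    have : δ * (A₁ + A₂) ≤ δ * C := by gcongr
    linarith
  · push Not at hlow
    rw [← h1, ← h2]
    refine JoinedAtCost.of_path hb hx (fun _ _ => mem_univ _) (by positivity) ?_
    refine (hseg 0 b le_rfl hb le_rfl hlow).trans (hmulC.trans (ENNReal.ofReal_le_ofReal ?_))
    linarith

end Compare

/-! ### The two regions and their common boundary -/

section Regions

variable {ξm ξp : USphere n} {Vmin : ℝ}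

theorem classP_min (V : classP ξm ξp Vmin) (s : USphere n) : Vmin ≤ V.1.1 s := V.2.2.2.1 s

theorem classP_left (V : classP ξm ξp Vmin) : V.1.1 ξm = Vmin := V.2.1

theorem classP_right (V : classP ξm ξp Vmin) : V.1.1 ξp = Vmin := V.2.2.1

theorem mem_regionOut_iff {V : classP ξm ξp Vmin} :
    V ∈ regionOut ξm ξp Vmin ↔
      bolzaLevel ξm ξp V.1 < ENNReal.ofReal (2 * rayCost Vmin V.1) := by
  rw [← two_rayCost]; rfl

theorem joined_ends (hVmin : 0 < Vmin) (V : classP ξm ξp Vmin) :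
    JoinedAtCost V.1 univ ξm ξp (2 * rayCost Vmin V.1) := by
  have h := JoinedAtCost.through_zero (p := V.1) (ne_zero_of_mem_unit_sphere ξm)
    (ne_zero_of_mem_unit_sphere ξp) (fun s => hVmin.trans_le (classP_min V s))
  rw [radialExt_coe, radialExt_coe, classP_left, classP_right, norm_eq_of_mem_sphere,
    norm_eq_of_mem_sphere, Real.one_rpow, mul_one] at h
  rw [two_mul]
  exact h

/-- The path through the origin along the two minimal rays shows that the Bolza level never exceeds
the threshold. -/
theorem regionIn_eq_compl (hξ : ξp ≠ ξm) (hVmin : 0 < Vmin) :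
    regionIn ξm ξp Vmin = (regionOut ξm ξp Vmin)ᶜ := by
  ext V
  rw [mem_compl_iff, mem_regionOut_iff, not_lt]
  have h : V ∈ regionIn ξm ξp Vmin ↔
      bolzaLevel ξm ξp V.1 = ENNReal.ofReal (2 * rayCost Vmin V.1) := by
    rw [← two_rayCost]; rfl
  rw [h]
  have hle := (joined_ends hVmin V).bolzaLevel_le hξ
  exact ⟨fun e => e.ge, fun e => le_antisymm hle e⟩

theorem le_of_joined_of_notMem_regionOut (hξ : ξp ≠ ξm) {V : classP ξm ξp Vmin}
    (hV : V ∉ regionOut ξm ξp Vmin) {K : Set (Conf n)} {C : ℝ} (h : JoinedAtCost V.1 K ξm ξp C) :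
    2 * rayCost Vmin V.1 ≤ C := by
  rw [mem_regionOut_iff, not_lt] at hV
  exact (ENNReal.ofReal_le_ofReal_iff h.1).mp (hV.trans (h.bolzaLevel_le hξ))

theorem mem_regionOut_of_joined (hξ : ξp ≠ ξm) {V : classP ξm ξp Vmin} {K : Set (Conf n)} {C : ℝ}
    (h : JoinedAtCost V.1 K ξm ξp C) (hC : C < 2 * rayCost Vmin V.1) :
    V ∈ regionOut ξm ξp Vmin := by
  by_contra hV
  exact absurd (le_of_joined_of_notMem_regionOut hξ hV h) (not_le.mpr hC)

theorem exists_joined_of_mem_regionOut {V : classP ξm ξp Vmin} (hV : V ∈ regionOut ξm ξp Vmin) :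
    ∃ C, C < 2 * rayCost Vmin V.1 ∧ JoinedAtCost V.1 univ ξm ξp C := by
  rw [mem_regionOut_iff] at hV
  obtain ⟨C, h1, h2⟩ := ENNReal.lt_iff_exists_nnreal_btwn.mp hV
  refine ⟨C, ?_, JoinedAtCost.of_bolzaLevel_lt (by simpa using h1)⟩
  exact ENNReal.lt_ofReal_iff_toReal_lt ENNReal.coe_ne_top |>.mp h2

theorem isOpen_regionOut (hξ : ξp ≠ ξm) (hVmin : 0 < Vmin) : IsOpen (regionOut ξm ξp Vmin) := by
  rw [isOpen_iff_mem_nhds]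
  intro V hV
  obtain ⟨C, hC, hJ⟩ := exists_joined_of_mem_regionOut hV
  set η := (2 * rayCost Vmin V.1 - C) / 2 with hη
  have hη0 : 0 < η := by linarith
  have h1 := hJ.eventually hVmin (classP_min V) (ne_zero_of_mem_unit_sphere ξm)
    (ne_zero_of_mem_unit_sphere ξp) hη0
  have h2 : ∀ᶠ p' in 𝓝 V.1, C + η < 2 * rayCost Vmin p' :=
    ((continuous_const.mul (continuous_rayCost Vmin)).tendsto V.1).eventually
      (lt_mem_nhds (by change C + η < 2 * rayCost Vmin V.1; linarith))
  have h3 := (continuous_subtype_val.tendsto V).eventually (h1.and h2)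
  filter_upwards [h3] with V' hV'
  exact mem_regionOut_of_joined hξ hV'.1 hV'.2

/-- Complementary sets have the same frontier, and an open set has as frontier its closure minus
itself. -/
theorem mem_interfacePi_iff (hξ : ξp ≠ ξm) (hVmin : 0 < Vmin) {V : classP ξm ξp Vmin} :
    V ∈ interfacePi ξm ξp Vmin ↔
      V ∉ regionOut ξm ξp Vmin ∧ V ∈ closure (regionOut ξm ξp Vmin) := by
  rw [interfacePi, regionIn_eq_compl hξ hVmin, frontier_compl, inter_self,
    (isOpen_regionOut hξ hVmin).frontier_eq, Set.mem_sdiff, and_comm]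

/-- Lower semicontinuity of the Bolza level at the potentials with inner minimizers. -/
theorem eventually_le_of_joined (hξ : ξp ≠ ξm) (hVmin : 0 < Vmin) {V : classP ξm ξp Vmin}
    (hV : V ∉ regionOut ξm ξp Vmin) {η : ℝ} (hη : 0 < η) (hη1 : η < 1) :
    ∀ᶠ V' in 𝓝 V, ∀ (K : Set (Conf n)) (C : ℝ), JoinedAtCost V'.1 K ξm ξp C →
      2 * rayCost Vmin V'.1 * (1 - η) ≤ C := by
  have hβ := homExp_pos V.1
  -- A path of cost below `2L'(1 - η)` satisfies `|‖x‖^β' - 1| < 1 - η` by the radial bound. As `β'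
  -- > β/2`, it stays in the annulus `ρ ≤ ‖x‖ ≤ M`, where the potentials are comparable.
  set ρ := η ^ (2 / homExp V.1) with hρ
  set M := (2 : ℝ) ^ (2 / homExp V.1) with hM
  have hρ0 : 0 < ρ := Real.rpow_pos_of_pos hη _
  have hρ1 : ρ < 1 := Real.rpow_lt_one hη.le hη1 (by positivity)
  have hM1 : 1 ≤ M := Real.one_le_rpow (by norm_num) (by positivity)
  -- The factor is `(1 + η)(1 - η)`: a path too cheap for `V'` would cost less than `2L` for `V`.
  have e1 : (1 - η ^ 2) * rayCost Vmin V.1 < rayCost Vmin V.1 := by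
    have := rayCost_pos hVmin V.1
    nlinarith [pow_pos hη 2, mul_pos (pow_pos hη 2) this]
  have h2 : ∀ᶠ p' in 𝓝 V.1, (1 - η ^ 2) * rayCost Vmin p' < rayCost Vmin V.1 :=
    ((continuous_const.mul (continuous_rayCost Vmin)).tendsto V.1).eventually (gt_mem_nhds e1)
  filter_upwards [(continuous_subtype_val.tendsto V).eventually ((eventually_potential_le hVmin
    (classP_min V) hρ0 hη (M := M)).and (h2.and (eventually_homExp_gt V.1)))] with V' hV' K C hJ
  obtain ⟨hpot, hray, hexp⟩ := hV'
  by_contra hlt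
  push Not at hlt
  obtain ⟨hC, b, x, hb, hx, h0, h1, -, hact⟩ := hJ
  have hβ' := homExp_pos V'.1
  have hL' := rayCost_pos hVmin V'.1
  have hn0 : ‖x 0‖ = 1 := by rw [h0]; exact norm_eq_of_mem_sphere ξm
  have hnb : ‖x b‖ = 1 := by rw [h1]; exact norm_eq_of_mem_sphere ξp
  have hrange : ∀ t ∈ Icc 0 b, ρ ≤ ‖x t‖ ∧ ‖x t‖ ≤ M := by
    intro t ht
    have a1 := (hx.hasVel.mono le_rfl ht.2).isH1.ofReal_radial_le_action (p := V'.1) hVmin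
      (classP_min V') ht.1
    have a2 := (hx.hasVel.mono ht.1 le_rfl).isH1.ofReal_radial_le_action (p := V'.1) hVmin
      (classP_min V') ht.2
    have a3 := add_le_add a1 a2
    rw [← action_add V'.1 x ht.1 ht.2, ← ENNReal.ofReal_add (by positivity) (by positivity), hn0,
      hnb, Real.one_rpow, abs_sub_comm 1] at a3
    have a4 := (ENNReal.ofReal_le_ofReal_iff hC).mp (a3.trans hact)
    change rayCost Vmin V'.1 * _ + rayCost Vmin V'.1 * _ ≤ C at a4
    have a5 : |‖x t‖ ^ homExp V'.1 - 1| < 1 - η := by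
      by_contra hcon
      push Not at hcon
      have := mul_le_mul_of_nonneg_left hcon hL'.le
      linarith
    have a6 := abs_lt.mp a5
    constructor
    · by_contra hcon
      push Not at hcon
      have b1 : ‖x t‖ ^ homExp V'.1 ≤ ρ ^ homExp V'.1 := by gcongr
      have b2 : ρ ^ homExp V'.1 ≤ ρ ^ (homExp V.1 / 2) :=
        Real.rpow_le_rpow_of_exponent_ge hρ0 hρ1.le hexp.le
      have b3 : ρ ^ (homExp V.1 / 2) = η := by
        rw [hρ, ← Real.rpow_mul hη.le]
        have : 2 / homExp V.1 * (homExp V.1 / 2) = 1 := by field_simp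
        rw [this, Real.rpow_one]
      linarith [a6.1]
    · by_contra hcon
      push Not at hcon
      have b1 : M ^ homExp V'.1 ≤ ‖x t‖ ^ homExp V'.1 := by gcongr
      have b2 : M ^ (homExp V.1 / 2) ≤ M ^ homExp V'.1 :=
        Real.rpow_le_rpow_of_exponent_le hM1 hexp.le
      have b3 : M ^ (homExp V.1 / 2) = 2 := by
        rw [hM, ← Real.rpow_mul (by norm_num)]
        have : 2 / homExp V.1 * (homExp V.1 / 2) = 1 := by field_simp
        rw [this, Real.rpow_one]
      linarith [a6.2]
  have hle := action_le_mul (p := V'.1) (p' := V.1) (a := 0) (b := b) (x := x) hη.le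
    fun t ht => (hpot _ (hrange t ht).1 (hrange t ht).2).2
  have hJV : JoinedAtCost V.1 univ ξm ξp ((1 + η) * C) := by
    rw [← h0, ← h1]
    refine JoinedAtCost.of_path hb hx (fun _ _ => mem_univ _) (by positivity) (hle.trans ?_)
    rw [ENNReal.ofReal_mul (by positivity)]
    exact mul_le_mul_right hact _
  have hfin := le_of_joined_of_notMem_regionOut hξ hV hJV
  have : (1 + η) * C ≤ (1 + η) * (2 * rayCost Vmin V'.1 * (1 - η)) := by gcongr
  nlinarith

end Regions

/-! ### Lowering the angular potential -/

/-- The angular potential `(1 - ε) U + ε m`. -/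
noncomputable def C2Sphere.shrink (U : C2Sphere n) (m ε : ℝ) : C2Sphere n :=
  ⟨fun s => (1 - ε) * U s + ε * m, by
    have h : ContDiff ℝ 2 fun u : ℝ => (1 - ε) * u + ε * m := by fun_prop
    exact h.contMDiff.comp U.2⟩

theorem C2Sphere.shrink_apply (U : C2Sphere n) (m ε : ℝ) (s : USphere n) :
    U.shrink m ε s = (1 - ε) * U s + ε * m := rfl

theorem radialExt_shrink (U : C2Sphere n) (m ε : ℝ) {z : Conf n} (hz : z ≠ 0) :
    radialExt (U.shrink m ε) z = (1 - ε) * radialExt U z + ε * m := by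
  rw [radialExt_of_ne _ hz, radialExt_of_ne _ hz, C2Sphere.shrink_apply]

/-- The jet is affine in `ε`, so convergence in the `C²` distance as `ε → 0` is immediate. -/
theorem jet2_shrink (U : C2Sphere n) (m ε : ℝ) :
    jet2 (U.shrink m ε) =
      (1 - ε) • jet2 U + ε • (ContinuousMap.const _ m, 0, 0) := by
  have hev : ∀ s : USphere n, radialExt (U.shrink m ε) =ᶠ[𝓝 (s : Conf n)]
      ((1 - ε) • radialExt U + fun _ => ε * m) := by
    intro s
    filter_upwards [isOpen_compl_singleton.mem_nhds
      (show (s : Conf n) ∈ ({0}ᶜ : Set (Conf n)) from ne_zero_of_mem_unit_sphere s)] with z hz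
    exact radialExt_shrink U m ε hz
  have hd : ∀ s : USphere n, ContDiffAt ℝ 2 (radialExt U) (s : Conf n) := fun s =>
    radialExt_contDiffAt U (ne_zero_of_mem_unit_sphere s)
  refine Prod.ext ?_ (Prod.ext ?_ ?_)
  · ext s
    exact (hev s).eq_of_nhds
  · refine ContinuousMap.ext fun s => ?_
    change fderiv ℝ (radialExt (U.shrink m ε)) (s : Conf n) =
      (1 - ε) • fderiv ℝ (radialExt U) (s : Conf n) + ε • (0 : Conf n →L[ℝ] ℝ)
    rw [(hev s).fderiv_eq, fderiv_add (((hd s).differentiableAt (by norm_num)).const_smul _)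
      (differentiableAt_const _), fderiv_const_smul ((hd s).differentiableAt (by norm_num))]
    simp
  · refine ContinuousMap.ext fun s => ?_
    change iteratedFDeriv ℝ 2 (radialExt (U.shrink m ε)) (s : Conf n) =
      (1 - ε) • iteratedFDeriv ℝ 2 (radialExt U) (s : Conf n) + ε • (0 : Conf n [×2]→L[ℝ] ℝ)
    rw [((hev s).iteratedFDeriv ℝ 2).eq_of_nhds,
      iteratedFDeriv_add_apply
        (show ContDiffAt ℝ 2 ((1 - ε) • radialExt U) (s : Conf n) from
          (hd s).const_smul (1 - ε))
        contDiffAt_const,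
      iteratedFDeriv_const_smul_apply (hd s), iteratedFDeriv_const_of_ne (by norm_num)]
    simp

theorem tendsto_one_sub_smul_add_smul {E : Type*} [NormedAddCommGroup E] [NormedSpace ℝ E]
    (u w : E) : Tendsto (fun ε : ℝ => (1 - ε) • u + ε • w) (𝓝 0) (𝓝 u) := by
  have hc : Continuous fun ε : ℝ => (1 - ε) • u + ε • w := by fun_prop
  simpa using hc.tendsto 0

theorem tendsto_shrink (U : C2Sphere n) (m : ℝ) :
    Tendsto (fun ε => U.shrink m ε) (𝓝 0) (𝓝 U) := by
  have hind : IsInducing (jet2 (n := n)) := ⟨rfl⟩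
  rw [hind.tendsto_nhds_iff]
  refine (tendsto_one_sub_smul_add_smul (jet2 U) (ContinuousMap.const _ m, 0, 0)).congr
    fun ε => ?_
  exact (jet2_shrink U m ε).symm

/-- The Lagrangian along a path. -/
noncomputable def lagr (p : C2Sphere n × Ioo (0 : ℝ) 2) (x : ℝ → Conf n) (t : ℝ) : ℝ :=
  ‖deriv x t‖ ^ 2 / 2 + radialExt p.1 (x t) / ‖x t‖ ^ (p.2 : ℝ)

section Lagrangian

variable {p : C2Sphere n × Ioo (0 : ℝ) 2} {a b : ℝ} {x : ℝ → Conf n}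

theorem ContinuousOn.radialExt_div {s : Set ℝ} (hx : ContinuousOn x s) (h0 : ∀ t ∈ s, x t ≠ 0)
    (U : C2Sphere n) (α : ℝ) : ContinuousOn (fun t => radialExt U (x t) / ‖x t‖ ^ α) s := by
  refine ContinuousOn.div (fun t ht => ?_) ?_ fun t ht => ?_
  · exact (radialExt_contDiffAt U (h0 t ht)).continuousAt.comp_continuousWithinAt (hx t ht)
  · exact hx.norm.rpow_const fun t ht => Or.inl (norm_ne_zero_iff.mpr (h0 t ht))
  · exact (Real.rpow_pos_of_pos (norm_pos_iff.mpr (h0 t ht)) _).ne'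

theorem IsH1.integrableOn_lagr (hx : IsH1 a b x) (h0 : ∀ t ∈ Icc a b, x t ≠ 0) :
    IntegrableOn (lagr p x) (Icc a b) := by
  have hsq : IntegrableOn (fun t => ‖deriv x t‖ ^ 2) (Icc a b) :=
    (memLp_two_iff_integrable_sq_norm hx.1.1).mp hx.1
  exact (hsq.div_const 2).add
    ((hx.hasVel.continuousOn.radialExt_div h0 p.1 p.2).integrableOn_Icc)

theorem IsH1.intervalIntegrable_lagr (hx : IsH1 a b x) (hab : a ≤ b) (h0 : ∀ t ∈ Icc a b, x t ≠ 0) :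
    IntervalIntegrable (lagr p x) volume a b :=
  (intervalIntegrable_iff_integrableOn_Icc_of_le hab).mpr (hx.integrableOn_lagr h0)

theorem lagr_nonneg (hp : ∀ s, 0 ≤ p.1 s) {t : ℝ} (h0 : x t ≠ 0) : 0 ≤ lagr p x t := by
  rw [lagr, radialExt_of_ne _ h0]
  have := hp (toUSphere (x t) h0)
  positivity

theorem IsH1.action_eq_integral (hx : IsH1 a b x) (hab : a ≤ b) (h0 : ∀ t ∈ Icc a b, x t ≠ 0)
    (hp : ∀ s, 0 ≤ p.1 s) : action p a b x = ENNReal.ofReal (∫ t in a..b, lagr p x t) := by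
  rw [intervalIntegral.integral_of_le hab, ← integral_Icc_eq_integral_Ioc,
    ofReal_integral_eq_lintegral_ofReal (hx.integrableOn_lagr h0)]
  · refine setLIntegral_congr_fun measurableSet_Icc fun t ht => ?_
    have h1 := hp (toUSphere (x t) (h0 t ht))
    rw [potential_of_ne p (h0 t ht), lagr, ENNReal.ofReal_add (by positivity)
      (by rw [radialExt_of_ne _ (h0 t ht)]; positivity)]
  · filter_upwards [ae_restrict_mem measurableSet_Icc] with t ht
    exact lagr_nonneg hp (h0 t ht)

theorem lagr_shrink (m ε : ℝ) {t : ℝ} (h0 : x t ≠ 0) :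
    lagr (p.1.shrink m ε, p.2) x t =
      lagr p x t - ε * ((radialExt p.1 (x t) - m) / ‖x t‖ ^ (p.2 : ℝ)) := by
  simp only [lagr]
  rw [radialExt_shrink _ _ _ h0]
  ring

theorem ContinuousOn.angular_excess {s : Set ℝ} (hx : ContinuousOn x s) (h0 : ∀ t ∈ s, x t ≠ 0)
    (U : C2Sphere n) (m α : ℝ) :
    ContinuousOn (fun t => (radialExt U (x t) - m) / ‖x t‖ ^ α) s := by
  refine ContinuousOn.div (ContinuousOn.sub (fun t ht => ?_) continuousOn_const) ?_ fun t ht => ?_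
  · exact (radialExt_contDiffAt U (h0 t ht)).continuousAt.comp_continuousWithinAt (hx t ht)
  · exact hx.norm.rpow_const fun t ht => Or.inl (norm_ne_zero_iff.mpr (h0 t ht))
  · exact (Real.rpow_pos_of_pos (norm_pos_iff.mpr (h0 t ht)) _).ne'

theorem IsH1.integral_lagr_shrink (hx : IsH1 a b x) (hab : a ≤ b) (h0 : ∀ t ∈ Icc a b, x t ≠ 0)
    (m ε : ℝ) :
    ∫ t in a..b, lagr (p.1.shrink m ε, p.2) x t =
      (∫ t in a..b, lagr p x t) -
        ε * ∫ t in a..b, (radialExt p.1 (x t) - m) / ‖x t‖ ^ (p.2 : ℝ) := by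
  have hD : IntervalIntegrable (fun t => (radialExt p.1 (x t) - m) / ‖x t‖ ^ (p.2 : ℝ)) volume a b := by
    refine ContinuousOn.intervalIntegrable ?_
    rw [uIcc_of_le hab]
    exact hx.hasVel.continuousOn.angular_excess h0 _ _ _
  rw [← intervalIntegral.integral_const_mul, ← intervalIntegral.integral_sub
    (hx.intervalIntegrable_lagr hab h0) (hD.const_mul ε)]
  refine intervalIntegral.integral_congr fun t ht => ?_
  rw [uIcc_of_le hab] at ht
  exact lagr_shrink m ε (h0 t ht)

end Lagrangian

/-! ### Asymptotics of parabolic Morse minimizers -/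

namespace IsParabolicMorseMinimizer

variable {ξm ξp : USphere n} {p : C2Sphere n × Ioo (0 : ℝ) 2} {x : ℝ → Conf n}

theorem ne_zero (h : IsParabolicMorseMinimizer ξm ξp p x) (t : ℝ) : x t ≠ 0 := by
  obtain ⟨t₀, h0, h1⟩ := h.min_pos
  exact norm_pos_iff.mp (h0.trans_le (h1 t))

theorem continuous (h : IsParabolicMorseMinimizer ξm ξp p x) : Continuous x := by
  refine continuous_iff_continuousAt.mpr fun t => ?_
  exact (h.h1_loc (t - 1) (t + 1) (by linarith)).hasVel.continuousOn.continuousAt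
    (Icc_mem_nhds (by linarith) (by linarith))

theorem isH1 (h : IsParabolicMorseMinimizer ξm ξp p x) {a b : ℝ} (hab : a ≤ b) : IsH1 a b x :=
  ((h.h1_loc a (b + 1) (by linarith)).hasVel.mono le_rfl (by linarith)).isH1

theorem action_le (h : IsParabolicMorseMinimizer ξm ξp p x) {a b C : ℝ} {K : Set (Conf n)}
    (hab : a < b) (hJ : JoinedAtCost p K (x a) (x b) C) :
    action p a b x ≤ ENNReal.ofReal C := by
  obtain ⟨hC, d, z, hd, hz, h1, h2, -, hact⟩ := hJ
  rcases hd.eq_or_lt with rfl | hd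
  -- Duration `0` is not admissible in `minimal`. Constant paths of vanishing duration replace it,
  -- at vanishing cost since `x a ≠ 0`.
  · have hxab : x b = x a := h2.symm.trans h1
    have hle : ∀ τ : ℝ, 0 < τ → action p a b x ≤ potential p (x a) * ENNReal.ofReal τ := by
      intro τ hτ
      have := h.minimal a b 0 τ hab hτ (fun _ => x a) ⟨by simp, fun t _ => by simp⟩ rfl hxab.symm
      simpa [action] using this
    have hlim : Tendsto (fun τ : ℝ => potential p (x a) * ENNReal.ofReal τ) (𝓝[>] 0) (𝓝 0) := by
      have hne : potential p (x a) ≠ ⊤ := by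
        rw [potential_of_ne p (h.ne_zero a)]; exact ENNReal.ofReal_ne_top
      have h3 : Tendsto (fun τ : ℝ => ENNReal.ofReal τ) (𝓝[>] 0) (𝓝 0) := by
        have := (ENNReal.continuous_ofReal.tendsto 0).mono_left
          (nhdsWithin_le_nhds (s := Ioi (0 : ℝ)))
        simpa using this
      simpa using ENNReal.Tendsto.const_mul h3 (Or.inr hne)
    have h0 : action p a b x ≤ 0 :=
      ge_of_tendsto hlim (by filter_upwards [self_mem_nhdsWithin] with τ hτ using hle τ hτ)
    exact h0.trans zero_le
  · exact (h.minimal a b 0 d hab hd z hz h1 h2).trans hact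

theorem integral_lagr_le (h : IsParabolicMorseMinimizer ξm ξp p x) (hp : ∀ s, 0 ≤ p.1 s) {a b C : ℝ}
    {K : Set (Conf n)} (hab : a < b) (hJ : JoinedAtCost p K (x a) (x b) C) :
    ∫ t in a..b, lagr p x t ≤ C := by
  have h1 := h.action_le hab hJ
  rw [(h.isH1 hab.le).action_eq_integral hab.le (fun t _ => h.ne_zero t) hp] at h1
  exact (ENNReal.ofReal_le_ofReal_iff hJ.1).mp h1

/-- The asymptotic estimates need only be proved at `+∞`. -/
theorem reverse (h : IsParabolicMorseMinimizer ξm ξp p x) :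
    IsParabolicMorseMinimizer ξp ξm p (fun t => x (-t)) := by
  have hrev : ∀ (y : ℝ → Conf n) (a b : ℝ), a < b → IsH1 a b y →
      IsH1 (-b) (-a) (fun t => y (-t)) ∧
        action p (-b) (-a) (fun t => y (-t)) = action p a b y := by
    intro y a b hab hy
    have himg : (fun t => (-1 : ℝ) * t + 0) '' Icc (-b) (-a) = Icc a b := by
      simp
    have hv := hy.hasVel.affine 1 (neg_ne_zero.mpr one_ne_zero) 0 (a' := -b) (b' := -a)
      (by linarith) (fun t ht => by rw [← himg]; exact ⟨t, ht, rfl⟩)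
    have ha := action_affine p (l := 1) (κ := -1) (d := 0) one_pos (by simp) hy
      (by linarith : -b ≤ -a) himg
    simp only [Real.one_rpow, ENNReal.ofReal_one, one_mul, one_smul, neg_one_mul, add_zero] at ha hv
    exact ⟨hv.isH1, ha⟩
  refine ⟨fun a b hab => ?_, ?_, ?_, ?_, ?_, ?_, ?_⟩
  · simpa using (hrev x (-b) (-a) (by linarith) (h.h1_loc _ _ (by linarith))).1
  · obtain ⟨t₀, h0, h1⟩ := h.min_pos
    exact ⟨-t₀, by simpa using h0, fun t => by simpa using h1 (-t)⟩
  · exact h.norm_atTop.comp tendsto_neg_atBot_atTop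
  · exact h.norm_atBot.comp tendsto_neg_atTop_atBot
  · exact h.dir_atTop.comp tendsto_neg_atBot_atTop
  · exact h.dir_atBot.comp tendsto_neg_atTop_atBot
  · intro a b a' b' hab hab' z hz h1 h2
    have e1 := (hrev x (-b) (-a) (by linarith) (h.h1_loc _ _ (by linarith))).2
    have e2 := hrev z a' b' hab' hz
    rw [neg_neg, neg_neg] at e1
    rw [e1, ← e2.2]
    exact h.minimal (-b) (-a) (-b') (-a') (by linarith) (by linarith) _ e2.1 (by simpa using h2)
      (by simpa using h1)

end IsParabolicMorseMinimizer

theorem abs_deriv_norm_le {x : ℝ → Conf n} {v : Conf n} {t : ℝ} (h : HasDerivAt x v t)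
    (h0 : x t ≠ 0) : ∃ r', HasDerivAt (fun t => ‖x t‖) r' t ∧ |r'| ≤ ‖v‖ := by
  have hz0 : 0 < ‖x t‖ := norm_pos_iff.mpr h0
  have h1 := h.norm_sq.sqrt (by positivity)
  simp only [Real.sqrt_sq (norm_nonneg _)] at h1
  refine ⟨_, h1, ?_⟩
  rw [mul_div_mul_left _ _ two_ne_zero, abs_div, abs_of_pos hz0, div_le_iff₀ hz0, mul_comm]
  exact abs_real_inner_le_norm _ _

/-- Young's inequality: the Lagrangian dominates the density of the Jacobi length. -/
theorem sqrt_mul_le_lagr {p : C2Sphere n × Ioo (0 : ℝ) 2} (hp : ∀ s, 0 ≤ p.1 s) {x : ℝ → Conf n}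
    {t : ℝ} (h0 : x t ≠ 0) :
    √(2 * radialExt p.1 (x t)) * ‖x t‖ ^ (homExp p - 1) * ‖deriv x t‖ ≤ lagr p x t := by
  have hz0 : 0 < ‖x t‖ := norm_pos_iff.mpr h0
  have hu : 0 ≤ radialExt p.1 (x t) := by rw [radialExt_of_ne _ h0]; exact hp _
  set u := radialExt p.1 (x t)
  set N := ‖x t‖ ^ (homExp p - 1) with hN
  have hN2 : N ^ 2 = (‖x t‖ ^ (p.2 : ℝ))⁻¹ := by
    rw [hN, ← Real.rpow_natCast, ← Real.rpow_mul hz0.le, ← Real.rpow_neg hz0.le]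
    congr 1
    unfold homExp; push_cast; ring
  have hsq : √(2 * u) ^ 2 = 2 * u := Real.sq_sqrt (by linarith)
  rw [lagr, div_eq_mul_inv (radialExt _ _), ← hN2]
  have : (√(2 * u) * N) ^ 2 = 2 * (u * N ^ 2) := by rw [mul_pow, hsq]; ring
  nlinarith [sq_nonneg (‖deriv x t‖ - √(2 * u) * N)]

namespace IsParabolicMorseMinimizer

variable {ξm ξp : USphere n} {p : C2Sphere n × Ioo (0 : ℝ) 2} {x : ℝ → Conf n} {m : ℝ}

theorem tendsto_radialExt (h : IsParabolicMorseMinimizer ξm ξp p x) :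
    Tendsto (fun t => radialExt p.1 (x t)) atTop (𝓝 (p.1 ξp)) := by
  have hc := (radialExt_contDiffAt p.1 (ne_zero_of_mem_unit_sphere ξp)).continuousAt
  have h1 := hc.tendsto.comp h.dir_atTop
  rw [radialExt_coe] at h1
  refine h1.congr fun t => ?_
  exact radialExt_smul _ (inv_pos.mpr (norm_pos_iff.mpr (h.ne_zero t))) _

theorem absolutelyContinuous_norm_rpow (h : IsParabolicMorseMinimizer ξm ξp p x) {a b : ℝ}
    (hab : a ≤ b) (q : ℝ) : AbsolutelyContinuousOnInterval (fun t => ‖x t‖ ^ q) a b := by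
  obtain ⟨t₀, h0, hmin⟩ := h.min_pos
  have hac := (h.isH1 hab).hasVel.absolutelyContinuous hab
  obtain ⟨R, hR⟩ := hac.exists_bound
  have hC : ContDiffOn ℝ 1 (fun r : ℝ => r ^ q) (Icc ‖x t₀‖ R) := fun r hr =>
    (Real.contDiffAt_rpow_const_of_ne (h0.trans_le hr.1).ne').contDiffWithinAt
  obtain ⟨K, hK⟩ := hC.exists_lipschitzOnWith (by norm_num) (convex_Icc _ _) isCompact_Icc
  refine hac.of_dist_le (K := K) fun s hs t ht => ?_
  refine (hK.dist_le_mul _ ⟨hmin s, hR s hs⟩ _ ⟨hmin t, hR t ht⟩).trans ?_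
  gcongr
  exact dist_norm_norm_le _ _

/-- Comparison with the path through the origin, improved by a differential inequality. -/
theorem integral_lagr_le_add_rayCost (h : IsParabolicMorseMinimizer ξm ξp p x) (hm : 0 < m)
    (hp : ∀ s, m ≤ p.1 s) (hξ : p.1 ξp = m) (t₀ : ℝ) :
    ∃ K, 0 ≤ K ∧ ∀ t, t₀ ≤ t → ∫ s in t₀..t, lagr p x s ≤ K + rayCost m p * ‖x t‖ ^ homExp p := by
  have hβ := homExp_pos p
  have hp0 : ∀ s, 0 ≤ p.1 s := fun s => hm.le.trans (hp s)
  have hn : ∀ t, 0 < ‖x t‖ := fun t => norm_pos_iff.mpr (h.ne_zero t)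
  set K := √(2 * radialExt p.1 (x t₀)) / homExp p * ‖x t₀‖ ^ homExp p with hK
  have hK0 : 0 ≤ K := by positivity
  set W : ℝ → ℝ := fun t => (∫ s in t₀..t, lagr p x s) - K with hW
  have hInt : ∀ s t, s ≤ t → IntervalIntegrable (lagr p x) volume s t := fun s t hst =>
    (h.isH1 hst).intervalIntegrable_lagr hst fun u _ => h.ne_zero u
  have hWle : ∀ t, t₀ < t → W t ≤ √(2 * radialExt p.1 (x t)) / homExp p * ‖x t‖ ^ homExp p := by
    intro t ht
    have := h.integral_lagr_le hp0 ht (JoinedAtCost.through_zero (h.ne_zero t₀) (h.ne_zero t)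
      fun s => hm.trans_le (hp s))
    rw [hW]
    linarith
  refine ⟨K, hK0, fun t₁ ht₁ => ?_⟩
  by_contra hcon
  push Not at hcon
  have hL := rayCost_pos hm p
  have hW1 : rayCost m p * ‖x t₁‖ ^ homExp p < W t₁ := by rw [hW]; linarith
  have hW1p : 0 < W t₁ := lt_of_le_of_lt (by positivity) hW1
  have hlt : t₀ < t₁ := by
    refine lt_of_le_of_ne ht₁ ?_
    rintro rfl
    simp only [hW, intervalIntegral.integral_same] at hW1p
    linarith
  -- Where `W ≥ 0`, `W' ≥ √(2U) r^(β-1) |v| ≥ β W |r'|/r`, by the Jacobi bound and `hWle`, so `W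
  -- r^(-β)` is nondecreasing. Yet `W r^(-β) ≤ √(2U)/β`, which tends to `L`; thus `W r^(-β)` cannot
  -- exceed `L` at any time `t₁`.
  have hmono : ∀ t₂, t₁ ≤ t₂ →
      W t₁ * ‖x t₁‖ ^ (-homExp p) ≤ W t₂ * ‖x t₂‖ ^ (-homExp p) := by
    intro t₂ h12
    have h02 : t₀ ≤ t₂ := ht₁.trans h12
    have hWac : AbsolutelyContinuousOnInterval W t₁ t₂ := by
      have h1 := (hInt t₀ t₂ h02).absolutelyContinuousOnInterval_intervalIntegral left_mem_uIcc
      have h2 := h1.of_dist_le (g := W) (K := 1) fun s _ t _ => by simp [hW]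
      refine h2.mono ?_
      rw [uIcc_of_le h12, uIcc_of_le h02]
      exact Icc_subset_Icc ht₁ le_rfl
    have hρac := h.absolutelyContinuous_norm_rpow h12 (-homExp p)
    have hFTC := hWac.integral_deriv_mul_eq_sub hρac
    have hnn : 0 ≤ ∫ t in t₁..t₂, deriv W t * ‖x t‖ ^ (-homExp p) +
        W t * deriv (fun t => ‖x t‖ ^ (-homExp p)) t := by
      refine intervalIntegral.integral_nonneg_of_ae_restrict h12 ?_
      have hd1 := (hInt t₀ t₂ h02).ae_hasDerivAt_integral
      filter_upwards [(h.isH1 h12).hasVel.ae_hasDerivAt, ae_restrict_mem measurableSet_Icc,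
        ae_restrict_of_ae hd1] with t hxt ht hd
      rw [uIcc_of_le h02] at hd
      have hWd : HasDerivAt W (lagr p x t) t :=
        (hd ⟨ht₁.trans ht.1, ht.2⟩ t₀ ⟨le_rfl, h02⟩).sub_const K
      obtain ⟨r', hr', hr'v⟩ := abs_deriv_norm_le hxt (h.ne_zero t)
      have hρd := hr'.rpow_const (p := -homExp p) (Or.inl (hn t).ne')
      rw [hWd.deriv, hρd.deriv]
      have hWt0 : 0 ≤ W t := by
        have hadd := intervalIntegral.integral_add_adjacent_intervals (hInt t₀ t₁ ht₁)
          (hInt t₁ t ht.1)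
        have hnn2 : 0 ≤ ∫ s in t₁..t, lagr p x s :=
          intervalIntegral.integral_nonneg ht.1 fun u _ => lagr_nonneg hp0 (h.ne_zero u)
        simp only [hW] at hW1p ⊢
        linarith
      have hWt := hWle t (hlt.trans_le ht.1)
      have hlag := sqrt_mul_le_lagr hp0 (h.ne_zero t)
      set r := ‖x t‖ with hr
      have hr0 : 0 < r := hn t
      set S := √(2 * radialExt p.1 (x t)) with hS
      have hS0 : 0 ≤ S := Real.sqrt_nonneg _
      have e1 : r ^ (homExp p - 1) * r ^ (-homExp p) = r⁻¹ := by
        rw [← Real.rpow_add hr0, ← Real.rpow_neg_one]; congr 1; ring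
      have e2 : r ^ homExp p * r ^ (-homExp p - 1) = r⁻¹ := by
        rw [← Real.rpow_add hr0, ← Real.rpow_neg_one]; congr 1; ring
      have i1 : S * r⁻¹ * ‖deriv x t‖ ≤ lagr p x t * r ^ (-homExp p) := by
        have := mul_le_mul_of_nonneg_right hlag (Real.rpow_nonneg hr0.le (-homExp p))
        calc S * r⁻¹ * ‖deriv x t‖ = S * r ^ (homExp p - 1) * ‖deriv x t‖ * r ^ (-homExp p) := by
              rw [← e1]; ring
          _ ≤ _ := this
      have i2 : W t * (homExp p * r ^ (-homExp p - 1) * |r'|) ≤ S * r⁻¹ * ‖deriv x t‖ := by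
        calc W t * (homExp p * r ^ (-homExp p - 1) * |r'|)
            ≤ S / homExp p * r ^ homExp p * (homExp p * r ^ (-homExp p - 1) * ‖deriv x t‖) := by
              gcongr
          _ = S * (r ^ homExp p * r ^ (-homExp p - 1)) * ‖deriv x t‖ := by field_simp
          _ = _ := by rw [e2]
      have i3 : W t * (homExp p * r ^ (-homExp p - 1) * r') ≤
          W t * (homExp p * r ^ (-homExp p - 1) * |r'|) := by
        gcongr; exact le_abs_self _
      simp only [Pi.zero_apply]
      linarith
    linarith
  have hlim : Tendsto (fun t => √(2 * radialExt p.1 (x t)) / homExp p) atTop (𝓝 (rayCost m p)) := by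
    have := ((h.tendsto_radialExt.const_mul 2).sqrt).div_const (homExp p)
    rw [hξ] at this
    exact this
  have hfin : W t₁ * ‖x t₁‖ ^ (-homExp p) ≤ rayCost m p := by
    refine ge_of_tendsto hlim ?_
    filter_upwards [eventually_ge_atTop t₁] with t ht
    refine (hmono t ht).trans ?_
    have := mul_le_mul_of_nonneg_right (hWle t (hlt.trans_le ht))
      (Real.rpow_nonneg (hn t).le (-homExp p))
    rwa [mul_assoc, ← Real.rpow_add (hn t), add_neg_cancel, Real.rpow_zero, mul_one] at this
  have := mul_le_mul_of_nonneg_right hfin (Real.rpow_nonneg (hn t₁).le (homExp p))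
  rw [mul_assoc, ← Real.rpow_add (hn t₁), neg_add_cancel, Real.rpow_zero, mul_one] at this
  linarith

/-- `shrink m 1` is the constant angular potential `m`. Removing the excess from the action leaves
the action for this isotropic potential, bounded below by the radial calibration; the terms in `‖x
t‖` cancel. -/
theorem integral_excess_le (h : IsParabolicMorseMinimizer ξm ξp p x) (hm : 0 < m)
    {t₀ t K : ℝ} (ht : t₀ ≤ t)
    (hK : ∫ s in t₀..t, lagr p x s ≤ K + rayCost m p * ‖x t‖ ^ homExp p) :
    ∫ s in t₀..t, (radialExt p.1 (x s) - m) / ‖x s‖ ^ (p.2 : ℝ) ≤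
      K + rayCost m p * ‖x t₀‖ ^ homExp p := by
  have hs := (h.isH1 ht).integral_lagr_shrink (p := p) ht (fun u _ => h.ne_zero u) m 1
  have hmin : ∀ s, m ≤ (p.1.shrink m 1) s := fun s => by simp [C2Sphere.shrink_apply]
  have hmin0 : ∀ s, 0 ≤ (p.1.shrink m 1) s := fun s => hm.le.trans (hmin s)
  have h1 := (h.isH1 ht).ofReal_radial_le_action (p := (p.1.shrink m 1, p.2)) hm hmin ht
  rw [(h.isH1 ht).action_eq_integral ht (fun u _ => h.ne_zero u) hmin0] at h1
  have h2 := (ENNReal.ofReal_le_ofReal_iff (intervalIntegral.integral_nonneg ht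
    fun u _ => lagr_nonneg hmin0 (h.ne_zero u))).mp h1
  rw [hs] at h2
  change rayCost m p * |‖x t‖ ^ homExp p - ‖x t₀‖ ^ homExp p| ≤ _ at h2
  have h3 := mul_le_mul_of_nonneg_left (le_abs_self (‖x t‖ ^ homExp p - ‖x t₀‖ ^ homExp p))
    (rayCost_pos hm p).le
  rw [mul_sub] at h3
  linarith

/-- Along suitable times the direction of a minimizer converges to its limit faster than the
square root of the radial cost diverges. -/
theorem exists_small_deviation (h : IsParabolicMorseMinimizer ξm ξp p x) (hm : 0 < m)
    (hp : ∀ s, m ≤ p.1 s) (hξ : p.1 ξp = m) {δ μ : ℝ} (hδ : 0 < δ) (hμ : 0 < μ)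
    (hnd : ∀ s : USphere n, ‖(s : Conf n) - ξp‖ < δ → μ * ‖(s : Conf n) - ξp‖ ^ 2 ≤ p.1 s - p.1 ξp)
    {ε : ℝ} (hε : 0 < ε) (T : ℝ) :
    ∃ t, T ≤ t ∧ ‖‖x t‖⁻¹ • x t - ξp‖ ≤ 1 ∧
      ‖x t‖ ^ homExp p * ‖‖x t‖⁻¹ • x t - ξp‖ ^ 2 < ε := by
  by_contra hcon
  push Not at hcon
  have hβ := homExp_pos p
  have hβ1 := homExp_lt_one p
  have hL := rayCost_pos hm p
  obtain ⟨K, hK0, hK⟩ := h.integral_lagr_le_add_rayCost hm hp hξ 0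
  have hp0 : ∀ s, 0 ≤ p.1 s := fun s => hm.le.trans (hp s)
  set N := K + rayCost m p with hN
  have hN0 : 0 < N := by positivity
  have hdir : ∀ᶠ t in atTop, ‖‖x t‖⁻¹ • x t - (ξp : Conf n)‖ < min δ 1 := by
    have := h.dir_atTop.eventually (Metric.ball_mem_nhds (ξp : Conf n) (by positivity : 0 < min δ 1))
    simpa [dist_eq_norm] using this
  obtain ⟨T₁, hT₁⟩ := (((hdir.and (h.norm_atTop.eventually_ge_atTop (max 1 (2 * ‖x 0‖)))).and
    ((eventually_ge_atTop T).and (eventually_ge_atTop 1)))).exists_forall_of_atTop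
  have h1T : 1 ≤ T₁ := (hT₁ T₁ le_rfl).2.2
  set D : ℝ → ℝ := fun s => (radialExt p.1 (x s) - m) / ‖x s‖ ^ (p.2 : ℝ) with hD
  have hDc : Continuous D := by
    rw [← continuousOn_univ]
    exact h.continuous.continuousOn.angular_excess (fun t _ => h.ne_zero t) _ _ _
  have hD0 : ∀ t, 0 ≤ D t := by
    intro t
    have := hp (toUSphere (x t) (h.ne_zero t))
    simp only [hD, radialExt_of_ne _ (h.ne_zero t)]
    have : 0 ≤ p.1 (toUSphere (x t) (h.ne_zero t)) - m := by linarith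
    positivity
  -- If `r^β θ² ≥ ε` at all late times, nondegeneracy gives `D ≥ μ ε r^(-(α+β))`. Since `α + β = 2 -
  -- β` and Cauchy–Schwarz gives `r^(2-β) ≤ 8 N t`, `D ≥ c/t`, against the bound on its integral.
  set c := μ * ε / (8 * N) with hc
  have hc0 : 0 < c := by positivity
  have hlow : ∀ t, T₁ ≤ t → c * t⁻¹ ≤ D t := by
    intro t ht
    obtain ⟨⟨hd, hr⟩, hTt, h1t⟩ := hT₁ t ht
    have ht0 : 0 < t := by linarith
    have hr1 : 1 ≤ ‖x t‖ := (le_max_left _ _).trans hr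
    have hr2 : 2 * ‖x 0‖ ≤ ‖x t‖ := (le_max_right _ _).trans hr
    have hr0 : 0 < ‖x t‖ := by linarith
    have hdev := hcon t hTt (hd.le.trans (min_le_right _ _))
    set r := ‖x t‖ with hrdef
    set θ := ‖r⁻¹ • x t - (ξp : Conf n)‖ with hθ
    have hU : μ * θ ^ 2 ≤ radialExt p.1 (x t) - m := by
      have := hnd (toUSphere (x t) (h.ne_zero t)) (hd.trans_le (min_le_left _ _))
      rw [hξ, ← radialExt_of_ne (p.1 : USphere n → ℝ) (h.ne_zero t)] at this
      exact this
    have hgrow : r ^ (2 - homExp p) ≤ 8 * N * t := by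
      have hact : action p 0 t x ≤ ENNReal.ofReal (N * r ^ homExp p) := by
        rw [(h.isH1 (ht0.le)).action_eq_integral ht0.le (fun u _ => h.ne_zero u) hp0]
        refine ENNReal.ofReal_le_ofReal ((hK t ht0.le).trans ?_)
        have : 1 ≤ r ^ homExp p := Real.one_le_rpow hr1 hβ.le
        rw [hN, add_mul]
        have := mul_le_mul_of_nonneg_left this hK0
        linarith
      have hsq := (h.isH1 ht0.le).norm_sub_sq_le ht0.le (by positivity) hact
      have hhalf : r / 2 ≤ ‖x t - x 0‖ := by
        have := norm_sub_norm_le (x t) (x 0)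
        linarith
      have : (r / 2) ^ 2 ≤ 2 * (t - 0) * (N * r ^ homExp p) := le_trans (by gcongr) hsq
      rw [sub_zero] at this
      rw [Real.rpow_sub hr0, div_le_iff₀ (Real.rpow_pos_of_pos hr0 _)]
      have e : r ^ (2 : ℝ) = r ^ 2 := by norm_cast
      rw [e]
      nlinarith
    have hrβ : 0 < r ^ homExp p := Real.rpow_pos_of_pos hr0 _
    have hrα : 0 < r ^ (p.2 : ℝ) := Real.rpow_pos_of_pos hr0 _
    have hexp : r ^ (2 - homExp p) = r ^ homExp p * r ^ (p.2 : ℝ) := by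
      rw [← Real.rpow_add hr0]; congr 1; unfold homExp; ring
    have hθ2 : ε / r ^ homExp p ≤ θ ^ 2 := by
      rw [div_le_iff₀ hrβ]; linarith
    calc c * t⁻¹ = μ * (ε / (8 * N * t)) := by rw [hc]; field_simp
      _ ≤ μ * (ε / (r ^ homExp p * r ^ (p.2 : ℝ))) := by
          rw [← hexp]; gcongr
      _ = μ * (ε / r ^ homExp p) / r ^ (p.2 : ℝ) := by field_simp
      _ ≤ μ * θ ^ 2 / r ^ (p.2 : ℝ) := by gcongr
      _ ≤ D t := by
          simp only [hD]; gcongr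
  have hbound : ∀ t, T₁ ≤ t → c * (Real.log t - Real.log T₁) ≤
      K + rayCost m p * ‖x 0‖ ^ homExp p := by
    intro t ht
    have hT₁0 : 0 < T₁ := by linarith
    have ht0 : 0 < t := hT₁0.trans_le ht
    have hlog : ∫ s in T₁..t, c * s⁻¹ = c * (Real.log t - Real.log T₁) := by
      rw [intervalIntegral.integral_const_mul, integral_inv_of_pos hT₁0 ht0,
        Real.log_div ht0.ne' hT₁0.ne']
    rw [← hlog]
    have i1 : ∫ s in T₁..t, c * s⁻¹ ≤ ∫ s in T₁..t, D s := by
      refine intervalIntegral.integral_mono_on ht ?_ (hDc.intervalIntegrable _ _)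
        fun s hs => hlow s hs.1
      refine ContinuousOn.intervalIntegrable ?_
      rw [uIcc_of_le ht]
      refine continuousOn_const.mul (continuousOn_id.inv₀ fun s hs => ?_)
      exact (hT₁0.trans_le hs.1).ne'
    have i2 : ∫ s in T₁..t, D s ≤ ∫ s in (0 : ℝ)..t, D s := by
      rw [← intervalIntegral.integral_add_adjacent_intervals (hDc.intervalIntegrable 0 T₁)
        (hDc.intervalIntegrable T₁ t)]
      have : 0 ≤ ∫ s in (0 : ℝ)..T₁, D s :=
        intervalIntegral.integral_nonneg hT₁0.le fun u _ => hD0 u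
      linarith
    exact i1.trans (i2.trans (h.integral_excess_le hm ht0.le (hK t ht0.le)))
  have hlog : Tendsto (fun t => c * (Real.log t - Real.log T₁)) atTop atTop :=
    (tendsto_atTop_add_const_right _ (-Real.log T₁) Real.tendsto_log_atTop).const_mul_atTop hc0
  obtain ⟨t, ht, ht'⟩ := ((hlog.eventually_gt_atTop (K + rayCost m p * ‖x 0‖ ^ homExp p)).and
    (eventually_ge_atTop T₁)).exists
  exact absurd (hbound t ht') (not_le.mpr ht)

end IsParabolicMorseMinimizer

/-! ### Existence of a minimizer implies membership in the boundary -/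

namespace IsParabolicMorseMinimizer

variable {ξm ξp : USphere n} {p : C2Sphere n × Ioo (0 : ℝ) 2} {x : ℝ → Conf n} {m Vmin : ℝ}

theorem exists_norm_eq (h : IsParabolicMorseMinimizer ξm ξp p x) {θ : ℝ} (hθ : 0 < θ) (T : ℝ) :
    ∃ R₀, ∀ R, R₀ ≤ R → ∃ b, T ≤ b ∧ ‖x b‖ = R ∧ ‖‖x b‖⁻¹ • x b - ξp‖ < θ := by
  have hdir := h.dir_atTop.eventually (Metric.ball_mem_nhds (ξp : Conf n) hθ)
  obtain ⟨T₁, hT₁⟩ := (hdir.and (eventually_ge_atTop T)).exists_forall_of_atTop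
  refine ⟨‖x T₁‖, fun R hR => ?_⟩
  obtain ⟨T₂, h1, h2⟩ := ((h.norm_atTop.eventually_ge_atTop R).and
    (eventually_ge_atTop T₁)).exists
  obtain ⟨b, hb, hbR⟩ := intermediate_value_Icc h2 h.continuous.norm.continuousOn ⟨hR, h1⟩
  refine ⟨b, (hT₁ b hb.1).2, hbR, ?_⟩
  have := (hT₁ b hb.1).1
  rwa [dist_eq_norm] at this

theorem joined_ray (h : IsParabolicMorseMinimizer ξm ξp p x) {M R b : ℝ} (hM0 : 0 ≤ M)
    (hM : ∀ s, p.1 s ≤ M) (hb : ‖x b‖ = R) (hθ : ‖‖x b‖⁻¹ • x b - ξp‖ ≤ 1 / 2) :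
    JoinedAtCost p univ (R • (ξp : Conf n)) (x b)
      (R ^ homExp p * ((1 / 2 + 16 * M) * ‖‖x b‖⁻¹ • x b - ξp‖)) := by
  have hR : 0 < R := hb ▸ norm_pos_iff.mpr (h.ne_zero b)
  have h1 := JoinedAtCost.of_near hM0 hM (norm_eq_of_mem_sphere ξp).ge hθ
  have h2 := h1.smul hR (K' := univ) fun _ _ => mem_univ _
  have e : R • ‖x b‖⁻¹ • x b = x b := by
    rw [smul_smul, hb, mul_inv_cancel₀ hR.ne', one_smul]
  rwa [e] at h2

/-- The minimizer between its two arms at radius `R` is compared with a dilated path of cost `C <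
2L`. The gap `g R^β` exceeds the connections, at most `g R^β / 4` in total, and the constant `2 L
r₀^β` lost in the radial lower bound. -/
theorem notMem_regionOut (hVmin : 0 < Vmin) {V : classP ξm ξp Vmin}
    (h : IsParabolicMorseMinimizer ξm ξp V.1 x) : V ∉ regionOut ξm ξp Vmin := by
  intro hV
  obtain ⟨C, hC, hJ⟩ := exists_joined_of_mem_regionOut hV
  have hβ := homExp_pos V.1
  have hL := rayCost_pos hVmin V.1
  set p := V.1 with hp
  set L := rayCost Vmin p with hLdef
  set M := ‖(jet2 p.1).1‖ with hMdef
  have hM0 : 0 ≤ M := norm_nonneg _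
  have hM : ∀ s, p.1 s ≤ M := C2Sphere.le_norm_jet2 p.1
  set C₁ := 1 / 2 + 16 * M with hC₁
  have hC₁0 : 0 < C₁ := by positivity
  set g := 2 * L - C with hg
  have hg0 : 0 < g := by linarith
  set θ := min (1 / 2) (g / (8 * C₁)) with hθ
  have hθ0 : 0 < θ := by positivity
  have hθC : C₁ * θ ≤ g / 8 := by
    calc C₁ * θ ≤ C₁ * (g / (8 * C₁)) := by gcongr; exact min_le_right _ _
      _ = g / 8 := by field_simp
  obtain ⟨t₀, hr0, hmin⟩ := h.min_pos
  set r₀ := ‖x t₀‖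
  obtain ⟨R₁, hR₁⟩ := h.exists_norm_eq hθ0 t₀
  obtain ⟨R₂, hR₂⟩ := h.reverse.exists_norm_eq hθ0 (-t₀)
  have hpow : Tendsto (fun R : ℝ => R ^ homExp p * (g / 2)) atTop atTop :=
    (tendsto_rpow_atTop hβ).atTop_mul_const (by positivity)
  obtain ⟨R, ⟨hRg, hRr⟩, hRR₁, hRR₂⟩ :=
    (((hpow.eventually_gt_atTop (2 * L * r₀ ^ homExp p)).and (eventually_gt_atTop r₀)).and
    ((eventually_ge_atTop R₁).and (eventually_ge_atTop R₂))).exists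
  have hR0 : 0 < R := hr0.trans hRr
  obtain ⟨b, hb0, hbR, hbθ⟩ := hR₁ R hRR₁
  obtain ⟨a', ha0, haR, haθ⟩ := hR₂ R hRR₂
  have j1 := h.joined_ray hM0 hM hbR (hbθ.le.trans (min_le_left _ _))
  have j2 := h.reverse.joined_ray hM0 hM haR (haθ.le.trans (min_le_left _ _))
  have j3 := hJ.smul hR0 (K' := univ) fun _ _ => mem_univ _
  have j := (j2.symm.trans j3).trans j1
  have hat : -a' ≤ t₀ := by linarith
  have hab : -a' < b := by
    refine lt_of_le_of_ne (hat.trans hb0) fun e => ?_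
    have : t₀ = b := le_antisymm hb0 (e ▸ hat)
    rw [← this] at hbR
    exact absurd hbR hRr.ne
  have hact := h.action_le hab j
  rw [action_add _ x hat hb0] at hact
  have l1 := (h.isH1 hat).ofReal_radial_le_action (p := p) hVmin (classP_min V) hat
  have l2 := (h.isH1 hb0).ofReal_radial_le_action (p := p) hVmin (classP_min V) hb0
  have l3 := (add_le_add l1 l2).trans hact
  rw [← ENNReal.ofReal_add (by positivity) (by positivity), ENNReal.ofReal_le_ofReal_iff j.1, haR,
    hbR] at l3
  change L * _ + L * _ ≤ _ at l3
  have l4 : R ^ homExp p - r₀ ^ homExp p ≤ |R ^ homExp p - r₀ ^ homExp p| := le_abs_self _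
  rw [abs_sub_comm (‖x t₀‖ ^ homExp p)] at l3
  have l5 := mul_le_mul_of_nonneg_left l4 hL.le
  have hRβ : 0 < R ^ homExp p := Real.rpow_pos_of_pos hR0 _
  rw [haR] at haθ
  rw [hbR] at hbθ
  have k1 : R ^ homExp p * (C₁ * ‖R⁻¹ • x (-a') - (ξm : Conf n)‖) ≤ R ^ homExp p * (g / 8) := by
    gcongr
    exact le_trans (by gcongr) hθC
  have k2 : R ^ homExp p * (C₁ * ‖R⁻¹ • x b - (ξp : Conf n)‖) ≤ R ^ homExp p * (g / 8) := by
    gcongr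
    exact le_trans (by gcongr) hθC
  have hgR : R ^ homExp p * g = R ^ homExp p * (2 * L) - R ^ homExp p * C := by rw [hg]; ring
  have hm1 : L * (R ^ homExp p - r₀ ^ homExp p) = R ^ homExp p * L - L * r₀ ^ homExp p := by ring
  have hgR0 : 0 < R ^ homExp p * g := by positivity
  change L * |R ^ homExp p - r₀ ^ homExp p| + L * |R ^ homExp p - r₀ ^ homExp p| ≤
    R ^ homExp p * (C₁ * ‖R⁻¹ • x (-a') - (ξm : Conf n)‖) + R ^ homExp p * C +
      R ^ homExp p * (C₁ * ‖R⁻¹ • x b - (ξp : Conf n)‖) at l3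
  linarith

/-- Going to the origin in a direction near a minimum costs more than along the minimal ray only to
second order in the angle. -/
theorem sqrt_angular_le {U : C2Sphere n} {ξ : USphere n} {M : ℝ} (hm : 0 < m)
    (hM : ∀ s, U s ≤ m + M * ‖(s : Conf n) - ξ‖ ^ 2) (hU : ∀ s, m ≤ U s) (s : USphere n) :
    √(2 * U s) ≤ √(2 * m) + M / √(2 * m) * ‖(s : Conf n) - ξ‖ ^ 2 := by
  have hκ : 0 < √(2 * m) := Real.sqrt_pos.mpr (by linarith)
  have h0 : 0 ≤ M * ‖(s : Conf n) - ξ‖ ^ 2 := by linarith [hM s, hU s]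
  have e : M / √(2 * m) * ‖(s : Conf n) - ξ‖ ^ 2 = M * ‖(s : Conf n) - ξ‖ ^ 2 / √(2 * m) := by ring
  rw [e]
  apply Real.sqrt_le_iff.mpr
  refine ⟨by positivity, ?_⟩
  have : (√(2 * m) + M * ‖(s : Conf n) - ξ‖ ^ 2 / √(2 * m)) ^ 2 =
      √(2 * m) ^ 2 + 2 * (M * ‖(s : Conf n) - ξ‖ ^ 2) +
        (M * ‖(s : Conf n) - ξ‖ ^ 2 / √(2 * m)) ^ 2 := by
    field_simp
    ring
  rw [this, Real.sq_sqrt (by linarith)]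
  nlinarith [hM s, sq_nonneg (M * ‖(s : Conf n) - ξ‖ ^ 2 / √(2 * m))]

/-- The angular potential is not constantly minimal along a minimizer. -/
theorem exists_integral_excess_pos (hξ : ξp ≠ ξm) {V : classP ξm ξp Vmin}
    (h : IsParabolicMorseMinimizer ξm ξp V.1 x) :
    ∃ a₀ b₀ η, a₀ < b₀ ∧ 0 < η ∧ ∀ a b, a ≤ a₀ → b₀ ≤ b →
      η ≤ ∫ t in a..b, (radialExt V.1.1 (x t) - Vmin) / ‖x t‖ ^ (V.1.2 : ℝ) := by
  obtain ⟨δ, hδ, μ, hμ, hnd⟩ := V.2.2.2.2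
  set D : ℝ → ℝ := fun s => (radialExt V.1.1 (x s) - Vmin) / ‖x s‖ ^ (V.1.2 : ℝ) with hD
  have hDc : Continuous D := by
    rw [← continuousOn_univ]
    exact h.continuous.continuousOn.angular_excess (fun t _ => h.ne_zero t) _ _ _
  have hD0 : ∀ t, 0 ≤ D t := by
    intro t
    have := classP_min V (toUSphere (x t) (h.ne_zero t))
    simp only [hD, radialExt_of_ne _ (h.ne_zero t)]
    have : 0 ≤ V.1.1 (toUSphere (x t) (h.ne_zero t)) - Vmin := by linarith
    positivity
  set d := ‖(ξm : Conf n) - ξp‖ with hd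
  have hd0 : 0 < d := norm_pos_iff.mpr (sub_ne_zero.mpr fun e => hξ (Subtype.ext e.symm))
  set φ : ℝ → ℝ := fun t => ‖‖x t‖⁻¹ • x t - (ξp : Conf n)‖ with hφ
  have hφc : Continuous φ := by
    have h1 : Continuous fun t => ‖x t‖⁻¹ :=
      h.continuous.norm.inv₀ fun t => norm_ne_zero_iff.mpr (h.ne_zero t)
    exact ((h1.smul h.continuous).sub continuous_const).norm
  -- The deviation from `ξp` varies continuously from `d` to `0`, hence takes the value `v`; as `0 <
  -- v < δ`, nondegeneracy makes the potential exceed its minimum there.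
  set v := min δ d / 2 with hv
  have hv0 : 0 < v := by positivity
  have hvδ : v < δ := by
    have := min_le_left δ d
    have : 0 < min δ d := by positivity
    linarith
  have hvd : v < d := by
    have := min_le_right δ d
    have : 0 < min δ d := by positivity
    linarith
  have l1 : Tendsto φ atTop (𝓝 0) := by
    have := (h.dir_atTop.sub_const (ξp : Conf n)).norm
    simpa using this
  have l2 : Tendsto φ atBot (𝓝 d) := (h.dir_atBot.sub_const (ξp : Conf n)).norm
  obtain ⟨t₁, ht₁⟩ := (l1.eventually (gt_mem_nhds hv0)).exists
  obtain ⟨t₂, ht₂, ht₂₁⟩ := ((l2.eventually (lt_mem_nhds hvd)).and (eventually_le_atBot t₁)).exists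
  obtain ⟨s, hs, hsv⟩ := intermediate_value_Icc' ht₂₁ hφc.continuousOn ⟨ht₁.le, ht₂.le⟩
  have hDs : 0 < D s := by
    have h1 := hnd ξp (by simp) (toUSphere (x s) (h.ne_zero s)) (hsv.trans_lt hvδ)
    have h2 : ‖(toUSphere (x s) (h.ne_zero s) : Conf n) - ξp‖ = v := hsv
    rw [h2, classP_right] at h1
    have h3 : 0 < V.1.1 (toUSphere (x s) (h.ne_zero s)) - Vmin := lt_of_lt_of_le (by positivity) h1
    have h4 : 0 < ‖x s‖ := norm_pos_iff.mpr (h.ne_zero s)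
    simp only [hD, radialExt_of_ne _ (h.ne_zero s)]
    positivity
  have hpos : 0 < ∫ t in (s - 1)..(s + 1), D t :=
    intervalIntegral.integral_pos (by linarith) hDc.continuousOn (fun t _ => hD0 t)
      ⟨s, ⟨by linarith, by linarith⟩, hDs⟩
  refine ⟨s - 1, s + 1, _, by linarith, hpos, fun a b ha hb => ?_⟩
  have e1 := intervalIntegral.integral_add_adjacent_intervals (hDc.intervalIntegrable (μ := volume) a (s - 1))
    (hDc.intervalIntegrable (s - 1) (s + 1))
  have e2 := intervalIntegral.integral_add_adjacent_intervals (hDc.intervalIntegrable (μ := volume) a (s + 1))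
    (hDc.intervalIntegrable (s + 1) b)
  have p1 : 0 ≤ ∫ t in a..(s - 1), D t := intervalIntegral.integral_nonneg ha fun u _ => hD0 u
  have p2 : 0 ≤ ∫ t in (s + 1)..b, D t := intervalIntegral.integral_nonneg hb fun u _ => hD0 u
  linarith

theorem joined_to_ray {ξ : USphere n} {C : ℝ} {y : Conf n} (hy : y ≠ 0)
    (hC : ∀ s : USphere n, ‖(s : Conf n) - ξ‖ ≤ 1 → ∀ r : ℝ, 0 < r →
      JoinedAtCost p univ (r • (s : Conf n)) ((2 * r) • (ξ : Conf n))
        (√(2 * m) / homExp p * ((2 * r) ^ homExp p - r ^ homExp p) +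
          C * (r ^ homExp p * ‖(s : Conf n) - ξ‖ ^ 2)))
    (hm : 0 < m) (hξ : p.1 ξ = m) (hdev : ‖‖y‖⁻¹ • y - ξ‖ ≤ 1) {R : ℝ} (hR : 2 * ‖y‖ ≤ R) :
    JoinedAtCost p univ y (R • (ξ : Conf n)) (rayCost m p * (R ^ homExp p - ‖y‖ ^ homExp p) +
      C * (‖y‖ ^ homExp p * ‖‖y‖⁻¹ • y - ξ‖ ^ 2)) := by
  have h1 := hC (toUSphere y hy) hdev ‖y‖ (norm_pos_iff.mpr hy)
  rw [toUSphere_smul_norm] at h1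
  have h2 := (JoinedAtCost.radial (p := p) ξ (by rw [hξ]; exact hm) (by positivity) hR).mono
    (subset_univ _) le_rfl
  refine (h1.trans h2).mono subset_rfl (le_of_eq ?_)
  rw [hξ]
  simp only [rayCost, toUSphere]
  ring

theorem mem_closure_regionOut (hξ : ξp ≠ ξm) (hVmin : 0 < Vmin) {V : classP ξm ξp Vmin}
    (h : IsParabolicMorseMinimizer ξm ξp V.1 x) : V ∈ closure (regionOut ξm ξp Vmin) := by
  obtain ⟨a₀, b₀, η, hab₀, hη, hex⟩ := h.exists_integral_excess_pos hξ
  rw [Metric.mem_closure_iff]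
  intro tol htol
  obtain ⟨⟨U, α⟩, hU⟩ := V
  obtain ⟨hUm, hUp, hUmin, δ, hδ, μ, hμ, hnd⟩ := hU
  dsimp only at hUm hUp hUmin hnd h hex
  have hev : ∀ᶠ ε in 𝓝[>] (0 : ℝ), dist (U.shrink Vmin ε) U < tol :=
    nhdsWithin_le_nhds ((tendsto_shrink U Vmin).eventually (Metric.ball_mem_nhds U htol))
  have hev1 : ∀ᶠ ε in 𝓝[>] (0 : ℝ), ε < 1 := nhdsWithin_le_nhds (gt_mem_nhds one_pos)
  have hev0 : ∀ᶠ ε in 𝓝[>] (0 : ℝ), 0 < ε := self_mem_nhdsWithin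
  obtain ⟨ε, hε, hε0, hε1⟩ := (hev.and (hev0.and hev1)).exists
  set W := U.shrink Vmin ε with hW
  have hWm : W ξm = Vmin := by rw [hW, C2Sphere.shrink_apply, hUm]; ring
  have hWp : W ξp = Vmin := by rw [hW, C2Sphere.shrink_apply, hUp]; ring
  have hWle : ∀ s, W s ≤ U s := fun s => by
    rw [hW, C2Sphere.shrink_apply]; nlinarith [hUmin s]
  have hWmin : ∀ s, Vmin ≤ W s := fun s => by
    rw [hW, C2Sphere.shrink_apply]; nlinarith [hUmin s]
  have hWS : W ∈ classS ξm ξp Vmin := by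
    refine ⟨hWm, hWp, hWmin, δ, hδ, (1 - ε) * μ, mul_pos (by linarith) hμ, fun ξ hξ s hs => ?_⟩
    have := mul_le_mul_of_nonneg_left (hnd ξ hξ s hs) (by linarith : 0 ≤ 1 - ε)
    rw [hW, C2Sphere.shrink_apply, C2Sphere.shrink_apply]
    linarith
  have hp0 : ∀ s, 0 ≤ U s := fun s => hVmin.le.trans (hUmin s)
  set p : C2Sphere n × Ioo (0 : ℝ) 2 := (U, α) with hp
  set q : C2Sphere n × Ioo (0 : ℝ) 2 := (W, α) with hq
  refine ⟨⟨q, hWS⟩, ?_, ?_⟩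
  swap
  · rw [dist_comm, Subtype.dist_eq, Prod.dist_eq]
    simp only [hq, dist_self]
    exact max_lt hε htol
  have hβ := homExp_pos q
  have hexp : homExp p = homExp q := rfl
  have hL := rayCost_pos hVmin q
  set L := rayCost Vmin q with hLdef
  obtain ⟨M₁, hM₁0, hM₁⟩ := U.le_add_sq_of_min ξm fun s => hUm.symm ▸ hUmin s
  obtain ⟨M₂, hM₂0, hM₂⟩ := U.le_add_sq_of_min ξp fun s => hUp.symm ▸ hUmin s
  rw [hUm] at hM₁
  rw [hUp] at hM₂
  obtain ⟨C₁, hC₁0, hC₁⟩ := JoinedAtCost.to_minimal_ray (p := q) hVmin hM₁0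
    fun s => (hWle s).trans (hM₁ s)
  obtain ⟨C₂, hC₂0, hC₂⟩ := JoinedAtCost.to_minimal_ray (p := q) hVmin hM₂0
    fun s => (hWle s).trans (hM₂ s)
  set B₁ := M₁ / √(2 * Vmin) / homExp q + C₁ with hB₁
  set B₂ := M₂ / √(2 * Vmin) / homExp q + C₂ with hB₂
  have hB₁0 : 0 ≤ B₁ := by positivity
  have hB₂0 : 0 ≤ B₂ := by positivity
  -- `B₁` and `B₂` collect the quadratic costs of the deviations at the two ends, from the path
  -- through the origin and from the connections to the rays. With deviations below `ν` their total
  -- stays below the gain `εη`.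
  set ν := ε * η / (2 * (B₁ + B₂ + 1)) with hν
  have hν0 : 0 < ν := by positivity
  obtain ⟨b, hb, hbθ, hbν⟩ := h.exists_small_deviation hVmin hUmin hUp hδ hμ
    (fun s hs => hnd ξp (by simp) s hs) hν0 b₀
  obtain ⟨a', ha, haθ, haν⟩ := h.reverse.exists_small_deviation hVmin hUmin hUm hδ hμ
    (fun s hs => hnd ξm (by simp) s hs) hν0 (-a₀)
  obtain ⟨a, rfl⟩ : ∃ a, a' = -a := ⟨-a', by ring⟩
  rw [neg_neg] at haθ haν
  have hab : a < b := by linarith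
  set R := 2 * max ‖x a‖ ‖x b‖ with hR
  have hRa : 2 * ‖x a‖ ≤ R := by rw [hR]; gcongr; exact le_max_left _ _
  have hRb : 2 * ‖x b‖ ≤ R := by rw [hR]; gcongr; exact le_max_right _ _
  have hxa : 0 < ‖x a‖ := norm_pos_iff.mpr (h.ne_zero a)
  have hR0 : 0 < R := by linarith
  set fa := ‖x a‖ ^ homExp q * ‖‖x a‖⁻¹ • x a - (ξm : Conf n)‖ ^ 2 with hfa
  set fb := ‖x b‖ ^ homExp q * ‖‖x b‖⁻¹ • x b - (ξp : Conf n)‖ ^ 2 with hfb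
  have haν : fa < ν := haν
  have hbν : fb < ν := hbν
  have j1 := joined_to_ray (h.ne_zero a) hC₁ hVmin hWm haθ hRa
  have j3 := joined_to_ray (h.ne_zero b) hC₂ hVmin hWp hbθ hRb
  -- Minimality against the path through the origin.
  have hInt : ∫ t in a..b, lagr p x t ≤ L * ‖x a‖ ^ homExp q + L * ‖x b‖ ^ homExp q +
      M₁ / √(2 * Vmin) / homExp q * fa + M₂ / √(2 * Vmin) / homExp q * fb := by
    refine (h.integral_lagr_le hp0 hab (JoinedAtCost.through_zero (h.ne_zero a) (h.ne_zero b)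
      fun s => hVmin.trans_le (hUmin s))).trans ?_
    have s1 := sqrt_angular_le hVmin hM₁ hUmin (toUSphere (x a) (h.ne_zero a))
    have s2 := sqrt_angular_le hVmin hM₂ hUmin (toUSphere (x b) (h.ne_zero b))
    rw [← radialExt_of_ne (U : USphere n → ℝ)] at s1 s2
    have s1' : √(2 * radialExt U (x a)) / homExp q * ‖x a‖ ^ homExp q ≤
        L * ‖x a‖ ^ homExp q + M₁ / √(2 * Vmin) / homExp q * fa := by
      calc √(2 * radialExt U (x a)) / homExp q * ‖x a‖ ^ homExp q
          ≤ (√(2 * Vmin) + M₁ / √(2 * Vmin) * ‖‖x a‖⁻¹ • x a - (ξm : Conf n)‖ ^ 2) / homExp q *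
            ‖x a‖ ^ homExp q := by
            gcongr; exact s1
        _ = _ := by rw [hLdef, hfa, rayCost]; ring
    have s2' : √(2 * radialExt U (x b)) / homExp q * ‖x b‖ ^ homExp q ≤
        L * ‖x b‖ ^ homExp q + M₂ / √(2 * Vmin) / homExp q * fb := by
      calc √(2 * radialExt U (x b)) / homExp q * ‖x b‖ ^ homExp q
          ≤ (√(2 * Vmin) + M₂ / √(2 * Vmin) * ‖‖x b‖⁻¹ • x b - (ξp : Conf n)‖ ^ 2) / homExp q *
            ‖x b‖ ^ homExp q := by
            gcongr; exact s2
        _ = _ := by rw [hLdef, hfb, rayCost]; ring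
    have s3 := add_le_add s1' s2'
    refine le_trans ?_ (s3.trans (le_of_eq (by ring)))
    exact le_of_eq rfl
  have hq0 : ∀ s, 0 ≤ q.1 s := fun s => hVmin.le.trans (hWmin s)
  set I := ∫ t in a..b, lagr q x t with hI
  have hI0 : 0 ≤ I :=
    intervalIntegral.integral_nonneg hab.le fun u _ => lagr_nonneg hq0 (h.ne_zero u)
  have hIle : I ≤ (∫ t in a..b, lagr p x t) - ε * η := by
    have e := (h.isH1 hab.le).integral_lagr_shrink (p := p) hab.le (fun u _ => h.ne_zero u) Vmin ε
    have hx := mul_le_mul_of_nonneg_left (hex a b (by linarith) hb) hε0.le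
    rw [hI]
    change (∫ t in a..b, lagr (U.shrink Vmin ε, α) x t) ≤ _
    rw [e]
    linarith
  have j2 : JoinedAtCost q univ (x a) (x b) I :=
    JoinedAtCost.of_path hab.le (h.isH1 hab.le) (fun _ _ => mem_univ _) hI0
      ((h.isH1 hab.le).action_eq_integral hab.le (fun u _ => h.ne_zero u) hq0).le
  -- The connections cost `L(R^β - ‖x a‖^β)` and `L(R^β - ‖x b‖^β)` up to quadratic terms, so the
  -- whole path costs less than `2L R^β`; dilation by `R⁻¹` brings its ends back to the sphere.
  have j := ((j1.symm.trans j2).trans j3).smul (inv_pos.mpr hR0) (K' := univ) fun _ _ => mem_univ _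
  rw [smul_smul, smul_smul, inv_mul_cancel₀ hR0.ne', one_smul, one_smul] at j
  refine mem_regionOut_of_joined hξ (V := ⟨q, hWS⟩) j ?_
  change _ < 2 * L
  rw [Real.inv_rpow hR0.le, inv_mul_lt_iff₀ (Real.rpow_pos_of_pos hR0 _)]
  have hBν : B₁ * fa + B₂ * fb < ε * η := by
    have q1 : B₁ * fa ≤ B₁ * ν := by gcongr
    have q2 : B₂ * fb ≤ B₂ * ν := by gcongr
    have q3 : ν * (2 * (B₁ + B₂ + 1)) = ε * η := by rw [hν]; field_simp
    have q4 : 0 < ε * η := by positivity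
    nlinarith
  have hB1e : B₁ * fa = M₁ / √(2 * Vmin) / homExp q * fa + C₁ * fa := by rw [hB₁]; ring
  have hB2e : B₂ * fb = M₂ / √(2 * Vmin) / homExp q * fb + C₂ * fb := by rw [hB₂]; ring
  rw [mul_sub, mul_sub]
  linarith

end IsParabolicMorseMinimizer

/-! ### Weak limits and lower semicontinuity -/

/-- Along an ultrafilter all bounded scalar products converge at once, without extracting
subsequences; the limit functional is bounded and Riesz represents it. -/
theorem exists_weak_limit_of_bounded {H ι : Type*} [NormedAddCommGroup H] [InnerProductSpace ℝ H]
    [CompleteSpace H] (F : Ultrafilter ι) (f : ι → H) (C : ℝ) (hf : ∀ j, ‖f j‖ ≤ C) :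
    ∃ w : H, ∀ g : H, Tendsto (fun j => inner ℝ (f j) g) F (𝓝 (inner ℝ w g)) := by
  have hlim : ∀ g : H, ∃ l : ℝ, |l| ≤ C * ‖g‖ ∧ Tendsto (fun j => inner ℝ (f j) g) F (𝓝 l) := by
    intro g
    have hK : IsCompact (Metric.closedBall (0 : ℝ) (C * ‖g‖)) := isCompact_closedBall _ _
    have hle : ((F.map fun j => inner ℝ (f j) g : Ultrafilter ℝ) : Filter ℝ) ≤
        𝓟 (Metric.closedBall (0 : ℝ) (C * ‖g‖)) := by
      rw [le_principal_iff]
      refine Filter.mem_map.mpr (Filter.univ_mem' fun j => ?_)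
      simp only [mem_preimage, mem_closedBall_zero_iff]
      exact (norm_inner_le_norm _ _).trans (by gcongr; exact hf j)
    obtain ⟨l, hl, hlF⟩ := hK.ultrafilter_le_nhds _ hle
    exact ⟨l, by simpa using hl, hlF⟩
  choose l hl hlF using hlim
  let φ : H →ₗ[ℝ] ℝ :=
    { toFun := l
      map_add' := fun g g' => by
        have h1 := (hlF g).add (hlF g')
        refine tendsto_nhds_unique (hlF (g + g')) (h1.congr fun j => ?_)
        rw [inner_add_right]
      map_smul' := fun c g => by
        have h1 := (hlF g).const_mul c
        refine tendsto_nhds_unique (hlF (c • g)) (h1.congr fun j => ?_)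
        rw [inner_smul_right] }
  let Φ : StrongDual ℝ H := φ.mkContinuous C fun g => hl g
  refine ⟨(InnerProductSpace.toDual ℝ H).symm Φ, fun g => ?_⟩
  rw [InnerProductSpace.toDual_symm_apply]
  exact hlF g

theorem tendsto_potential {p : C2Sphere n × Ioo (0 : ℝ) 2} {ι : Type*} {F : Filter ι}
    {pj : ι → C2Sphere n × Ioo (0 : ℝ) 2} (hp : Tendsto pj F (𝓝 p)) {z : ι → Conf n} {w : Conf n}
    (hz : Tendsto z F (𝓝 w)) (hw : w ≠ 0) (hz0 : ∀ j, z j ≠ 0) :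
    Tendsto (fun j => potential (pj j) (z j)) F (𝓝 (potential p w)) := by
  have h1 : Tendsto (fun j => radialExt p.1 (z j)) F (𝓝 (radialExt p.1 w)) :=
    (radialExt_contDiffAt p.1 hw).continuousAt.tendsto.comp hz
  have h2 : Tendsto (fun j => dist (pj j).1 p.1) F (𝓝 0) :=
    tendsto_iff_dist_tendsto_zero.mp ((continuous_fst.tendsto p).comp hp)
  have h3 : Tendsto (fun j => radialExt (pj j).1 (z j) - radialExt p.1 (z j)) F (𝓝 0) := by
    refine squeeze_zero_norm (fun j => ?_) h2
    rw [radialExt_of_ne _ (hz0 j), radialExt_of_ne _ (hz0 j), Real.norm_eq_abs]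
    exact C2Sphere.abs_sub_le_dist _ _ _
  have h4 : Tendsto (fun j => radialExt (pj j).1 (z j)) F (𝓝 (radialExt p.1 w)) := by
    simpa using h3.add h1
  have h5 : Tendsto (fun j => ((pj j).2 : ℝ)) F (𝓝 (p.2 : ℝ)) :=
    ((continuous_subtype_val.comp continuous_snd).tendsto p).comp hp
  have h6 : Tendsto (fun j => ‖z j‖ ^ ((pj j).2 : ℝ)) F (𝓝 (‖w‖ ^ (p.2 : ℝ))) :=
    hz.norm.rpow h5 (Or.inl (norm_ne_zero_iff.mpr hw))
  have h7 := ENNReal.tendsto_ofReal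
    (h4.div h6 (Real.rpow_pos_of_pos (norm_pos_iff.mpr hw) _).ne')
  rw [potential_of_ne p hw]
  exact h7.congr fun j => (potential_of_ne _ (hz0 j)).symm

/-- Lower semicontinuity of the action under pointwise convergence of paths. -/
theorem action_le_of_tendsto {p : C2Sphere n × Ioo (0 : ℝ) 2}
    {pj : ℕ → C2Sphere n × Ioo (0 : ℝ) 2} (hp : Tendsto pj atTop (𝓝 p)) {a b : ℝ} (hab : a ≤ b)
    {y : ℕ → ℝ → Conf n} {x : ℝ → Conf n} (hy : ∀ j, IsH1 a b (y j))
    (hy0 : ∀ j, ∀ t ∈ Icc a b, y j t ≠ 0) (hx0 : ∀ t ∈ Icc a b, x t ≠ 0)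
    (hlim : ∀ t ∈ Icc a b, Tendsto (fun j => y j t) atTop (𝓝 (x t)))
    {Q : ℕ → ℝ} {Q₀ : ℝ} (hQ : Tendsto Q atTop (𝓝 Q₀)) (hQ0 : ∀ j, 0 ≤ Q j)
    (hact : ∀ j, action (pj j) a b (y j) ≤ ENNReal.ofReal (Q j)) :
    IsH1 a b x ∧ action p a b x ≤ ENNReal.ofReal Q₀ := by
  set μ := (volume : Measure ℝ).restrict (Icc a b) with hμ
  let f : ℕ → Lp (Conf n) 2 μ := fun j => (hy j).1.toLp (deriv (y j))
  have hfae : ∀ j, ∀ᵐ t ∂μ, f j t = deriv (y j) t := fun j => MemLp.coeFn_toLp _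
  have hnormsq : ∀ g : Lp (Conf n) 2 μ,
      ∫⁻ t, ENNReal.ofReal (‖g t‖ ^ 2 / 2) ∂μ = ENNReal.ofReal (‖g‖ ^ 2 / 2) := by
    intro g
    have hi : Integrable (fun t => ‖g t‖ ^ 2) μ :=
      (memLp_two_iff_integrable_sq_norm (Lp.memLp g).1).mp (Lp.memLp g)
    rw [← ofReal_integral_eq_lintegral_ofReal (hi.div_const 2) (ae_of_all _ fun t => by positivity),
      integral_div]
    congr 2
    rw [← real_inner_self_eq_norm_sq, L2.inner_def]
    exact integral_congr_ae (ae_of_all _ fun t => (real_inner_self_eq_norm_sq _).symm)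
  have hsplit : ∀ j, ENNReal.ofReal (‖f j‖ ^ 2 / 2) + ∫⁻ t, potential (pj j) (y j t) ∂μ ≤
      ENNReal.ofReal (Q j) := by
    intro j
    refine le_trans (le_of_eq ?_) (hact j)
    rw [← hnormsq, action, lintegral_add_left']
    · congr 1
      refine lintegral_congr_ae ((hfae j).mono fun t ht => ?_)
      simp only [ht]
    · exact ((hy j).1.1.norm.aemeasurable.pow_const 2).div_const 2 |>.ennreal_ofReal
  have hfQ : ∀ j, ‖f j‖ ^ 2 / 2 ≤ Q j := fun j =>
    (ENNReal.ofReal_le_ofReal_iff (hQ0 j)).mp (le_self_add.trans (hsplit j))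
  obtain ⟨B, hB⟩ := hQ.bddAbove_range
  have hfB : ∀ j, ‖f j‖ ∈ Icc 0 √(2 * B) := fun j => by
    refine ⟨norm_nonneg _, Real.le_sqrt_of_sq_le ?_⟩
    have := hB (mem_range_self j)
    linarith [hfQ j]
  -- Convergence of the velocity norms to `κ` lets the two energies be treated apart: `‖w‖ ≤ κ` for
  -- the kinetic part, Fatou with the remaining budget `Q₀ - κ²/2` for the potential part.
  obtain ⟨κ, -, φ, hφ, hκ⟩ := isCompact_Icc.tendsto_subseq hfB
  let F : Ultrafilter ℕ := Ultrafilter.of atTop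
  have hF : (F : Filter ℕ) ≤ atTop := Ultrafilter.of_le _
  obtain ⟨w, hw⟩ := exists_weak_limit_of_bounded F (fun j => f (φ j)) √(2 * B) fun j => (hfB _).2
  have hκF : Tendsto (fun j => ‖f (φ j)‖) F (𝓝 κ) := hκ.mono_left hF
  have hwκ : ‖w‖ ≤ κ := by
    have h1 : ‖w‖ ^ 2 ≤ κ * ‖w‖ := by
      rw [← real_inner_self_eq_norm_sq]
      exact le_of_tendsto_of_tendsto' (hw w) (hκF.mul_const ‖w‖) fun j => real_inner_le_norm _ _
    rcases (norm_nonneg w).eq_or_lt with h0 | h0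
    · rw [← h0]
      exact ge_of_tendsto' hκ fun j => norm_nonneg _
    · nlinarith
  have hvel : HasVel a b x w := by
    refine ⟨Lp.memLp w, fun t ht => ?_⟩
    have hms : MeasurableSet (Icc a t) := measurableSet_Icc
    have hfin : μ (Icc a t) ≠ ⊤ := by
      refine ne_top_of_le_ne_top ?_ (Measure.restrict_apply_le _ _)
      simp
    have hrestr : μ.restrict (Icc a t) = volume.restrict (Icc a t) := by
      rw [hμ, Measure.restrict_restrict hms, inter_eq_left.mpr (Icc_subset_Icc le_rfl ht.2)]
    have haa : a ∈ Icc a b := ⟨le_rfl, hab⟩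
    -- Testing the weak convergence against indicators of `[a, t]` identifies `w` as the velocity of
    -- the pointwise limit.
    have hgoal : x t - x a = ∫ s in Icc a t, w s ∂μ := by
      refine ext_inner_left ℝ fun c => ?_
      have h1 : Tendsto (fun j => inner ℝ c (y (φ j) t - y (φ j) a)) F
          (𝓝 (inner ℝ c (x t - x a))) := by
        have := ((hlim t ht).sub (hlim a haa)).comp hφ.tendsto_atTop
        exact (tendsto_const_nhds.inner this).mono_left hF
      have h2 := hw (indicatorConstLp 2 hms hfin c)
      rw [real_inner_comm, L2.inner_indicatorConstLp_eq_inner_setIntegral] at h2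
      refine tendsto_nhds_unique h1 (h2.congr fun j => ?_)
      rw [real_inner_comm, L2.inner_indicatorConstLp_eq_inner_setIntegral,
        (hy (φ j)).hasVel.sub_eq haa ht, intervalIntegral.integral_of_le ht.1,
        ← integral_Icc_eq_integral_Ioc, ← hrestr]
      congr 1
      exact integral_congr_ae (ae_restrict_of_ae (hfae (φ j)))
    rw [hrestr, integral_Icc_eq_integral_Ioc, ← intervalIntegral.integral_of_le ht.1] at hgoal
    rw [← hgoal]; abel
  refine ⟨hvel.isH1, ?_⟩
  have hpot : ∫⁻ t, potential p (x t) ∂μ ≤ ENNReal.ofReal (Q₀ - κ ^ 2 / 2) := by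
    have hpt : ∀ᵐ t ∂μ, potential p (x t) = liminf (fun j => potential (pj (φ j)) (y (φ j) t)) atTop := by
      filter_upwards [ae_restrict_mem measurableSet_Icc] with t ht
      exact (tendsto_potential (hp.comp hφ.tendsto_atTop)
        ((hlim t ht).comp hφ.tendsto_atTop) (hx0 t ht) fun j => hy0 _ t ht).liminf_eq.symm
    have hmeas : ∀ j, AEMeasurable (fun t => potential (pj (φ j)) (y (φ j) t)) μ := by
      intro j
      have hc := (hy (φ j)).hasVel.continuousOn.radialExt_div (hy0 (φ j)) (pj (φ j)).1 (pj (φ j)).2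
      refine (hc.aemeasurable measurableSet_Icc).ennreal_ofReal.congr ?_
      filter_upwards [ae_restrict_mem measurableSet_Icc] with t ht
      exact (potential_of_ne _ (hy0 _ t ht)).symm
    rw [lintegral_congr_ae hpt]
    refine (lintegral_liminf_le' hmeas).trans ?_
    have hle : ∀ j, ∫⁻ t, potential (pj (φ j)) (y (φ j) t) ∂μ ≤
        ENNReal.ofReal (Q (φ j) - ‖f (φ j)‖ ^ 2 / 2) := by
      intro j
      rw [ENNReal.ofReal_sub _ (by positivity)]
      exact ENNReal.le_sub_of_add_le_left ENNReal.ofReal_ne_top (hsplit _)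
    have htend : Tendsto (fun j => ENNReal.ofReal (Q (φ j) - ‖f (φ j)‖ ^ 2 / 2)) atTop
        (𝓝 (ENNReal.ofReal (Q₀ - κ ^ 2 / 2))) :=
      ENNReal.tendsto_ofReal ((hQ.comp hφ.tendsto_atTop).sub ((hκ.pow 2).div_const 2))
    exact (liminf_le_liminf (Eventually.of_forall hle)).trans htend.liminf_eq.le
  have hκQ : κ ^ 2 / 2 ≤ Q₀ :=
    le_of_tendsto_of_tendsto' ((hκ.pow 2).div_const 2) (hQ.comp hφ.tendsto_atTop) fun j => hfQ _
  rw [hvel.action_eq, lintegral_add_left', hnormsq]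
  · calc ENNReal.ofReal (‖w‖ ^ 2 / 2) + ∫⁻ t, potential p (x t) ∂μ
        ≤ ENNReal.ofReal (κ ^ 2 / 2) + ENNReal.ofReal (Q₀ - κ ^ 2 / 2) := by
          gcongr
      _ = ENNReal.ofReal Q₀ := by
          rw [← ENNReal.ofReal_add (by positivity) (by linarith)]
          congr 1; ring
  · exact ((Lp.memLp w).1.norm.aemeasurable.pow_const 2).div_const 2 |>.ennreal_ofReal

/-! ### Construction of nearly minimal paths -/

/-- A path from `R ξm` to `R ξp` on `[-τ, σ]`, closest to the origin at time `0` where it has norm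
`1`, all of whose arcs have least action up to an error `ε`. -/
structure IsNearMinimizer (ξm ξp : USphere n) (m : ℝ) (p : C2Sphere n × Ioo (0 : ℝ) 2)
    (ε R τ σ : ℝ) (y : ℝ → Conf n) : Prop where
  left_nonneg : 0 ≤ τ
  right_nonneg : 0 ≤ σ
  radius_pos : 0 < R
  isH1 : IsH1 (-τ) σ y
  norm_zero : ‖y 0‖ = 1
  one_le_norm : ∀ t ∈ Icc (-τ) σ, 1 ≤ ‖y t‖
  left_end : y (-τ) = R • (ξm : Conf n)
  right_end : y σ = R • (ξp : Conf n)
  action_le : action p (-τ) σ y ≤ ENNReal.ofReal (2 * rayCost m p * R ^ homExp p)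
  near_minimal : ∀ a b, -τ ≤ a → a ≤ b → b ≤ σ → ∀ C, JoinedAtCost p univ (y a) (y b) C →
    action p a b y ≤ ENNReal.ofReal (C + ε)

section Approx

variable {ξm ξp : USphere n} {Vmin : ℝ}

/-- A path joining the unit sphere to itself splits at its point closest to the origin. -/
theorem JoinedAtCost.split_at_min {p : C2Sphere n × Ioo (0 : ℝ) 2} {m : ℝ} (hm : 0 < m)
    (hp : ∀ s, m ≤ p.1 s) {C : ℝ} (h : JoinedAtCost p univ (ξm : Conf n) ξp C) :
    ∃ (u : Conf n) (C₁ C₂ : ℝ), ‖u‖ ≤ 1 ∧ C₁ + C₂ ≤ C ∧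
      2 * rayCost m p * (1 - ‖u‖ ^ homExp p) ≤ C ∧
      JoinedAtCost p {z | ‖u‖ ≤ ‖z‖} ξm u C₁ ∧ JoinedAtCost p {z | ‖u‖ ≤ ‖z‖} u ξp C₂ := by
  obtain ⟨hC, b, x, hb, hx, h0, h1, -, hact⟩ := h
  have hβ := homExp_pos p
  have hn0 : ‖x 0‖ = 1 := by rw [h0]; exact norm_eq_of_mem_sphere ξm
  have hnb : ‖x b‖ = 1 := by rw [h1]; exact norm_eq_of_mem_sphere ξp
  obtain ⟨t, ht, hmin⟩ := isCompact_Icc.exists_isMinOn (nonempty_Icc.mpr hb)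
    hx.hasVel.continuousOn.norm
  have hmin' : ∀ s ∈ Icc 0 b, ‖x t‖ ≤ ‖x s‖ := fun s hs => hmin hs
  have hle : ‖x t‖ ≤ 1 := hn0 ▸ hmin' 0 ⟨le_rfl, hb⟩
  have hx1 := (hx.hasVel.mono le_rfl ht.2).isH1
  have hx2 := (hx.hasVel.mono ht.1 le_rfl).isH1
  have hsum := action_add p x ht.1 ht.2
  have hfin : action p 0 b x ≠ ⊤ := ne_top_of_le_ne_top ENNReal.ofReal_ne_top hact
  have f1 : action p 0 t x ≠ ⊤ := ne_top_of_le_ne_top hfin (hsum ▸ le_self_add)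
  have f2 : action p t b x ≠ ⊤ := ne_top_of_le_ne_top hfin (hsum ▸ le_add_self)
  refine ⟨x t, (action p 0 t x).toReal, (action p t b x).toReal, hle, ?_, ?_, ?_, ?_⟩
  · rw [← ENNReal.toReal_add f1 f2, ← hsum]
    exact ENNReal.toReal_le_of_le_ofReal hC hact
  · have a1 := hx1.ofReal_radial_le_action (p := p) hm hp ht.1
    have a2 := hx2.ofReal_radial_le_action (p := p) hm hp ht.2
    have a3 := add_le_add a1 a2
    rw [← hsum, ← ENNReal.ofReal_add (by positivity) (by positivity), hn0, hnb, Real.one_rpow,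
      abs_sub_comm] at a3
    have a4 := (ENNReal.ofReal_le_ofReal_iff hC).mp (a3.trans hact)
    change rayCost m p * _ + rayCost m p * _ ≤ C at a4
    have a5 := mul_le_mul_of_nonneg_left (le_abs_self (1 - ‖x t‖ ^ homExp p)) (rayCost_pos hm p).le
    linarith
  · rw [← h0]
    exact JoinedAtCost.of_path ht.1 hx1 (fun s hs => hmin' s ⟨hs.1, hs.2.trans ht.2⟩)
      ENNReal.toReal_nonneg (ENNReal.ofReal_toReal f1).ge
  · rw [← h1]
    exact JoinedAtCost.of_path ht.2 hx2 (fun s hs => hmin' s ⟨ht.1.trans hs.1, hs.2⟩)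
      ENNReal.toReal_nonneg (ENNReal.ofReal_toReal f2).ge

/-- Near a potential of the common boundary there are potentials with nearly minimal arcs that join
distant points of the two minimal rays and keep at distance `1` from the origin. -/
theorem exists_far_joined (hξ : ξp ≠ ξm) (hVmin : 0 < Vmin) {V : classP ξm ξp Vmin}
    (hV : V ∉ regionOut ξm ξp Vmin) (hcl : V ∈ closure (regionOut ξm ξp Vmin))
    {S : Set (classP ξm ξp Vmin)} (hS : S ∈ 𝓝 V) {ε j : ℝ} (hε : 0 < ε) (hj : 1 ≤ j) :
    ∃ V' ∈ S, ∃ (R : ℝ) (w : Conf n) (C₁ C₂ : ℝ), j ≤ R ∧ ‖w‖ = 1 ∧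
      JoinedAtCost V'.1 {z | 1 ≤ ‖z‖} (R • (ξm : Conf n)) w C₁ ∧
      JoinedAtCost V'.1 {z | 1 ≤ ‖z‖} w (R • (ξp : Conf n)) C₂ ∧
      C₁ + C₂ ≤ 2 * rayCost Vmin V'.1 * R ^ homExp V'.1 ∧
      ∀ C, JoinedAtCost V'.1 univ (R • (ξm : Conf n)) (R • (ξp : Conf n)) C → C₁ + C₂ ≤ C + ε := by
  set L₀ := rayCost Vmin V.1 + 1 with hL₀
  have hL₀0 : 0 < L₀ := by have := rayCost_pos hVmin V.1; positivity
  -- Chosen so that prolonging the path by a factor at most `j` wastes at most `ε/2` after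
  -- rescaling.
  set η := min (1 / 2) (ε / (4 * L₀ * j ^ 2)) with hη
  have hj0 : 0 < j := by linarith
  have hη0 : 0 < η := by positivity
  have hη1 : η < 1 := (min_le_left _ _).trans_lt (by norm_num)
  have hηε : 2 * L₀ * η * j ^ 2 ≤ ε / 2 := by
    have : η ≤ ε / (4 * L₀ * j ^ 2) := min_le_right _ _
    rw [le_div_iff₀ (by positivity)] at this
    linarith
  have hLev : ∀ᶠ V' : classP ξm ξp Vmin in 𝓝 V, rayCost Vmin V'.1 < L₀ :=
    (((continuous_rayCost Vmin).comp continuous_subtype_val).tendsto V).eventually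
      (gt_mem_nhds (by change rayCost Vmin V.1 < L₀; linarith))
  obtain ⟨V', ⟨⟨hV'S, hLL⟩, hlow⟩, hout⟩ := mem_closure_iff_nhds.mp hcl _
    (inter_mem (inter_mem hS hLev) (eventually_le_of_joined hξ hVmin hV hη0 hη1))
  change rayCost Vmin V'.1 < L₀ at hLL
  change ∀ (K : Set (Conf n)) (C : ℝ), JoinedAtCost V'.1 K ξm ξp C →
      2 * rayCost Vmin V'.1 * (1 - η) ≤ C at hlow
  refine ⟨V', hV'S, ?_⟩
  set p := V'.1 with hp
  have hβ := homExp_pos p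
  have hβ1 := homExp_lt_one p
  set L := rayCost Vmin p with hL
  have hL0 : 0 < L := rayCost_pos hVmin p
  set S' : Set ℝ := {C | JoinedAtCost p univ (ξm : Conf n) ξp C} with hS'
  have hbdd : BddBelow S' := ⟨0, fun C hC => hC.1⟩
  obtain ⟨C₀, hC₀, hJ₀⟩ := exists_joined_of_mem_regionOut hout
  set c := sInf S' with hc
  have hc1 : c < 2 * L := (csInf_le hbdd hJ₀).trans_lt hC₀
  have hc2 : 2 * L * (1 - η) ≤ c := le_csInf ⟨C₀, hJ₀⟩ fun C hC => hlow _ _ hC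
  have hc3 : ∀ C, JoinedAtCost p univ (ξm : Conf n) ξp C → c ≤ C := fun C hC => csInf_le hbdd hC
  set q := (2 * L - c) / 2 / (2 * L) with hq
  have hq0 : 0 < q := by
    have : 0 < 2 * L - c := by linarith
    positivity
  obtain ⟨C, hC, hCc⟩ := exists_lt_of_csInf_lt ⟨C₀, hJ₀⟩
    (show c < min (c + q * (ε / 2)) ((c + 2 * L) / 2) from
      lt_min (by linarith [mul_pos hq0 (half_pos hε)]) (by linarith))
  obtain ⟨u, C₁, C₂, hu1, hC12, hrad, J1, J2⟩ := JoinedAtCost.split_at_min hVmin (classP_min V') hC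
  set ρ := ‖u‖ with hρ
  have hCm : C < (c + 2 * L) / 2 := hCc.trans_le (min_le_right _ _)
  have hCε : C < c + q * (ε / 2) := hCc.trans_le (min_le_left _ _)
  have hqρ : q ≤ ρ ^ homExp p := by
    rw [hq, div_le_iff₀ (by positivity)]
    change 2 * L * (1 - ρ ^ homExp p) ≤ C at hrad
    linarith
  have hρ0 : 0 < ρ := by
    rcases (norm_nonneg u).eq_or_lt with h | h
    · rw [hρ, ← h, Real.zero_rpow hβ.ne'] at hqρ
      linarith
    · exact h
  -- If `ρ ≤ 1/j`, dilation alone reaches radius `j`. Otherwise the path is prolonged by the factor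
  -- `j`; the excess over the optimal cost `c j^β` is `(2L - c)(j^β - 1)`, small because `2L - c ≤
  -- 2Lη`.
  obtain ⟨Λ, hΛ1, hΛR, hΛε⟩ : ∃ Λ : ℝ, 1 ≤ Λ ∧ j ≤ Λ / ρ ∧
      (2 * L - c) * (Λ ^ homExp p - 1) ≤ ρ ^ homExp p * (ε / 2) := by
    rcases le_total j (1 / ρ) with h | h
    · refine ⟨1, le_rfl, h, ?_⟩
      rw [Real.one_rpow, sub_self, mul_zero]; positivity
    · refine ⟨j, hj, ?_, ?_⟩
      · rw [le_div_iff₀ hρ0]; nlinarith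
      · have h1 : j ^ homExp p ≤ j := by
          simpa using Real.rpow_le_rpow_of_exponent_le hj hβ1.le
        have h2 : 1 ≤ ρ * j := by rwa [div_le_iff₀ hρ0, mul_comm] at h
        have h3 : ρ ≤ ρ ^ homExp p := by
          simpa using Real.rpow_le_rpow_of_exponent_ge hρ0 hu1 hβ1.le
        have h4 : 1 ≤ ρ ^ homExp p * j := h2.trans (by gcongr)
        have h5 : (2 * L - c) * (j ^ homExp p - 1) ≤ 2 * L₀ * η * j := by
          have a1 : 2 * L - c ≤ 2 * L₀ * η := by
            have : L * η ≤ L₀ * η := by gcongr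
            linarith
          have a2 : 0 ≤ j ^ homExp p - 1 := by linarith [Real.one_le_rpow hj hβ.le]
          calc (2 * L - c) * (j ^ homExp p - 1) ≤ 2 * L₀ * η * (j ^ homExp p - 1) := by gcongr
            _ ≤ _ := by gcongr; linarith
        calc (2 * L - c) * (j ^ homExp p - 1) ≤ 2 * L₀ * η * j * 1 := by linarith
          _ ≤ 2 * L₀ * η * j * (ρ ^ homExp p * j) := by gcongr
          _ = ρ ^ homExp p * (2 * L₀ * η * j ^ 2) := by ring
          _ ≤ _ := by gcongr
  have hpm : p.1 ξm = Vmin := classP_left V'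
  have hpp : p.1 ξp = Vmin := classP_right V'
  have hΛ0 : 0 < Λ := by linarith
  have Rm := (JoinedAtCost.radial (p := p) ξm (by rw [hpm]; exact hVmin) zero_le_one hΛ1).symm.mono
    (K' := {z | ρ ≤ ‖z‖}) (fun z hz => hu1.trans hz) le_rfl
  have Rp := (JoinedAtCost.radial (p := p) ξp (by rw [hpp]; exact hVmin) zero_le_one hΛ1).mono
    (K' := {z | ρ ≤ ‖z‖}) (fun z hz => hu1.trans hz) le_rfl
  rw [hpm, one_smul, Real.one_rpow] at Rm
  rw [hpp, one_smul, Real.one_rpow] at Rp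
  change JoinedAtCost p _ _ _ (L * (Λ ^ homExp p - 1)) at Rm
  change JoinedAtCost p _ _ _ (L * (Λ ^ homExp p - 1)) at Rp
  have hK : ∀ z ∈ {z : Conf n | ρ ≤ ‖z‖}, ρ⁻¹ • z ∈ {z : Conf n | 1 ≤ ‖z‖} := by
    intro z hz
    have hz' : ρ ≤ ‖z‖ := hz
    simp only [mem_ofPred_eq, norm_smul, norm_inv, Real.norm_of_nonneg hρ0.le]
    rwa [← div_eq_inv_mul, le_div_iff₀ hρ0, one_mul]
  have T1 := (Rm.trans J1).smul (inv_pos.mpr hρ0) hK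
  have T2 := (J2.trans Rp).smul (inv_pos.mpr hρ0) hK
  have hR : Λ / ρ = ρ⁻¹ * Λ := div_eq_inv_mul _ _
  rw [smul_smul, ← hR] at T1 T2
  have hρβ : 0 < ρ ^ homExp p := Real.rpow_pos_of_pos hρ0 _
  have hρi : ρ⁻¹ ^ homExp p = (ρ ^ homExp p)⁻¹ := Real.inv_rpow hρ0.le _
  have hRβ : (Λ / ρ) ^ homExp p = (ρ ^ homExp p)⁻¹ * Λ ^ homExp p := by
    rw [hR, Real.mul_rpow (by positivity) hΛ0.le, hρi]
  rw [hρi] at T1 T2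
  refine ⟨Λ / ρ, ρ⁻¹ • u, _, _, hΛR, ?_, T1, T2, ?_, ?_⟩
  · rw [norm_smul, norm_inv, Real.norm_of_nonneg hρ0.le, ← hρ, inv_mul_cancel₀ hρ0.ne']
  · rw [hRβ, ← mul_add, mul_left_comm]
    gcongr
    linarith
  · intro D hD
    have hR0 : 0 < Λ / ρ := by positivity
    have hD' := hD.smul (inv_pos.mpr hR0) (K' := univ) fun _ _ => mem_univ _
    rw [smul_smul, smul_smul, inv_mul_cancel₀ hR0.ne', one_smul, one_smul,
      Real.inv_rpow hR0.le] at hD'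
    have hcD := hc3 _ hD'
    have hRβ0 : 0 < (Λ / ρ) ^ homExp p := Real.rpow_pos_of_pos hR0 _
    rw [← div_eq_inv_mul, le_div_iff₀ hRβ0, hRβ] at hcD
    have e : (ρ ^ homExp p)⁻¹ * (L * (Λ ^ homExp p - 1) + C₁) +
        (ρ ^ homExp p)⁻¹ * (C₂ + L * (Λ ^ homExp p - 1)) =
        (ρ ^ homExp p)⁻¹ * (2 * L * (Λ ^ homExp p - 1) + (C₁ + C₂)) := by ring
    have hfin : 2 * L * (Λ ^ homExp p - 1) + (C₁ + C₂) ≤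
        c * Λ ^ homExp p + ρ ^ homExp p * ε := by
      have : q * (ε / 2) ≤ ρ ^ homExp p * (ε / 2) := by gcongr
      linarith
    rw [e]
    calc (ρ ^ homExp p)⁻¹ * (2 * L * (Λ ^ homExp p - 1) + (C₁ + C₂))
        ≤ (ρ ^ homExp p)⁻¹ * (c * Λ ^ homExp p + ρ ^ homExp p * ε) := by gcongr
      _ = c * ((ρ ^ homExp p)⁻¹ * Λ ^ homExp p) + ε := by field_simp
      _ ≤ D + ε := by linarith

/-- A concatenation of two arcs that is nearly minimal as a whole has nearly minimal arcs. -/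
theorem exists_isNearMinimizer_of_joined {p : C2Sphere n × Ioo (0 : ℝ) 2} {m R ε C₁ C₂ : ℝ}
    {w : Conf n} (hR : 0 < R) (hw : ‖w‖ = 1)
    (h₁ : JoinedAtCost p {z | 1 ≤ ‖z‖} (R • (ξm : Conf n)) w C₁)
    (h₂ : JoinedAtCost p {z | 1 ≤ ‖z‖} w (R • (ξp : Conf n)) C₂)
    (hle : C₁ + C₂ ≤ 2 * rayCost m p * R ^ homExp p)
    (hmin : ∀ C, JoinedAtCost p univ (R • (ξm : Conf n)) (R • (ξp : Conf n)) C →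
      C₁ + C₂ ≤ C + ε) :
    ∃ τ σ y, IsNearMinimizer ξm ξp m p ε R τ σ y := by
  obtain ⟨hC₁, τ, x₁, hτ, hx₁, h10, h11, hK₁, hA₁⟩ := h₁
  obtain ⟨hC₂, σ, x₂, hσ, hx₂, h20, h21, hK₂, hA₂⟩ := h₂
  have himg : (fun t => (1 : ℝ) * t + τ) '' Icc (-τ) 0 = Icc 0 τ := by simp
  have hact := action_affine p (l := 1) (κ := 1) (d := τ) one_pos (by simp) hx₁
    (by linarith : -τ ≤ 0) himg
  have hv := hx₁.hasVel.affine 1 one_ne_zero τ (a' := -τ) (b' := 0) (by linarith)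
    (fun t ht => by rw [← himg]; exact ⟨t, ht, rfl⟩)
  simp only [Real.one_rpow, ENNReal.ofReal_one, one_mul, one_smul] at hact hv
  have hg := hv.piecewise hx₂.hasVel (by linarith) hσ (by simp [h11, h20])
  set y : ℝ → Conf n := fun t => if t ≤ 0 then x₁ (t + τ) else x₂ t with hy
  have e1 : action p (-τ) 0 y = action p 0 τ x₁ := by
    rw [← hact]; exact action_congr p fun t ht => if_pos ht.2
  have hy2 : ∀ t ∈ Icc 0 σ, y t = x₂ t := by
    intro t ht
    rcases ht.1.eq_or_lt with h | h
    · simp [hy, ← h, h11, h20]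
    · exact if_neg (not_le.mpr h)
  have e2 : action p 0 σ y = action p 0 σ x₂ := action_congr p hy2
  have hyl : y (-τ) = R • (ξm : Conf n) := by simp [hy, hτ, h10]
  have hyr : y σ = R • (ξp : Conf n) := by rw [hy2 σ ⟨hσ, le_rfl⟩, h21]
  have htot : action p (-τ) σ y ≤ ENNReal.ofReal (C₁ + C₂) := by
    rw [action_add p y (by linarith : -τ ≤ 0) hσ, e1, e2, ENNReal.ofReal_add hC₁ hC₂]
    exact add_le_add hA₁ hA₂
  refine ⟨τ, σ, y, hτ, hσ, hR, hg.isH1, ?_, ?_, hyl, hyr,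
    htot.trans (ENNReal.ofReal_le_ofReal hle), ?_⟩
  · simp [hy, h11, hw]
  · intro t ht
    rcases le_or_gt t 0 with h | h
    · have : y t = x₁ (t + τ) := if_pos h
      rw [this]; exact hK₁ _ ⟨by linarith [ht.1], by linarith⟩
    · rw [hy2 t ⟨h.le, ht.2⟩]; exact hK₂ _ ⟨h.le, ht.2⟩
  · intro a b ha hab hb C hC
    have hfin : action p (-τ) σ y ≠ ⊤ := ne_top_of_le_ne_top ENNReal.ofReal_ne_top htot
    have hs : action p (-τ) σ y = action p (-τ) a y + (action p a b y + action p b σ y) := by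
      rw [action_add p y ha (hab.trans hb), action_add p y hab hb]
    have f1 : action p (-τ) a y ≠ ⊤ := ne_top_of_le_ne_top hfin (hs ▸ le_self_add)
    have f23 : action p a b y + action p b σ y ≠ ⊤ :=
      ne_top_of_le_ne_top hfin (hs ▸ le_add_self)
    have f2 : action p a b y ≠ ⊤ := ne_top_of_le_ne_top f23 le_self_add
    have f3 : action p b σ y ≠ ⊤ := ne_top_of_le_ne_top f23 le_add_self
    have J1 : JoinedAtCost p univ (y (-τ)) (y a) (action p (-τ) a y).toReal :=
      JoinedAtCost.of_path ha (hg.mono le_rfl (hab.trans hb)).isH1 (fun _ _ => mem_univ _)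
        ENNReal.toReal_nonneg (ENNReal.ofReal_toReal f1).ge
    have J3 : JoinedAtCost p univ (y b) (y σ) (action p b σ y).toReal :=
      JoinedAtCost.of_path hb (hg.mono (ha.trans hab) le_rfl).isH1 (fun _ _ => mem_univ _)
        ENNReal.toReal_nonneg (ENNReal.ofReal_toReal f3).ge
    -- Replacing the arc yields a competitor for the whole path; the outer arcs contribute equally
    -- to both and cancel.
    have J := (J1.trans hC).trans J3
    rw [hyl, hyr] at J
    have h1 := hmin _ J
    have h2 : (action p (-τ) σ y).toReal ≤ C₁ + C₂ :=
      ENNReal.toReal_le_of_le_ofReal (add_nonneg hC₁ hC₂) htot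
    rw [hs, ENNReal.toReal_add f1 f23, ENNReal.toReal_add f2 f3] at h2
    rw [← ENNReal.ofReal_toReal f2]
    exact ENNReal.ofReal_le_ofReal (by linarith)

theorem exists_isNearMinimizer_seq (hξ : ξp ≠ ξm) (hVmin : 0 < Vmin) {V : classP ξm ξp Vmin}
    (hV : V ∉ regionOut ξm ξp Vmin) (hcl : V ∈ closure (regionOut ξm ξp Vmin)) :
    ∃ (W : ℕ → classP ξm ξp Vmin) (R τ σ : ℕ → ℝ) (y : ℕ → ℝ → Conf n),
      Tendsto W atTop (𝓝 V) ∧ (∀ j : ℕ, (j : ℝ) ≤ R j) ∧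
      ∀ j : ℕ, IsNearMinimizer ξm ξp Vmin (W j).1 (1 / ((j : ℝ) + 1)) (R j) (τ j) (σ j) (y j) := by
  have h : ∀ j : ℕ, ∃ (V' : classP ξm ξp Vmin) (R τ σ : ℝ) (y : ℝ → Conf n),
      dist V' V < 1 / ((j : ℝ) + 1) ∧ (j : ℝ) ≤ R ∧
      IsNearMinimizer ξm ξp Vmin V'.1 (1 / ((j : ℝ) + 1)) R τ σ y := by
    intro j
    obtain ⟨V', hV', R, w, C₁, C₂, hR, hw, h1, h2, h3, h4⟩ := exists_far_joined hξ hVmin hV hcl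
      (Metric.ball_mem_nhds V (Nat.one_div_pos_of_nat (α := ℝ) (n := j)))
      (Nat.one_div_pos_of_nat (α := ℝ) (n := j)) (by simp : (1 : ℝ) ≤ (j : ℝ) + 1)
    obtain ⟨τ, σ, y, hy⟩ := exists_isNearMinimizer_of_joined
      (by have : (0 : ℝ) ≤ j := j.cast_nonneg
          linarith) hw h1 h2 h3 h4
    exact ⟨V', R, τ, σ, y, hV', by linarith, hy⟩
  choose W R τ σ y hW hR hy using h
  refine ⟨W, R, τ, σ, y, ?_, hR, hy⟩
  rw [tendsto_iff_dist_tendsto_zero]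
  exact squeeze_zero (fun _ => dist_nonneg) (fun j => (hW j).le) tendsto_one_div_add_atTop_nhds_zero_nat

end Approx

/-! ### Uniform estimates for nearly minimal paths -/

theorem action_reverse (p : C2Sphere n × Ioo (0 : ℝ) 2) {a b : ℝ} {x : ℝ → Conf n} (hab : a ≤ b)
    (hx : IsH1 a b x) :
    IsH1 (-b) (-a) (fun t => x (-t)) ∧
      action p (-b) (-a) (fun t => x (-t)) = action p a b x := by
  have himg : (fun t => (-1 : ℝ) * t + 0) '' Icc (-b) (-a) = Icc a b := by
    simp
  have hact := action_affine p (l := 1) (κ := -1) (d := 0) one_pos (by simp) hx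
    (neg_le_neg hab) himg
  have hv := hx.hasVel.affine 1 (neg_ne_zero.mpr one_ne_zero) 0 (a' := -b) (b' := -a)
    (neg_le_neg hab) (fun t ht => by rw [← himg]; exact ⟨t, ht, rfl⟩)
  simp only [Real.one_rpow, ENNReal.ofReal_one, one_mul, one_smul, neg_mul, add_zero] at hact hv
  exact ⟨hv.isH1, hact⟩

namespace IsNearMinimizer

variable {ξm ξp : USphere n} {m ε R τ σ N β : ℝ} {p : C2Sphere n × Ioo (0 : ℝ) 2} {y : ℝ → Conf n}

theorem reverse (h : IsNearMinimizer ξm ξp m p ε R τ σ y) :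
    IsNearMinimizer ξp ξm m p ε R σ τ (fun t => y (-t)) := by
  have hτσ : -τ ≤ σ := by linarith [h.left_nonneg, h.right_nonneg]
  have h0 := action_reverse p hτσ h.isH1
  rw [neg_neg] at h0
  refine ⟨h.right_nonneg, h.left_nonneg, h.radius_pos, h0.1, by simp [h.norm_zero], ?_,
    by simp [h.right_end], h.left_end, h0.2.trans_le h.action_le, ?_⟩
  · exact fun t ht => h.one_le_norm _ ⟨by linarith [ht.2], by linarith [ht.1]⟩
  · intro a b ha hab hb C hC
    have h1 := h.near_minimal (-b) (-a) (by linarith) (by linarith) (by linarith) C hC.symm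
    have h2 := (action_reverse p (neg_le_neg hab)
      (h.isH1.hasVel.mono (by linarith : -τ ≤ -b) (by linarith : -a ≤ σ)).isH1).2
    rw [neg_neg, neg_neg] at h2
    rw [h2]; exact h1

theorem ne_zero (h : IsNearMinimizer ξm ξp m p ε R τ σ y) {t : ℝ} (ht : t ∈ Icc (-τ) σ) :
    y t ≠ 0 :=
  norm_pos_iff.mp (zero_lt_one.trans_le (h.one_le_norm t ht))

/-- Comparison with the path through the origin. The constants `N` and `β` are to be common to all
potentials near a given one. -/
theorem norm_sub_sq_le (h : IsNearMinimizer ξm ξp m p ε R τ σ y) (hε : 0 ≤ ε) (hε1 : ε ≤ 1)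
    (hpos : ∀ s, 0 < p.1 s) (hN : ∀ s, p.1 s ≤ N) (hβ0 : 0 < β) (hβ : β ≤ homExp p) {a b : ℝ}
    (ha : -τ ≤ a) (hab : a ≤ b) (hb : b ≤ σ) :
    ‖y b - y a‖ ^ 2 ≤ 2 * (b - a) * (√(2 * N) / β * (‖y a‖ + ‖y b‖) + 1) := by
  have hma : a ∈ Icc (-τ) σ := ⟨ha, hab.trans hb⟩
  have hmb : b ∈ Icc (-τ) σ := ⟨ha.trans hab, hb⟩
  have hJ := JoinedAtCost.through_zero_of_le (h.ne_zero hma) (h.ne_zero hmb) hpos hN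
  have hpow : ∀ t ∈ Icc (-τ) σ, ‖y t‖ ^ homExp p ≤ ‖y t‖ := fun t ht => by
    simpa using Real.rpow_le_rpow_of_exponent_le (h.one_le_norm t ht) (homExp_lt_one p).le
  have h1 := (h.isH1.hasVel.mono ha hb).isH1.norm_sub_sq_le (p := p) hab
    (add_nonneg hJ.1 hε) (h.near_minimal a b ha hab hb _ hJ)
  refine h1.trans ?_
  have h2 := hpow a hma
  have h3 := hpow b hmb
  have : 0 ≤ b - a := by linarith
  gcongr

/-- For `u = ‖y t‖ - 1 > 1` the previous estimate reads `u² ≤ 2 (3A + 1) t u`, so the growth is at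
most linear. -/
theorem norm_le_of_nonneg (h : IsNearMinimizer ξm ξp m p ε R τ σ y) (hε : 0 ≤ ε) (hε1 : ε ≤ 1)
    (hpos : ∀ s, 0 < p.1 s) (hN : ∀ s, p.1 s ≤ N) (hβ0 : 0 < β) (hβ : β ≤ homExp p) {t : ℝ}
    (ht0 : 0 ≤ t) (ht : t ≤ σ) : ‖y t‖ ≤ 2 + 2 * (3 * (√(2 * N) / β) + 1) * t := by
  have h1 := h.norm_sub_sq_le hε hε1 hpos hN hβ0 hβ (neg_nonpos.mpr h.left_nonneg) ht0 ht
  rw [h.norm_zero, sub_zero] at h1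
  set A := √(2 * N) / β with hA
  have hA0 : 0 ≤ A := by positivity
  have h2 : ‖y t‖ - 1 ≤ ‖y t - y 0‖ := by
    have := norm_sub_norm_le (y t) (y 0)
    rwa [h.norm_zero] at this
  have h3 : 1 ≤ ‖y t‖ := h.one_le_norm t ⟨by linarith [h.left_nonneg], ht⟩
  by_contra hcon
  push Not at hcon
  have hD : 0 ≤ 2 * (3 * A + 1) * t := by positivity
  set u := ‖y t‖ - 1 with hu
  have hu1 : 1 < u := by linarith
  have h4 : u ^ 2 ≤ ‖y t - y 0‖ ^ 2 := by gcongr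
  have h5 : 2 * t * (A * (1 + ‖y t‖) + 1) ≤ 2 * t * ((3 * A + 1) * u) := by
    gcongr
    have : ‖y t‖ = u + 1 := by linarith
    rw [this]
    nlinarith
  nlinarith

theorem norm_le (h : IsNearMinimizer ξm ξp m p ε R τ σ y) (hε : 0 ≤ ε) (hε1 : ε ≤ 1)
    (hpos : ∀ s, 0 < p.1 s) (hN : ∀ s, p.1 s ≤ N) (hβ0 : 0 < β) (hβ : β ≤ homExp p) {t : ℝ}
    (ht : t ∈ Icc (-τ) σ) : ‖y t‖ ≤ 2 + 2 * (3 * (√(2 * N) / β) + 1) * |t| := by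
  rcases le_total 0 t with h0 | h0
  · rw [abs_of_nonneg h0]
    exact h.norm_le_of_nonneg hε hε1 hpos hN hβ0 hβ h0 ht.2
  · rw [abs_of_nonpos h0]
    have := h.reverse.norm_le_of_nonneg hε hε1 hpos hN hβ0 hβ (t := -t) (by linarith)
      (by linarith [ht.1])
    simpa using this

/-- Read backwards: a large end radius forces a long duration, so the domains exhaust the line. -/
theorem radius_le (h : IsNearMinimizer ξm ξp m p ε R τ σ y) (hε : 0 ≤ ε) (hε1 : ε ≤ 1)
    (hpos : ∀ s, 0 < p.1 s) (hN : ∀ s, p.1 s ≤ N) (hβ0 : 0 < β) (hβ : β ≤ homExp p) :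
    R ≤ 2 + 2 * (3 * (√(2 * N) / β) + 1) * σ := by
  have := h.norm_le_of_nonneg hε hε1 hpos hN hβ0 hβ h.right_nonneg le_rfl
  rwa [h.right_end, norm_smul, norm_eq_of_mem_sphere, mul_one, Real.norm_of_nonneg h.radius_pos.le]
    at this

/-- The direction of a nearly minimal path at distance `r` from the origin differs from its final
direction by an amount controlled by a negative power of `r`. -/
theorem angle_le (h : IsNearMinimizer ξm ξp m p ε R τ σ y) (hm : 0 < m) (hp : ∀ s, m ≤ p.1 s)
    {t : ℝ} (ht0 : 0 ≤ t) (ht : t ≤ σ) :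
    homExp p ^ 2 / (1 + homExp p ^ 2) * ‖y t‖ ^ homExp p *
      (1 - inner ℝ (y t) (ξp : Conf n) / ‖y t‖) ≤ 2 := by
  have hβ := homExp_pos p
  have hL := rayCost_pos hm p
  have hl : -τ ≤ 0 := neg_nonpos.mpr h.left_nonneg
  -- The largest coefficient of the angular term allowed by `calib_coeff_le`.
  set c := homExp p ^ 2 / (1 + homExp p ^ 2) with hc
  have hc0 : 0 ≤ c := by positivity
  have hc1 : c * (1 + homExp p ^ 2) = homExp p ^ 2 := by rw [hc]; field_simp
  have hv := h.isH1.hasVel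
  -- The radial bound is used on `[-τ, 0]` and `[0, t]`, the angular one on `[t, σ]`. In their sum
  -- the terms in `R` cancel against the upper bound `2L R^β`, leaving `c r^β (1 - cos) ≤ 2`.
  have b1 := (hv.mono le_rfl h.right_nonneg).isH1.ofReal_radial_le_action (p := p) hm hp hl
  have b2 := (hv.mono hl ht).isH1.ofReal_radial_le_action (p := p) hm hp ht0
  have b3 := (hv.mono (hl.trans ht0) le_rfl).isH1.ofReal_angular_le_action (p := p) hm hp ht hc0
    hc1.le (norm_eq_of_mem_sphere ξp) (Or.inl ⟨rfl, rfl⟩) h.radius_pos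
    (h.ne_zero ⟨hl.trans ht0, ht⟩) h.right_end
  have hsum : action p (-τ) σ y = action p (-τ) 0 y + (action p 0 t y + action p t σ y) := by
    rw [action_add p y hl h.right_nonneg, action_add p y ht0 ht]
  have htot := h.action_le
  have hR0 : 0 ≤ 2 * rayCost m p * R ^ homExp p := by have := h.radius_pos; positivity
  have hfin : action p (-τ) σ y ≠ ⊤ := ne_top_of_le_ne_top ENNReal.ofReal_ne_top htot
  have f1 : action p (-τ) 0 y ≠ ⊤ := ne_top_of_le_ne_top hfin (hsum ▸ le_self_add)
  have f23 : action p 0 t y + action p t σ y ≠ ⊤ := ne_top_of_le_ne_top hfin (hsum ▸ le_add_self)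
  have f2 : action p 0 t y ≠ ⊤ := ne_top_of_le_ne_top f23 le_self_add
  have f3 : action p t σ y ≠ ⊤ := ne_top_of_le_ne_top f23 le_add_self
  have h1 := ENNReal.ofReal_le_iff_le_toReal f1 |>.mp b1
  have h2 := ENNReal.ofReal_le_iff_le_toReal f2 |>.mp b2
  have h3 := ENNReal.ofReal_le_iff_le_toReal f3 |>.mp b3
  have h4 := ENNReal.toReal_le_of_le_ofReal hR0 htot
  rw [hsum, ENNReal.toReal_add f1 f23, ENNReal.toReal_add f2 f3] at h4
  have hnl : ‖y (-τ)‖ = R := by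
    rw [h.left_end, norm_smul, norm_eq_of_mem_sphere, mul_one, Real.norm_of_nonneg h.radius_pos.le]
  rw [hnl, h.norm_zero, Real.one_rpow] at h1
  rw [h.norm_zero, Real.one_rpow] at h2
  change rayCost m p * _ ≤ _ at h1 h2 h3
  have h1' := mul_le_mul_of_nonneg_left (neg_abs_le (1 - R ^ homExp p)) hL.le
  have h2' := mul_le_mul_of_nonneg_left (le_abs_self (‖y t‖ ^ homExp p - 1)) hL.le
  refine le_of_mul_le_mul_left ?_ hL
  nlinarith

end IsNearMinimizer

/-! ### Compactness -/

/-- A pointwise bounded sequence of paths, equi-Hölder on bounded intervals, has a pointwise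
convergent subsequence. -/
theorem exists_subseq_tendsto_pointwise {E : Type*} [NormedAddCommGroup E] [ProperSpace E]
    (f : ℕ → ℝ → E) (B K : ℝ → ℝ) (hB : ∀ j t, ‖f j t‖ ≤ B t)
    (hK : ∀ j T, ∀ s ∈ Icc (-T) T, ∀ t ∈ Icc (-T) T, ‖f j t - f j s‖ ^ 2 ≤ K T * |t - s|) :
    ∃ (φ : ℕ → ℕ) (x : ℝ → E), StrictMono φ ∧
      ∀ t, Tendsto (fun j => f (φ j) t) atTop (𝓝 (x t)) := by
  -- Sequential compactness of the countable product gives convergence at the rationals; the Hölder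
  -- bound extends it to all times.
  have hcomp : IsCompact (Set.pi univ fun q : ℚ => Metric.closedBall (0 : E) (B q)) :=
    isCompact_univ_pi fun q => isCompact_closedBall _ _
  obtain ⟨g, -, φ, hφ, hlim⟩ := hcomp.tendsto_subseq (x := fun j (q : ℚ) => f j q)
    (fun j q _ => by simpa using hB j q)
  rw [tendsto_pi_nhds] at hlim
  have hcau : ∀ t, CauchySeq fun j => f (φ j) t := by
    intro t
    rw [Metric.cauchySeq_iff']
    intro ε hε
    set T := |t| + 1 with hT
    set κ := |K T| + 1 with hκ
    have hκ0 : 0 < κ := by positivity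
    obtain ⟨q, hq1, hq2⟩ := exists_rat_btwn (show t < t + min 1 ((ε / 4) ^ 2 / κ) by
      have : 0 < min 1 ((ε / 4) ^ 2 / κ) := by positivity
      linarith)
    have hq3 : (q : ℝ) - t ≤ 1 := by linarith [min_le_left 1 ((ε / 4) ^ 2 / κ)]
    have hq4 : (q : ℝ) - t ≤ (ε / 4) ^ 2 / κ := by linarith [min_le_right 1 ((ε / 4) ^ 2 / κ)]
    have htT : t ∈ Icc (-T) T := ⟨by linarith [neg_abs_le t], by linarith [le_abs_self t]⟩
    have hqT : (q : ℝ) ∈ Icc (-T) T := ⟨by linarith [neg_abs_le t], by linarith [le_abs_self t]⟩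
    have hclose : ∀ j, ‖f j q - f j t‖ ≤ ε / 4 := by
      intro j
      refine abs_le_of_sq_le_sq' ?_ (by positivity) |>.2
      refine (hK j T t htT q hqT).trans ?_
      rw [abs_of_nonneg (by linarith : 0 ≤ (q : ℝ) - t)]
      calc K T * (q - t) ≤ κ * (q - t) := by
            have h1 : 0 ≤ (q : ℝ) - t := by linarith
            have h2 : K T ≤ κ := by linarith [le_abs_self (K T)]
            gcongr
        _ ≤ κ * ((ε / 4) ^ 2 / κ) := by gcongr
        _ = (ε / 4) ^ 2 := by field_simp
    obtain ⟨N, hN⟩ := Metric.cauchySeq_iff'.mp (hlim q).cauchySeq (ε / 4) (by positivity)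
    refine ⟨N, fun j hj => ?_⟩
    have h1 := hN j hj
    simp only [Function.comp, dist_eq_norm] at h1
    have e : f (φ j) t - f (φ N) t = (f (φ j) q - f (φ N) q) - (f (φ j) q - f (φ j) t) +
        (f (φ N) q - f (φ N) t) := by abel
    rw [dist_eq_norm, e]
    have h2 := norm_add_le ((f (φ j) q - f (φ N) q) - (f (φ j) q - f (φ j) t))
      (f (φ N) q - f (φ N) t)
    have h3 := norm_sub_le (f (φ j) q - f (φ N) q) (f (φ j) q - f (φ j) t)
    linarith [hclose (φ j), hclose (φ N)]
  choose x hx using fun t => cauchySeq_tendsto_of_complete (hcau t)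
  exact ⟨φ, x, hφ, hx⟩

/-- `x` is a pointwise limit of nearly minimal paths, on intervals invading the real line. -/
def IsLimitOfNearMinimizers (ξm ξp : USphere n) (m : ℝ) (p : C2Sphere n × Ioo (0 : ℝ) 2)
    (x : ℝ → Conf n) : Prop :=
  ∃ (pj : ℕ → C2Sphere n × Ioo (0 : ℝ) 2) (ε R τ σ : ℕ → ℝ) (y : ℕ → ℝ → Conf n),
    (∀ j, IsNearMinimizer ξm ξp m (pj j) (ε j) (R j) (τ j) (σ j) (y j)) ∧
    (∀ j s, m ≤ (pj j).1 s) ∧ Tendsto pj atTop (𝓝 p) ∧ (∀ j, 0 ≤ ε j) ∧ Tendsto ε atTop (𝓝 0) ∧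
    Tendsto τ atTop atTop ∧ Tendsto σ atTop atTop ∧ ∀ t, Tendsto (fun j => y j t) atTop (𝓝 (x t))

theorem exists_isLimitOfNearMinimizers {ξm ξp : USphere n} {Vmin : ℝ} (hξ : ξp ≠ ξm)
    (hVmin : 0 < Vmin) {V : classP ξm ξp Vmin} (hV : V ∉ regionOut ξm ξp Vmin)
    (hcl : V ∈ closure (regionOut ξm ξp Vmin)) :
    ∃ x, IsLimitOfNearMinimizers ξm ξp Vmin V.1 x := by
  obtain ⟨W, R, τ, σ, y, hW, hR, hy⟩ := exists_isNearMinimizer_seq hξ hVmin hV hcl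
  have hWp : Tendsto (fun j => (W j).1) atTop (𝓝 V.1) := (continuous_subtype_val.tendsto V).comp hW
  set N := ‖(jet2 V.1.1).1‖ + Vmin with hN
  set β := homExp V.1 / 2 with hβ
  have hβ0 : 0 < β := half_pos (homExp_pos _)
  obtain ⟨k, hk⟩ := eventually_atTop.mp (hWp.eventually
    ((eventually_bounds hVmin (classP_min V)).and (eventually_homExp_gt V.1)))
  have hε0 : ∀ j : ℕ, (0 : ℝ) ≤ 1 / ((j : ℝ) + 1) := fun j => by positivity
  have hε1 : ∀ j : ℕ, (1 : ℝ) / ((j : ℝ) + 1) ≤ 1 := fun j => by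
    rw [div_le_one (by positivity)]; simp
  set D := 2 * (3 * (√(2 * N) / β) + 1) with hD
  have hD0 : 0 < D := by positivity
  have hRσ : ∀ j ≥ k, R j ≤ 2 + D * σ j := fun j hj =>
    (hy j).radius_le (hε0 j) (hε1 j) (fun s => ((hk j hj).1 s).1) (fun s => ((hk j hj).1 s).2) hβ0
      (hk j hj).2.le
  have hRτ : ∀ j ≥ k, R j ≤ 2 + D * τ j := fun j hj =>
    (hy j).reverse.radius_le (hε0 j) (hε1 j) (fun s => ((hk j hj).1 s).1)
      (fun s => ((hk j hj).1 s).2) hβ0 (hk j hj).2.le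
  have hRt : Tendsto R atTop atTop := tendsto_atTop_mono hR tendsto_natCast_atTop_atTop
  have htend : ∀ θ : ℕ → ℝ, (∀ j ≥ k, R j ≤ 2 + D * θ j) → Tendsto θ atTop atTop := by
    intro θ hθ
    refine tendsto_atTop_mono' atTop ?_ ((tendsto_atTop_add_const_right _ (-2) hRt).atTop_div_const hD0)
    filter_upwards [eventually_ge_atTop k] with j hj
    rw [div_le_iff₀ hD0]
    linarith [hθ j hj]
  have hσt := htend σ hRσ
  have hτt := htend τ hRτ
  -- Clamping the time prolongs each path by constants to the whole line without spoiling the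
  -- bounds; at a fixed time it has no effect for late indices.
  set cl : ℕ → ℝ → ℝ := fun j t => max (-τ j) (min (σ j) t) with hcl'
  have hclm : ∀ j t, cl j t ∈ Icc (-τ j) (σ j) := fun j t =>
    ⟨le_max_left _ _, max_le (by linarith [(hy j).left_nonneg, (hy j).right_nonneg]) (min_le_left _ _)⟩
  have hclabs : ∀ j t, |cl j t| ≤ |t| := by
    intro j t
    have h1 := (hy j).left_nonneg
    have h2 := (hy j).right_nonneg
    rw [abs_le]
    constructor
    · refine le_max_of_le_right (le_min ?_ (neg_abs_le t))
      linarith [abs_nonneg t]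
    · refine max_le ?_ ((min_le_right _ _).trans (le_abs_self t))
      linarith [abs_nonneg t]
  have hclmono : ∀ j, Monotone (cl j) := fun j s t hst =>
    max_le_max le_rfl (min_le_min le_rfl hst)
  have hclip : ∀ j s t, |cl j t - cl j s| ≤ |t - s| := by
    intro j s t
    have h1 := abs_max_sub_max_le_max (-τ j) (min (σ j) t) (-τ j) (min (σ j) s)
    have h2 := abs_min_sub_min_le_max (σ j) t (σ j) s
    rw [sub_self, abs_zero, max_eq_right (a := (0 : ℝ)) (abs_nonneg _)] at h1 h2
    exact h1.trans h2
  have hbound : ∀ j t, ‖y (j + k) (cl (j + k) t)‖ ≤ 2 + D * |t| := by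
    intro j t
    have hj : j + k ≥ k := Nat.le_add_left _ _
    refine ((hy (j + k)).norm_le (hε0 _) (hε1 _) (fun s => ((hk _ hj).1 s).1)
      (fun s => ((hk _ hj).1 s).2) hβ0 (hk _ hj).2.le (hclm _ t)).trans ?_
    exact add_le_add le_rfl (mul_le_mul_of_nonneg_left (hclabs _ t) hD0.le)
  have hholder : ∀ j T, ∀ s ∈ Icc (-T) T, ∀ t ∈ Icc (-T) T,
      ‖y (j + k) (cl (j + k) t) - y (j + k) (cl (j + k) s)‖ ^ 2 ≤
        2 * (√(2 * N) / β * (2 * (2 + D * T)) + 1) * |t - s| := by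
    intro j T
    have hj : j + k ≥ k := Nat.le_add_left _ _
    have key : ∀ s ∈ Icc (-T) T, ∀ t ∈ Icc (-T) T, s ≤ t →
      ‖y (j + k) (cl (j + k) t) - y (j + k) (cl (j + k) s)‖ ^ 2 ≤
        2 * (√(2 * N) / β * (2 * (2 + D * T)) + 1) * |t - s| := by
      intro s hs t ht hst
      refine ((hy (j + k)).norm_sub_sq_le (hε0 _) (hε1 _) (fun s => ((hk _ hj).1 s).1)
        (fun s => ((hk _ hj).1 s).2) hβ0 (hk _ hj).2.le (hclm _ s).1 (hclmono _ hst)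
        (hclm _ t).2).trans ?_
      have h1 : cl (j + k) t - cl (j + k) s ≤ |t - s| := (le_abs_self _).trans (hclip _ s t)
      have h2 : ‖y (j + k) (cl (j + k) s)‖ ≤ 2 + D * T := (hbound j s).trans (by
        gcongr; exact abs_le.mpr hs)
      have h3 : ‖y (j + k) (cl (j + k) t)‖ ≤ 2 + D * T := (hbound j t).trans (by
        gcongr; exact abs_le.mpr ht)
      have h4 : 0 ≤ cl (j + k) t - cl (j + k) s := sub_nonneg.mpr (hclmono _ hst)
      have h5 : 0 ≤ 2 + D * T := (norm_nonneg _).trans h2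
      rw [mul_right_comm]
      gcongr
      linarith
    intro s hs t ht
    rcases le_total s t with h | h
    · exact key s hs t ht h
    · rw [norm_sub_rev, abs_sub_comm]; exact key t ht s hs h
  obtain ⟨φ, x, hφ, hx⟩ := exists_subseq_tendsto_pointwise
    (fun j t => y (j + k) (cl (j + k) t)) _ _ hbound hholder
  have hψ : Tendsto (fun j => φ j + k) atTop atTop :=
    (tendsto_add_atTop_nat k).comp hφ.tendsto_atTop
  refine ⟨x, fun j => (W (φ j + k)).1, _, _, _, _, fun j => y (φ j + k), fun j => hy (φ j + k),
    fun j s => classP_min _ s, hWp.comp hψ, fun j => hε0 _,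
    (tendsto_one_div_add_atTop_nhds_zero_nat (𝕜 := ℝ)).comp hψ, hτt.comp hψ, hσt.comp hψ,
    fun t => ?_⟩
  refine (hx t).congr' ?_
  filter_upwards [(hσt.comp hψ).eventually_ge_atTop t, (hτt.comp hψ).eventually_ge_atTop (-t)]
    with j h1 h2
  simp only [Function.comp] at h1 h2
  have : cl (φ j + k) t = t := by
    simp only [hcl']
    rw [min_eq_right h1, max_eq_right (by linarith)]
  rw [this]

/-! ### The limit is a parabolic Morse minimizer -/

namespace IsLimitOfNearMinimizers

variable {ξm ξp : USphere n} {m : ℝ} {p : C2Sphere n × Ioo (0 : ℝ) 2} {x : ℝ → Conf n}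

theorem reverse (h : IsLimitOfNearMinimizers ξm ξp m p x) :
    IsLimitOfNearMinimizers ξp ξm m p (fun t => x (-t)) := by
  obtain ⟨pj, ε, R, τ, σ, y, hy, hm, hp, hε0, hε, hτ, hσ, hx⟩ := h
  exact ⟨pj, ε, R, σ, τ, fun j t => y j (-t), fun j => (hy j).reverse, hm, hp, hε0, hε, hσ, hτ,
    fun t => hx (-t)⟩

theorem norm_zero (h : IsLimitOfNearMinimizers ξm ξp m p x) : ‖x 0‖ = 1 := by
  obtain ⟨pj, ε, R, τ, σ, y, hy, hm, hp, hε0, hε, hτ, hσ, hx⟩ := h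
  refine tendsto_nhds_unique (hx 0).norm ?_
  simp [fun j => (hy j).norm_zero]

theorem one_le_norm (h : IsLimitOfNearMinimizers ξm ξp m p x) (t : ℝ) : 1 ≤ ‖x t‖ := by
  obtain ⟨pj, ε, R, τ, σ, y, hy, hm, hp, hε0, hε, hτ, hσ, hx⟩ := h
  refine ge_of_tendsto (hx t).norm ?_
  filter_upwards [hσ.eventually_ge_atTop t, hτ.eventually_ge_atTop (-t)] with j h1 h2
  exact (hy j).one_le_norm t ⟨by linarith, h1⟩

theorem ne_zero (h : IsLimitOfNearMinimizers ξm ξp m p x) (t : ℝ) : x t ≠ 0 :=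
  norm_pos_iff.mp (zero_lt_one.trans_le (h.one_le_norm t))

/-- A competitor for the limit becomes one for `y j`: it keeps its cost up to `η` under the
approximating potential, and short segments join its ends to those of `y j` at vanishing cost. Near
minimality and lower semicontinuity conclude. -/
theorem isH1_and_action_le_add (h : IsLimitOfNearMinimizers ξm ξp m p x) (hm : 0 < m)
    (hp : ∀ s, m ≤ p.1 s) {a b C η : ℝ} (hab : a ≤ b) (hC : JoinedAtCost p univ (x a) (x b) C)
    (hη : 0 < η) : IsH1 a b x ∧ action p a b x ≤ ENNReal.ofReal (C + η) := by
  have hxa := h.ne_zero a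
  have hxb := h.ne_zero b
  have hx0 := h.ne_zero
  have hx1 := h.one_le_norm
  obtain ⟨pj, ε, R, τ, σ, y, hy, -, hpj, hε0, hε, hτ, hσ, hx⟩ := h
  set N := ‖(jet2 p.1).1‖ + m with hN
  have hN0 : 0 ≤ N := by positivity
  set κ := 1 / 2 + 16 * N with hκ
  have hκ0 : 0 ≤ κ := by positivity
  have hnear : ∀ t, ∀ᶠ j in atTop, ‖y j t - x t‖ ≤ 1 / 2 := by
    intro t
    have h1 : Tendsto (fun j => ‖y j t - x t‖) atTop (𝓝 0) :=
      tendsto_iff_norm_sub_tendsto_zero.mp (hx t)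
    exact (h1.eventually (gt_mem_nhds (by norm_num : (0 : ℝ) < 1 / 2))).mono fun _ hj => hj.le
  set Q : ℕ → ℝ := fun j => κ * ‖y j a - x a‖ + (C + η) + κ * ‖y j b - x b‖ + ε j with hQ
  have hQlim : Tendsto Q atTop (𝓝 (C + η)) := by
    have h1 := (tendsto_iff_norm_sub_tendsto_zero.mp (hx a)).const_mul κ
    have h2 := (tendsto_iff_norm_sub_tendsto_zero.mp (hx b)).const_mul κ
    simpa using ((h1.add_const (C + η)).add h2).add hε
  have hQ0 : ∀ j, 0 ≤ Q j := fun j => by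
    have h1 := hC.1
    have h2 := hε0 j
    simp only [hQ]; positivity
  have hev : ∀ᶠ j in atTop, -τ j ≤ a ∧ b ≤ σ j ∧ action (pj j) a b (y j) ≤ ENNReal.ofReal (Q j) := by
    filter_upwards [hτ.eventually_ge_atTop (-a), hσ.eventually_ge_atTop b, hnear a, hnear b,
      hpj.eventually (hC.eventually hm hp hxa hxb hη), hpj.eventually (eventually_bounds hm hp)]
      with j h1 h2 h3 h4 h5 h6
    have ha : -τ j ≤ a := by linarith
    refine ⟨ha, h2, ?_⟩
    have J1 := (JoinedAtCost.of_near hN0 (fun s => (h6 s).2) (hx1 a) h3).symm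
    have J3 := JoinedAtCost.of_near hN0 (fun s => (h6 s).2) (hx1 b) h4
    exact (hy j).near_minimal a b ha hab h2 _ ((J1.trans h5).trans J3)
  obtain ⟨k, hk⟩ := eventually_atTop.mp hev
  have hsh : Tendsto (fun j => j + k) atTop atTop := tendsto_add_atTop_nat k
  have hkj : ∀ j, k ≤ j + k := fun j => Nat.le_add_left _ _
  exact action_le_of_tendsto (pj := fun j => pj (j + k)) (y := fun j => y (j + k))
    (Q := fun j => Q (j + k)) (hpj.comp hsh) hab
    (fun j => ((hy (j + k)).isH1.hasVel.mono (hk _ (hkj j)).1 (hk _ (hkj j)).2.1).isH1)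
    (fun j t ht => (hy (j + k)).ne_zero
      ⟨(hk _ (hkj j)).1.trans ht.1, ht.2.trans (hk _ (hkj j)).2.1⟩)
    (fun t _ => hx0 t) (fun t _ => (hx t).comp hsh) (hQlim.comp hsh) (fun j => hQ0 _)
    (fun j => (hk _ (hkj j)).2.2)

theorem isH1 (h : IsLimitOfNearMinimizers ξm ξp m p x) (hm : 0 < m) (hp : ∀ s, m ≤ p.1 s)
    {a b : ℝ} (hab : a ≤ b) : IsH1 a b x :=
  (h.isH1_and_action_le_add hm hp hab (JoinedAtCost.through_zero (h.ne_zero a) (h.ne_zero b)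
    fun s => hm.trans_le (hp s)) one_pos).1

theorem action_le (h : IsLimitOfNearMinimizers ξm ξp m p x) (hm : 0 < m) (hp : ∀ s, m ≤ p.1 s)
    {a b C : ℝ} (hab : a ≤ b) (hC : JoinedAtCost p univ (x a) (x b) C) :
    action p a b x ≤ ENNReal.ofReal C := by
  have hlim : Tendsto (fun η : ℝ => ENNReal.ofReal (C + η)) (𝓝[>] 0) (𝓝 (ENNReal.ofReal C)) := by
    have hc : Continuous fun η : ℝ => ENNReal.ofReal (C + η) :=
      ENNReal.continuous_ofReal.comp (continuous_const.add continuous_id)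
    simpa using (hc.tendsto 0).mono_left nhdsWithin_le_nhds
  refine ge_of_tendsto hlim ?_
  filter_upwards [self_mem_nhdsWithin] with η hη
  exact (h.isH1_and_action_le_add hm hp hab hC hη).2

/-- If `‖x t‖ < M` at arbitrarily late times, the action on `[0, t]` stays below a constant `Q`.
Cauchy–Schwarz then gives `‖x‖ ≤ B√t` on `[0, t]`, so the potential energy is at least a multiple of
`t · t^(-α/2) = t^β`, which is unbounded. -/
theorem tendsto_norm_atTop (h : IsLimitOfNearMinimizers ξm ξp m p x) (hm : 0 < m)
    (hp : ∀ s, m ≤ p.1 s) : Tendsto (fun t => ‖x t‖) atTop atTop := by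
  by_contra hcon
  rw [tendsto_atTop] at hcon
  push Not at hcon
  obtain ⟨M, hM⟩ := hcon
  have hα0 : 0 < (p.2 : ℝ) := p.2.2.1
  have hβ := homExp_pos p
  set N := ‖(jet2 p.1).1‖ with hN
  set A := √(2 * N) / homExp p with hA
  have hA0 : 0 ≤ A := by positivity
  set Q := A * (1 + |M|) with hQ
  have hQ0 : 0 ≤ Q := by positivity
  set B := 1 + √(2 * Q) with hB
  have hB0 : 0 < B := by positivity
  have hbound : ∀ t : ℝ, 1 ≤ t → ‖x t‖ < M → t ^ homExp p ≤ Q / (m * B ^ (-(p.2 : ℝ))) := by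
    intro t ht htM
    have ht0 : 0 ≤ t := by linarith
    have hJ := JoinedAtCost.through_zero_of_le (h.ne_zero 0) (h.ne_zero t)
      (fun s => hm.trans_le (hp s)) (fun s => C2Sphere.le_norm_jet2 p.1 s)
    have hpow : ‖x t‖ ^ homExp p ≤ |M| := by
      have h1 : ‖x t‖ ^ homExp p ≤ ‖x t‖ := by
        simpa using Real.rpow_le_rpow_of_exponent_le (h.one_le_norm t) (homExp_lt_one p).le
      linarith [le_abs_self M]
    have hact : action p 0 t x ≤ ENNReal.ofReal Q := by
      refine h.action_le hm hp ht0 (hJ.mono subset_rfl ?_)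
      rw [h.norm_zero, Real.one_rpow]
      exact mul_le_mul_of_nonneg_left (add_le_add le_rfl hpow) hA0
    have hH := h.isH1 hm hp ht0
    have hst : 0 < √t := Real.sqrt_pos.mpr (by linarith)
    have hst1 : 1 ≤ √t := Real.one_le_sqrt.mpr ht
    have hnorm : ∀ s ∈ Icc 0 t, ‖x s‖ ≤ B * √t := by
      intro s hs
      have h1 := (hH.hasVel.mono le_rfl hs.2).isH1.norm_sub_sq_le (p := p) hs.1 hQ0
        ((action_mono p x le_rfl hs.2).trans hact)
      have h2 : ‖x s - x 0‖ ≤ √(2 * Q) * √t := by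
        rw [← Real.sqrt_mul (by positivity)]
        refine Real.le_sqrt_of_sq_le (h1.trans ?_)
        nlinarith [hs.2, hs.1]
      have h3 := norm_sub_norm_le (x s) (x 0)
      rw [h.norm_zero] at h3
      rw [hB, add_mul, one_mul]
      linarith
    have h4 := (ENNReal.ofReal_le_ofReal_iff hQ0).mp
      ((ofReal_mul_le_action (p := p) hm hp (mul_pos hB0 hst) hnorm).trans hact)
    have hsplit : t * (√t) ^ (-(p.2 : ℝ)) = t ^ homExp p := by
      have htp : 0 < t := by linarith
      rw [Real.sqrt_eq_rpow, ← Real.rpow_mul ht0]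
      nth_rewrite 1 [← Real.rpow_one t]
      rw [← Real.rpow_add htp]
      congr 1
      unfold homExp; ring
    rw [sub_zero, Real.mul_rpow hB0.le hst.le] at h4
    rw [le_div_iff₀ (by positivity), ← hsplit]
    linarith
  have hlarge := (tendsto_rpow_atTop hβ).eventually_gt_atTop (Q / (m * B ^ (-(p.2 : ℝ))))
  obtain ⟨t, h1, h2, h3⟩ := (hM.and_eventually (hlarge.and (eventually_ge_atTop 1))).exists
  exact absurd (hbound t h3 (by simpa using h1)) (not_le.mpr h2)

theorem angle_le (h : IsLimitOfNearMinimizers ξm ξp m p x) (hm : 0 < m) {t : ℝ} (ht : 0 ≤ t) :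
    homExp p ^ 2 / (1 + homExp p ^ 2) * ‖x t‖ ^ homExp p *
      (1 - inner ℝ (x t) (ξp : Conf n) / ‖x t‖) ≤ 2 := by
  have hx0 := h.ne_zero t
  have hβ := homExp_pos p
  obtain ⟨pj, ε, R, τ, σ, y, hy, hpm, hpj, hε0, hε, hτ, hσ, hx⟩ := h
  have hβj : Tendsto (fun j => homExp (pj j)) atTop (𝓝 (homExp p)) :=
    (continuous_homExp.tendsto p).comp hpj
  have hnj := (hx t).norm
  have hlim := (((hβj.pow 2).div ((hβj.pow 2).const_add 1) (by positivity)).mul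
    (hnj.rpow hβj (Or.inl (norm_ne_zero_iff.mpr hx0)))).mul
    (((hx t).inner (tendsto_const_nhds (x := (ξp : Conf n)))).div hnj
      (norm_ne_zero_iff.mpr hx0) |>.const_sub 1)
  refine le_of_tendsto hlim ?_
  filter_upwards [hσ.eventually_ge_atTop t] with j hj
  exact (hy j).angle_le hm (hpm j) ht hj

/-- The squared distance of the directions is `2(1 - cos)`, at most `4/(c r^β)` by `angle_le`, and
`r → ∞`. -/
theorem tendsto_direction_atTop (h : IsLimitOfNearMinimizers ξm ξp m p x) (hm : 0 < m)
    (hp : ∀ s, m ≤ p.1 s) :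
    Tendsto (fun t => ‖x t‖⁻¹ • x t) atTop (𝓝 (ξp : Conf n)) := by
  have hβ := homExp_pos p
  set c := homExp p ^ 2 / (1 + homExp p ^ 2) with hc
  have hc0 : 0 < c := by positivity
  have hpow : Tendsto (fun t => c * ‖x t‖ ^ homExp p) atTop atTop :=
    ((tendsto_rpow_atTop hβ).comp (h.tendsto_norm_atTop hm hp)).const_mul_atTop hc0
  have hsq : ∀ t, ‖‖x t‖⁻¹ • x t - ξp‖ ^ 2 = 2 * (1 - inner ℝ (x t) (ξp : Conf n) / ‖x t‖) := by
    intro t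
    have hn : ‖x t‖ ≠ 0 := norm_ne_zero_iff.mpr (h.ne_zero t)
    rw [norm_sub_sq_real, norm_smul, norm_inv, norm_norm, inv_mul_cancel₀ hn,
      norm_eq_of_mem_sphere, real_inner_smul_left]
    ring
  have hlim : Tendsto (fun t => √(4 / (c * ‖x t‖ ^ homExp p))) atTop (𝓝 0) := by
    have := (Real.continuous_sqrt.tendsto 0).comp (hpow.const_div_atTop 4)
    rwa [Real.sqrt_zero] at this
  rw [tendsto_iff_norm_sub_tendsto_zero]
  refine squeeze_zero' (Eventually.of_forall fun _ => norm_nonneg _) ?_ hlim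
  filter_upwards [eventually_ge_atTop 0] with t ht
  have hr : 0 < ‖x t‖ := norm_pos_iff.mpr (h.ne_zero t)
  refine Real.le_sqrt_of_sq_le ?_
  rw [hsq, le_div_iff₀ (by positivity)]
  linarith [h.angle_le hm ht]

theorem isParabolicMorseMinimizer (h : IsLimitOfNearMinimizers ξm ξp m p x) (hm : 0 < m)
    (hp : ∀ s, m ≤ p.1 s) : IsParabolicMorseMinimizer ξm ξp p x where
  h1_loc _ _ hab := h.isH1 hm hp hab.le
  min_pos := ⟨0, by rw [h.norm_zero]; exact one_pos, fun t => by
    rw [h.norm_zero]; exact h.one_le_norm t⟩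
  norm_atBot := by
    simpa [Function.comp_def] using (h.reverse.tendsto_norm_atTop hm hp).comp tendsto_neg_atBot_atTop
  norm_atTop := h.tendsto_norm_atTop hm hp
  dir_atBot := by
    simpa [Function.comp_def] using
      (h.reverse.tendsto_direction_atTop hm hp).comp tendsto_neg_atBot_atTop
  dir_atTop := h.tendsto_direction_atTop hm hp
  minimal a b a' b' hab hab' z hz hza hzb := by
    by_cases hfin : action p a' b' z = ⊤
    · rw [hfin]; exact le_top
    have hJ := JoinedAtCost.of_path (p := p) hab'.le hz (K := univ) (fun _ _ => mem_univ _)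
      ENNReal.toReal_nonneg (ENNReal.ofReal_toReal hfin).ge
    rw [hza, hzb] at hJ
    exact (h.action_le hm hp hab.le hJ).trans (ENNReal.ofReal_toReal hfin).le

end IsLimitOfNearMinimizers

end MorseMinimizers

theorem mainTheorem1 (n : ℕ) (hn : 1 ≤ n) (ξm ξp : USphere n) (hξ : ξp ≠ ξm)
    (Vmin : ℝ) (hVmin : 0 < Vmin) (V : classP ξm ξp Vmin) :
    (∃ x : ℝ → Conf n, IsParabolicMorseMinimizer ξm ξp V.1 x) ↔ V ∈ interfacePi ξm ξp Vmin := by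
  rw [mem_interfacePi_iff hξ hVmin]
  constructor
  · rintro ⟨x, hx⟩
    exact ⟨hx.notMem_regionOut hVmin, hx.mem_closure_regionOut hξ hVmin⟩
  · rintro ⟨hV, hcl⟩
    obtain ⟨x, hx⟩ := exists_isLimitOfNearMinimizers hξ hVmin hV hcl
    exact ⟨x, hx.isParabolicMorseMinimizer hVmin (classP_min V)⟩
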